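/- Let $d\ge 1$, $\alpha\in\mathbb R$, $\lambda>1$. Let $\chi\in\mathcal D(\mathbb R^d)$ and $\varphi\in\mathcal D(\mathbb R^d\setminus\{0\})$ be radial and nonnegative with $\chi(\xi)+\sum_{q\ge0}\varphi(2^{-q}\xi)=1$ for all $\xi$, $\operatorname{supp}\chi\cap\operatorname{supp}\varphi(2^{-q}\cdot)=\varnothing$ for $q\ge1$, and $\operatorname{supp}\varphi(2^{-j}\cdot)\cap\operatorname{supp}\varphi(2^{-k}\cdot)=\varnothing$ for $|j-k|\ge2$. Put $\Delta_{-1}=\chi(D)$, $\Delta_q=\varphi(2^{-q}D)$ for $q\ge0$ (where $D=-i\nabla$), and for a tempered distribution $u$ $$\|u\|_{B^{s,s'}_{p,r}}=\Big\|\big(2^{qs}(|q|+1)^{s'}\|\Delta_qu\|_{L^p}\big)_{q\ge-1}\Big\|_{\ell^r},\qquad B^s_{p,r}=B^{s,0}_{p,r}.$$ Let $\mathcal R_\alpha=\frac{\partial_1}{|D|}\log^\alpha(\lambda+|D|)$ be the Fourier multiplier with symbol $m(\xi)=i\frac{\xi_1}{|\xi|}\log^\alpha(\lambda+|\xi|)$;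 for a tempered distribution $u$, $\mathcal R_\alpha u$ is the limit in $\mathcal S'$ as $R\to\infty$, when it exists for every such $\eta$ and does not depend on $\eta$, of the multipliers with symbol $m(\xi)(1-\eta(R\xi))$ applied to $u$, where $\eta\in\mathcal D(\mathbb R^d)$ equals $1$ near $0$. Let $[\mathcal R_\alpha,v\cdot\nabla]\theta=\mathcal R_\alpha(v\cdot\nabla\theta)-v\cdot\nabla(\mathcal R_\alpha\theta)$. In what follows $v:\mathbb R^d\to\mathbb R^d$ is a smooth divergence free vector field all of whose derivatives grow at most polynomially, and $\theta:\mathbb R^d\to\mathbb R$ is a smooth function. The vorticity is $\omega=\nabla v-(\nabla v)^{T}$ (for $d=2$ its operator norm is $|\partial_1v^2-\partial_2v^1|$). (1) For every $p\in[2,\infty)$ and $r\in[1,\infty]$ there is a constant $C$, depending only on $p,r$ and on the fixed data $d,\alpha,\lambda,\chi,\varphi$, such that for all such $v,\theta$ with $\nabla v\in L^p$ and $\theta\in L^p$, the tempered distributions $\mathcal R_\alpha\theta$ and $\mathcal R_\alpha(v\cdot\nabla\theta)$ exist and $$\|[\mathcal R_\alpha,v\cdot\nabla]\theta\|_{B^0_{p,r}}\le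 C\,\|\nabla v\|_{L^p}\big(\|\theta\|_{B^{0,\alpha}_{\infty,r}}+\|\theta\|_{L^p}\big).$$ (2) For every $r\in[1,\infty]$, $\rho\in(1,\infty)$ and $\epsilon>0$ there is a constant $C$, depending only on $r,\rho,\epsilon$ and on the fixed data $d,\alpha,\lambda,\chi,\varphi$, such that for all such $v,\theta$ with $\nabla v\in L^\rho$, $\omega\in L^\infty$ and $\theta\in L^\rho$, the tempered distributions $\mathcal R_\alpha\theta$ and $\mathcal R_\alpha(v\cdot\nabla\theta)$ exist and $$\|[\mathcal R_\alpha,v\cdot\nabla]\theta\|_{B^0_{\infty,r}}\le C\,(\|\omega\|_{L^\infty}+\|\omega\|_{L^\rho})\big(\|\theta\|_{B^{\epsilon}_{\infty,r}}+\|\theta\|_{L^\rho}\big).$$ In both parts the right-hand side may be infinite, with the convention $0\cdot\infty=0$. -/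

import Mathlib

open MeasureTheory Filter Topology
open scoped NNReal ENNReal SchwartzMap ContDiff LineDeriv

noncomputable section

namespace LogRiesz

/-- The Euclidean space `ℝ^d`. -/
abbrev Space (d : ℕ) := EuclideanSpace ℝ (Fin d)

/-- A pair of radial nonnegative functions `χ ∈ 𝓓(ℝ^d)`, `φ ∈ 𝓓(ℝ^d \ {0})` generating an
inhomogeneous Littlewood-Paley decomposition. -/
structure LittlewoodPaley (d : ℕ) where
  χ : Space d → ℝ
  φ : Space d → ℝ
  χ_smooth : ContDiff ℝ ∞ χ
  φ_smooth : ContDiff ℝ ∞ φ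
  χ_compact : HasCompactSupport χ
  φ_compact : HasCompactSupport φ
  φ_away : (0 : Space d) ∉ tsupport φ
  χ_radial : ∀ ξ η : Space d, ‖ξ‖ = ‖η‖ → χ ξ = χ η
  φ_radial : ∀ ξ η : Space d, ‖ξ‖ = ‖η‖ → φ ξ = φ η
  χ_nonneg : ∀ ξ, 0 ≤ χ ξ
  φ_nonneg : ∀ ξ, 0 ≤ φ ξ
  partition : ∀ ξ, HasSum (fun q : ℕ => φ ((2 : ℝ) ^ (-(q : ℤ)) • ξ)) (1 - χ ξ)
  disjoint_χ : ∀ q : ℕ, 1 ≤ q →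
    Disjoint (tsupport χ) (tsupport fun ξ => φ ((2 : ℝ) ^ (-(q : ℤ)) • ξ))
  disjoint_φ : ∀ j k : ℤ, 2 ≤ |j - k| →
    Disjoint (tsupport fun ξ => φ ((2 : ℝ) ^ (-j) • ξ)) (tsupport fun ξ => φ ((2 : ℝ) ^ (-k) • ξ))

variable {d : ℕ}

/-- The Fourier multiplier `m(D)` on tempered distributions, for a smooth symbol `m` all of whose
derivatives have at most polynomial growth, in the convention in which `D = -i∇`, so that `∂_j` is
the multiplier with symbol `i ξ_j`. Mathlib's Fourier transform is
`∫ exp (-2πi x·ξ) f x dx`, hence the factor `2π`. -/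
def multiplier (m : Space d → ℂ) : 𝓢'(Space d, ℂ) →L[ℂ] 𝓢'(Space d, ℂ) :=
  TemperedDistribution.fourierMultiplierCLM ℂ (fun ξ => m ((2 * Real.pi) • ξ))

/-- The dyadic block `Δ_q`, `q ≥ -1`: `Δ_{-1} = χ(D)` and `Δ_q = φ(2^{-q} D)` for `q ≥ 0`. -/
def block (P : LittlewoodPaley d) (q : ℤ) : 𝓢'(Space d, ℂ) →L[ℂ] 𝓢'(Space d, ℂ) :=
  multiplier (fun ξ => if q < 0 then (P.χ ξ : ℂ) else (P.φ ((2 : ℝ) ^ (-q) • ξ) : ℂ))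

/-- The `L^p` norm of a tempered distribution, equal to `∞` if it is not an `L^p` function. -/
def lpNorm (p : ℝ≥0∞) (u : 𝓢'(Space d, ℂ)) : ℝ≥0∞ :=
  ⨅ (f : Space d → ℂ) (_ : MemLp f p volume) (_ : ∀ g : 𝓢(Space d, ℂ), u g = ∫ x, g x * f x),
    eLpNorm f p volume

/-- The norm of the generalized Besov space `B^{s,s'}_{p,r}`, that is the `ℓ^r` norm over
`q ≥ -1` of `2^{qs} (|q|+1)^{s'} ‖Δ_q u‖_{L^p}`; here `q = n - 1` with `n : ℕ`. -/
def besovNorm (P : LittlewoodPaley d) (s s' : ℝ) (p r : ℝ≥0∞) (u : 𝓢'(Space d, ℂ)) : ℝ≥0∞ :=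
  eLpNorm (fun n : ℕ =>
    ENNReal.ofReal ((2 : ℝ) ^ (((n : ℝ) - 1) * s) * (|(n : ℝ) - 1| + 1) ^ s') *
      lpNorm p (block P ((n : ℤ) - 1) u)) r Measure.count

/-- The symbol `i ξ_1 |ξ|⁻¹ log^α(λ + |ξ|)` of `R_α = ∂_1 |D|⁻¹ log^α(λ + |D|)`. -/
def logRieszSymbol [NeZero d] (α lam : ℝ) (ξ : Space d) : ℂ :=
  Complex.I * (((ξ 0 / ‖ξ‖) * Real.log (lam + ‖ξ‖) ^ α : ℝ) : ℂ)

/-- `w = R_α u` for tempered distributions `u`, `w`. The symbol is singular at `ξ = 0` only, and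
`R_α u` is the limit in the space of tempered distributions, if it exists, of the multipliers in
which low frequencies are removed by `1 - η(Rξ)`, `R → ∞`, whatever the smooth compactly supported
cut-off `η` with `η = 1` near `0`. -/
def IsLogRiesz [NeZero d] (α lam : ℝ) (u w : 𝓢'(Space d, ℂ)) : Prop :=
  ∀ η : Space d → ℝ, ContDiff ℝ ∞ η → HasCompactSupport η → (∀ᶠ ξ in 𝓝 0, η ξ = 1) →
    Tendsto (fun R : ℝ =>
      multiplier (fun ξ => logRieszSymbol α lam ξ * (1 - (η (R • ξ) : ℂ))) u) atTop (𝓝 w)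

/-- The tempered distribution `v · ∇u = ∑ v_i ∂_i u`, for a smooth vector field `v` all of whose
derivatives have at most polynomial growth. -/
def advect (v : Space d → Space d) (u : 𝓢'(Space d, ℂ)) : 𝓢'(Space d, ℂ) :=
  ∑ i : Fin d, TemperedDistribution.smulLeftCLM ℂ (fun x => ((v x i : ℝ) : ℂ))
    (∂_{EuclideanSpace.single i (1 : ℝ)} u)

/-- The divergence of a differentiable vector field. -/
def divergence (v : Space d → Space d) (x : Space d) : ℝ :=
  ∑ i : Fin d, fderiv ℝ v x (EuclideanSpace.single i (1 : ℝ)) i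

/-- The vorticity `∇v - (∇v)ᵀ`. In dimension two its operator norm is `|∂_1 v_2 - ∂_2 v_1|`, in
dimension three it is `|curl v|`. -/
def vorticity (v : Space d → Space d) (x : Space d) : Space d →L[ℝ] Space d :=
  fderiv ℝ v x - ContinuousLinearMap.adjoint (fderiv ℝ v x)

/-- The tempered distribution defined by a real function in `L^p`, `p ≥ 1`. -/
def lpDist {p : ℝ≥0∞} (hp : 1 ≤ p) (θ : Space d → ℝ) (hθ : MemLp θ p volume) :
    𝓢'(Space d, ℂ) :=
  haveI : Fact (1 ≤ p) := ⟨hp⟩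
  Lp.toTemperedDistribution (hθ.ofReal (K := ℂ)).toLp

end LogRiesz

end

/-! No paraproduct decomposition is used. Number the dyadic blocks from n = 0 (low frequencies), so
that block n ≥ 1 lives at frequency 2^n, and write m for the symbol of R_α. For n ≥ 1, Δ_n [R_α,
v·∇]θ = [Δ_n R_α, v·∇]θ − [Δ_n, v·∇] R_α θ, so only commutators of v·∇ with multipliers a(D)
localized at one frequency occur. The kernel of such a multiplier, and of its products with up to
two coordinates, is dominated by a rescaled integrable profile (`KerBound`, `SymbolBound`). For m
itself the size is (n+1)^α, because the rescaled pieces of m, divided by (n+1)^α, depend smoothly on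
parameters in a compact set (`Annular.exists_bddFamily_logRieszSymbol`).

A commutator with a function f has the kernel K(z)(f(x−z) − f(x)), so each power of |z| in the
modulus of continuity of f gains a power of 2^{-n}. In part (1) the increment of v is |z| times a
mean of |∇v| over a segment, and Hölder's and Fubini's theorems give an L^p bound
(`lpNorm_comm_le`). Applied to the block Δ_j of the argument this yields the factor 2^{-|n-j|}
(`exists_commBound`). If j ≤ n, the derivative in v·∇ falls on Δ_j and costs 2^j, against the gain
2^{-n}. If j > n, div v = 0 puts that derivative on the symbol, and Δ_j is written as a divergence
of terms smaller by 2^{-j} whose derivative is integrated by parts.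

In part (2) ∇v need not be bounded. The identity recovering v from ω is localized in frequency and
applied to the increments of v. Interpolating two bounds for each block gives |v(x−z) − v(x)| ≤ C Λ
(|z| + |z|^{1−δ}), with Λ the sum of the L^∞ and L^ρ norms of ω (`exists_enorm_component_sub_le`).
The weight becomes 2^{nδ − (n−j)^+} (`exists_commBound_top`); the loss 2^{nδ} and the logarithms are
paid by 2^{jε} once δ is small.

The singularity of m at the origin is handled by a dyadic decomposition of low frequencies. At
frequency 2^{-n} the commutator is bounded by 2^{-nd/ρ} ‖θ‖_{L^ρ}, which is summable since ρ < ∞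
(with ρ = p in part (1)). Hence the low part of the commutator converges, and so does that of R_α θ
by Bernstein's inequality. R_α(v·∇θ) then exists because its low part is the low commutator plus v·∇
of the low part of R_α θ (`exists_low_limit`, `isLogRiesz_of_low`, `exists_commutator_bound`).

Finally the block estimates form a matrix inequality with entries κ^{|n−j|}, κ < 1, after the
factors (n+1)^α + (j+1)^α are absorbed into the Besov weight. Schur's test gives the bound in ℓ^r
(`eLpNorm_tsum_mul_le`, `exists_besovNorm_commutator_le`). -/

noncomputable section

namespace LogRiesz

variable {d : ℕ}

/-! ### Functions of moderate growth and the tempered distributions they represent -/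

/-- Functions which become integrable after division by a power of `1 + ‖x‖`. -/
def Moderate (f : Space d → ℂ) : Prop :=
  ∃ N : ℕ, Integrable (fun x => (((1 + ‖x‖) ^ N : ℝ)⁻¹ : ℝ) • f x)

lemma one_add_norm_pow_pos (x : Space d) (N : ℕ) : 0 < (1 + ‖x‖) ^ N := by positivity

lemma Moderate.aestronglyMeasurable {f : Space d → ℂ} (hf : Moderate f) :
    AEStronglyMeasurable f := by
  obtain ⟨N, hN⟩ := hf
  have : f = fun x => ((1 + ‖x‖) ^ N : ℝ) • ((((1 + ‖x‖) ^ N : ℝ)⁻¹ : ℝ) • f x) := by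
    ext x
    rw [smul_smul, mul_inv_cancel₀ (one_add_norm_pow_pos x N).ne', one_smul]
  rw [this]
  exact AEStronglyMeasurable.fun_smul (Continuous.aestronglyMeasurable (by fun_prop)) hN.1

lemma Moderate.of_norm_le {f : Space d → ℂ} {g : Space d → ℂ} (hg : Moderate g)
    (hf : AEStronglyMeasurable f) {C : ℝ} {k : ℕ} (h : ∀ x, ‖f x‖ ≤ C * (1 + ‖x‖) ^ k * ‖g x‖) :
    Moderate f := by
  obtain ⟨N, hN⟩ := hg
  refine ⟨N + k, (hN.norm.const_mul C).mono' (AEStronglyMeasurable.fun_smul ?_ hf)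
    (Eventually.of_forall fun x => ?_)⟩
  · exact (Continuous.inv₀ (by fun_prop)
      fun x => (one_add_norm_pow_pos x _).ne').aestronglyMeasurable
  · have h1 := one_add_norm_pow_pos x N
    have h2 := one_add_norm_pow_pos x k
    rw [norm_smul, norm_smul, pow_add, mul_inv, norm_mul, norm_inv, norm_inv,
      Real.norm_of_nonneg h1.le, Real.norm_of_nonneg h2.le]
    calc _ ≤ ((1 + ‖x‖) ^ N)⁻¹ * ((1 + ‖x‖) ^ k)⁻¹ * (C * (1 + ‖x‖) ^ k * ‖g x‖) := by
          gcongr; exact h x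
      _ = _ := by field_simp

lemma schwartz_decay (g : 𝓢(Space d, ℂ)) (N : ℕ) :
    ∃ C : ℝ, 0 ≤ C ∧ ∀ x, ‖g x‖ ≤ C * ((1 + ‖x‖) ^ N)⁻¹ := by
  refine ⟨2 ^ N * (Finset.Iic (N, 0)).sup (fun m => SchwartzMap.seminorm ℝ m.1 m.2) g,
    by positivity, fun x => ?_⟩
  have h := SchwartzMap.one_add_le_sup_seminorm_apply (𝕜 := ℝ) (m := (N, 0)) (k := N) (n := 0)
    le_rfl le_rfl g x
  rw [norm_iteratedFDeriv_zero] at h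
  rw [← div_eq_mul_inv, le_div_iff₀ (one_add_norm_pow_pos x N), mul_comm]
  exact h

lemma Moderate.integrable_mul {f : Space d → ℂ} (hf : Moderate f) (g : 𝓢(Space d, ℂ)) :
    Integrable (fun x => g x * f x) := by
  have hm := hf.aestronglyMeasurable
  obtain ⟨N, hN⟩ := hf
  obtain ⟨C, hC, h⟩ := schwartz_decay g N
  refine (hN.norm.const_mul C).mono' (g.continuous.aestronglyMeasurable.mul hm)
    (Eventually.of_forall fun x => ?_)
  have h1 := one_add_norm_pow_pos x N
  rw [norm_smul, norm_mul, norm_inv, Real.norm_of_nonneg h1.le, ← mul_assoc]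
  gcongr; exact h x

lemma Moderate.add {f g : Space d → ℂ} (hf : Moderate f) (hg : Moderate g) :
    Moderate (fun x => f x + g x) := by
  have key : ∀ {f : Space d → ℂ} {N : ℕ} (M : ℕ),
      Integrable (fun x => (((1 + ‖x‖) ^ N : ℝ)⁻¹ : ℝ) • f x) →
      Integrable (fun x => (((1 + ‖x‖) ^ (N + M) : ℝ)⁻¹ : ℝ) • f x) := by
    intro f N M h
    refine h.mono (AEStronglyMeasurable.fun_smul (Continuous.inv₀ (by fun_prop)
      fun x => (one_add_norm_pow_pos x _).ne').aestronglyMeasurable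
        (Moderate.aestronglyMeasurable ⟨N, h⟩)) (Eventually.of_forall fun x => ?_)
    rw [norm_smul, norm_smul]
    gcongr
    rw [norm_inv, norm_inv, Real.norm_of_nonneg (one_add_norm_pow_pos x _).le,
      Real.norm_of_nonneg (one_add_norm_pow_pos x _).le]
    have : (1 : ℝ) ≤ 1 + ‖x‖ := by simp
    exact inv_anti₀ (one_add_norm_pow_pos x N) (pow_le_pow_right₀ this (Nat.le_add_right N M))
  obtain ⟨N, hN⟩ := hf
  obtain ⟨M, hM⟩ := hg
  refine ⟨N + M, ?_⟩
  have h2 := key N hM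
  rw [add_comm] at h2
  refine ((key M hN).add h2).congr (Eventually.of_forall fun x => ?_)
  exact (smul_add _ _ _).symm

lemma Moderate.const_mul {f : Space d → ℂ} (hf : Moderate f) (c : ℂ) :
    Moderate (fun x => c * f x) :=
  hf.of_norm_le (hf.aestronglyMeasurable.const_mul c) (C := ‖c‖) (k := 0) (by simp)

lemma Moderate.mul {f h : Space d → ℂ} (hf : Moderate f) (hh : h.HasTemperateGrowth) :
    Moderate (fun x => h x * f x) := by
  obtain ⟨k, C, hC⟩ := hh.2 0
  refine hf.of_norm_le (hh.1.continuous.aestronglyMeasurable.mul hf.aestronglyMeasurable)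
    (C := C) (k := k) fun x => ?_
  rw [norm_mul]
  gcongr
  simpa using hC x

/-- Hölder's inequality: a high negative power of 1 + ‖x‖ belongs to the conjugate Lebesgue space.
-/
lemma moderate_of_memLp {f : Space d → ℂ} {p : ℝ≥0∞} (hp : 1 ≤ p) (hf : MemLp f p volume) :
    Moderate f := by
  have := ENNReal.HolderConjugate.inv_one_sub_inv' hp
  obtain ⟨N, hN⟩ := Measure.HasTemperateGrowth.exists_eLpNorm_lt_top (1 - p⁻¹)⁻¹
    (μ := (volume : Measure (Space d))) inferInstance
  have hN' : MemLp (fun x : Space d => ((1 + ‖x‖) ^ N : ℝ)⁻¹) (1 - p⁻¹)⁻¹ volume := by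
    refine ⟨(Continuous.inv₀ (by fun_prop)
      fun x => (one_add_norm_pow_pos x _).ne').aestronglyMeasurable, ?_⟩
    convert hN using 3 with x
    rw [Real.rpow_neg (by positivity), Real.rpow_natCast]
  refine ⟨N, ?_⟩
  exact memLp_one_iff_integrable.1 (MemLp.smul (p := (1 - p⁻¹)⁻¹) (q := p) hf hN')

/-- `f` represents the tempered distribution `u`. -/
def Represents (f : Space d → ℂ) (u : 𝓢'(Space d, ℂ)) : Prop :=
  Moderate f ∧ ∀ g : 𝓢(Space d, ℂ), u g = ∫ x, g x * f x

lemma Represents.add {f g : Space d → ℂ} {u w : 𝓢'(Space d, ℂ)} (hf : Represents f u)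
    (hg : Represents g w) : Represents (fun x => f x + g x) (u + w) := by
  refine ⟨hf.1.add hg.1, fun k => ?_⟩
  simp_rw [mul_add]
  rw [integral_add (hf.1.integrable_mul k) (hg.1.integrable_mul k), ← hf.2, ← hg.2]
  rfl

lemma Represents.const_smul {f : Space d → ℂ} {u : 𝓢'(Space d, ℂ)} (hf : Represents f u)
    (c : ℂ) : Represents (fun x => c * f x) (c • u) := by
  refine ⟨hf.1.const_mul c, fun k => ?_⟩
  simp_rw [mul_left_comm _ c]
  rw [integral_const_mul, ← hf.2]
  rfl

lemma Moderate.sub {f g : Space d → ℂ} (hf : Moderate f) (hg : Moderate g) :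
    Moderate (fun x => f x - g x) := by
  simpa [sub_eq_add_neg] using hf.add (hg.const_mul (-1))

lemma Represents.sub {f g : Space d → ℂ} {u w : 𝓢'(Space d, ℂ)} (hf : Represents f u)
    (hg : Represents g w) : Represents (fun x => f x - g x) (u - w) := by
  refine ⟨hf.1.sub hg.1, fun k => ?_⟩
  simp_rw [mul_sub]
  rw [integral_sub (hf.1.integrable_mul k) (hg.1.integrable_mul k), ← hf.2, ← hg.2]
  rfl

lemma represents_zero : Represents (fun _ => 0) (0 : 𝓢'(Space d, ℂ)) :=
  ⟨⟨0, by simp⟩, fun g => by simp⟩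

lemma Represents.smulLeft {f h : Space d → ℂ} {u : 𝓢'(Space d, ℂ)} (hf : Represents f u)
    (hh : h.HasTemperateGrowth) :
    Represents (fun x => h x * f x) (TemperedDistribution.smulLeftCLM ℂ h u) := by
  refine ⟨hf.1.mul hh, fun g => ?_⟩
  rw [TemperedDistribution.smulLeftCLM_apply_apply, hf.2]
  refine integral_congr_ae (Eventually.of_forall fun x => ?_)
  simp only [SchwartzMap.smulLeftCLM_apply_apply hh, smul_eq_mul]
  ring

lemma Moderate.locallyIntegrable {f : Space d → ℂ} (hf : Moderate f) : LocallyIntegrable f := by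
  obtain ⟨N, hN⟩ := hf
  rw [locallyIntegrable_iff]
  intro K hK
  have := (hN.integrableOn (s := K)).continuousOn_smul (f := fun x : Space d => (1 + ‖x‖) ^ N)
    (Continuous.continuousOn (by fun_prop)) hK
  refine this.congr_fun (fun x _ => ?_) hK.measurableSet
  simp only [smul_smul]
  rw [mul_inv_cancel₀ (one_add_norm_pow_pos x N).ne', one_smul]

lemma Represents.ae_eq {f g : Space d → ℂ} {u : 𝓢'(Space d, ℂ)} (hf : Represents f u)
    (hg : Represents g u) : f =ᵐ[volume] g := by
  refine ae_eq_of_integral_contDiff_smul_eq hf.1.locallyIntegrable hg.1.locallyIntegrable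
    fun k hk hc => ?_
  have hg₁ : HasCompactSupport (Complex.ofRealCLM ∘ k) := hc.comp_left rfl
  have hg₂ : ContDiff ℝ ∞ (Complex.ofRealCLM ∘ k) := by fun_prop
  have h1 := hf.2 (hg₁.toSchwartzMap hg₂)
  rw [hg.2] at h1
  simpa using h1.symm

lemma Represents.lpNorm_le {f : Space d → ℂ} {u : 𝓢'(Space d, ℂ)} (hf : Represents f u)
    (p : ℝ≥0∞) : lpNorm p u ≤ eLpNorm f p volume := by
  by_cases h : eLpNorm f p volume = ⊤
  · simp [h]
  · exact iInf₂_le_of_le f ⟨hf.1.aestronglyMeasurable, lt_top_iff_ne_top.2 h⟩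
      (iInf_le_of_le hf.2 le_rfl)

/-- Two representatives agree almost everywhere, so the infimum in `lpNorm` has only one possible
value. This is what turns pointwise estimates of functions into estimates of distributions and back.
-/
lemma Represents.lpNorm_eq {f : Space d → ℂ} {u : 𝓢'(Space d, ℂ)} (hf : Represents f u)
    {p : ℝ≥0∞} (hp : 1 ≤ p) : lpNorm p u = eLpNorm f p volume := by
  refine le_antisymm (hf.lpNorm_le p) (le_iInf₂ fun g hg => le_iInf fun h => ?_)
  exact (eLpNorm_congr_ae (hf.ae_eq ⟨moderate_of_memLp hp hg, h⟩)).le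

lemma represents_of_memLp {f : Space d → ℂ} {p : ℝ≥0∞} [Fact (1 ≤ p)] (hf : MemLp f p volume) :
    Represents f (Lp.toTemperedDistribution hf.toLp) := by
  refine ⟨moderate_of_memLp Fact.out hf, fun g => ?_⟩
  rw [Lp.toTemperedDistribution_apply]
  refine integral_congr_ae ?_
  filter_upwards [hf.coeFn_toLp] with x hx
  rw [hx, smul_eq_mul]

lemma represents_lpDist {p : ℝ≥0∞} (hp : 1 ≤ p) (θ : Space d → ℝ) (hθ : MemLp θ p volume) :
    Represents (fun x => (θ x : ℂ)) (lpDist hp θ hθ) := by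
  have : Fact (1 ≤ p) := ⟨hp⟩
  exact represents_of_memLp (hθ.ofReal (K := ℂ))

/-! ### Convolution with a Schwartz kernel -/

/-- The dilation `ξ ↦ 2πξ`. -/
def dilation (c : ℝ) (hc : c ≠ 0) : Space d ≃L[ℝ] Space d :=
  ContinuousLinearEquiv.smulLeft (Units.mk0 c hc)

@[simp] lemma dilation_apply (c : ℝ) (hc : c ≠ 0) (x : Space d) : dilation c hc x = c • x := rfl

open FourierTransform in
/-- The convolution kernel of the multiplier with symbol `b`. -/
def kernel (b : 𝓢(Space d, ℂ)) : 𝓢(Space d, ℂ) :=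
  𝓕⁻ (SchwartzMap.compCLMOfContinuousLinearEquiv ℂ
    (dilation (2 * Real.pi) (by positivity)) b)

open FourierTransform in
-- By duality the multiplier acts on test functions as the transposed convolution, hence y + z
-- instead of y − z.
lemma multiplier_test (b g : 𝓢(Space d, ℂ)) (u : 𝓢'(Space d, ℂ)) :
    ∃ h : 𝓢(Space d, ℂ), multiplier b u g = u h ∧ ∀ y, h y = ∫ z, kernel b z * g (y + z) := by
  set b' := SchwartzMap.compCLMOfContinuousLinearEquiv ℂ
    (dilation (2 * Real.pi) (by positivity)) b with hb'
  refine ⟨𝓕 (SchwartzMap.smulLeftCLM ℂ b' (𝓕⁻ g)), rfl, fun y => ?_⟩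
  have h2 := SchwartzMap.convolution_apply (ContinuousLinearMap.mul ℂ ℂ) (kernel b)
    (𝓕⁻ (𝓕⁻ g)) (-y)
  -- The inverse Fourier transform applied twice is the reflection, so the Fourier transform of a
  -- product can be read as a convolution evaluated at −y.
  have h3 : ∀ x, (𝓕⁻ (𝓕⁻ g) : 𝓢(Space d, ℂ)) (-x) = g x := by
    intro x
    rw [SchwartzMap.fourierInv_coe, Real.fourierInv_eq_fourier_neg, neg_neg,
      ← SchwartzMap.fourier_coe]
    simp
  have h4 : (𝓕 (SchwartzMap.smulLeftCLM ℂ b' (𝓕⁻ g))) y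
      = SchwartzMap.convolution (ContinuousLinearMap.mul ℂ ℂ) (kernel b) (𝓕⁻ (𝓕⁻ g)) (-y) := by
    rw [SchwartzMap.fourier_coe]
    have : SchwartzMap.convolution (ContinuousLinearMap.mul ℂ ℂ) (kernel b) (𝓕⁻ (𝓕⁻ g))
      = 𝓕⁻ (SchwartzMap.smulLeftCLM ℂ b' (𝓕⁻ g)) := by
      rw [← FourierTransform.fourierInv_fourier_eq (F := 𝓢(Space d, ℂ)) (SchwartzMap.convolution
        (ContinuousLinearMap.mul ℂ ℂ) (kernel b) (𝓕⁻ (𝓕⁻ g) : 𝓢(Space d, ℂ))),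
        SchwartzMap.fourier_convolution,
        FourierTransform.fourier_fourierInv_eq (𝓕⁻ g : 𝓢(Space d, ℂ)), kernel,
        FourierTransform.fourier_fourierInv_eq (E := 𝓢(Space d, ℂ))]
      congr 1
      ext x
      rw [SchwartzMap.pairing_apply_apply, SchwartzMap.smulLeftCLM_apply_apply
        (SchwartzMap.hasTemperateGrowth _)]
      rfl
    rw [this, SchwartzMap.fourierInv_coe, Real.fourierInv_eq_fourier_neg, neg_neg]
  rw [h4, h2, MeasureTheory.convolution_def]
  refine integral_congr_ae (Eventually.of_forall fun z => ?_)
  simp only [ContinuousLinearMap.mul_apply']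
  rw [show -y - z = -(y + z) by abel, h3]

/-- Peetre's inequality: the decay of a kernel in x − y can be traded for decay in y at the price of
growth in x. -/
lemma inv_one_add_norm_sub_le (x y : Space d) (N : ℕ) :
    ((1 + ‖x - y‖) ^ N)⁻¹ ≤ (1 + ‖x‖) ^ N * ((1 + ‖y‖) ^ N)⁻¹ := by
  rw [← div_eq_mul_inv, le_div_iff₀ (one_add_norm_pow_pos y N), inv_mul_le_iff₀
    (one_add_norm_pow_pos _ N), ← mul_pow]
  have h : ‖y‖ ≤ ‖x‖ + ‖x - y‖ := by
    have := norm_sub_norm_le y x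
    rw [norm_sub_rev] at this
    linarith
  refine pow_le_pow_left₀ (by positivity) ?_ N
  nlinarith [norm_nonneg x, norm_nonneg (x - y)]

/-- The convolution of a function of moderate growth and a Schwartz function. -/
def conv (K : 𝓢(Space d, ℂ)) (f : Space d → ℂ) (x : Space d) : ℂ := ∫ z, K z * f (x - z)

lemma conv_eq (K : 𝓢(Space d, ℂ)) (f : Space d → ℂ) (x : Space d) :
    conv K f x = ∫ y, K (x - y) * f y := by
  rw [conv, ← integral_sub_left_eq_self _ _ x]
  simp

lemma Moderate.integrable_conv {f : Space d → ℂ} (hf : Moderate f) (K : 𝓢(Space d, ℂ))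
    (x : Space d) : Integrable (fun z => K z * f (x - z)) := by
  have h1 := hf.integrable_mul (SchwartzMap.compCLMOfContinuousLinearEquiv ℂ
    (ContinuousLinearEquiv.neg ℝ) (SchwartzMap.compSubConstCLM ℂ (-x) K))
  have h2 := h1.comp_sub_left x
  refine h2.congr (Eventually.of_forall fun z => ?_)
  simp

/-- Absolute integrability for Fubini's theorem in `Represents.multiplier`: Peetre's inequality
leaves the growth (1 + ‖x‖)^N, which the decay of g absorbs. -/
lemma conv_moderate_bound {f : Space d → ℂ} (hf : Moderate f) (K g : 𝓢(Space d, ℂ)) :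
    Integrable (fun q : Space d × Space d => g q.1 * (K (q.1 - q.2) * f q.2))
      (volume.prod volume) := by
  have hm := hf.aestronglyMeasurable
  obtain ⟨N, hN⟩ := hf
  obtain ⟨C, hC, h⟩ := schwartz_decay K N
  have hg : Integrable (fun x => ‖(1 + ‖x‖) ^ N * ‖g x‖‖) := by
    have hp : Moderate (fun x : Space d => (((1 + ‖x‖) ^ N : ℝ) : ℂ)) :=
      (moderate_of_memLp (p := ⊤) le_top (memLp_top_const (1 : ℂ))).of_norm_le
        (Continuous.aestronglyMeasurable (by fun_prop)) (C := 1) (k := N) fun x => by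
          rw [norm_one, mul_one, one_mul, Complex.norm_real,
            Real.norm_of_nonneg (one_add_norm_pow_pos x N).le]
    refine (hp.integrable_mul g).norm.congr (Eventually.of_forall fun x => ?_)
    simp only [norm_mul, norm_norm, Complex.norm_real]
    rw [mul_comm]
  refine ((hg.mul_prod hN.norm).const_mul C).mono' ?_ (Eventually.of_forall fun q => ?_)
  · refine AEStronglyMeasurable.mul (Continuous.aestronglyMeasurable (by fun_prop))
      (AEStronglyMeasurable.mul (Continuous.aestronglyMeasurable (by fun_prop)) hm.comp_snd)
  · have h1 := one_add_norm_pow_pos q.1 N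
    have h2 := one_add_norm_pow_pos q.2 N
    rw [norm_mul, norm_mul, norm_smul, norm_mul, norm_inv, norm_norm,
      Real.norm_of_nonneg h1.le, Real.norm_of_nonneg h2.le]
    calc _ ≤ ‖g q.1‖ * (C * ((1 + ‖q.1‖) ^ N * ((1 + ‖q.2‖) ^ N)⁻¹) * ‖f q.2‖) := by
          gcongr
          exact (h _).trans (by gcongr; exact inv_one_add_norm_sub_le _ _ _)
      _ = _ := by ring

lemma Moderate.conv {f : Space d → ℂ} (hf : Moderate f) (K : 𝓢(Space d, ℂ)) :
    Moderate (conv K f) := by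
  have hm := hf.aestronglyMeasurable
  obtain ⟨N, hN⟩ := hf
  obtain ⟨C, hC, h⟩ := schwartz_decay K N
  have hmeas : AEStronglyMeasurable (LogRiesz.conv K f) := by
    have : LogRiesz.conv K f = fun x => ∫ y, K (x - y) * f y := funext fun x => conv_eq K f x
    rw [this]
    exact AEStronglyMeasurable.integral_prod_right'
      (f := fun q : Space d × Space d => K (q.1 - q.2) * f q.2)
      (AEStronglyMeasurable.mul (Continuous.aestronglyMeasurable (by fun_prop)) hm.comp_snd)
  refine (moderate_of_memLp (p := ⊤) le_top (memLp_top_const (1 : ℂ))).of_norm_le hmeas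
    (C := C * ∫ y, ‖(((1 + ‖y‖) ^ N : ℝ)⁻¹ : ℝ) • f y‖) (k := N) fun x => ?_
  rw [conv_eq, norm_one, mul_one, mul_right_comm, ← integral_const_mul]
  refine norm_integral_le_of_norm_le (hN.norm.const_mul _) (Eventually.of_forall fun y => ?_)
  have h2 := one_add_norm_pow_pos y N
  rw [norm_mul, norm_smul, norm_inv, Real.norm_of_nonneg h2.le]
  calc _ ≤ (C * ((1 + ‖x‖) ^ N * ((1 + ‖y‖) ^ N)⁻¹)) * ‖f y‖ := by
        gcongr
        exact (h _).trans (by gcongr; exact inv_one_add_norm_sub_le _ _ _)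
    _ = _ := by ring

lemma Represents.multiplier {f : Space d → ℂ} {u : 𝓢'(Space d, ℂ)} (hf : Represents f u)
    (b : 𝓢(Space d, ℂ)) : Represents (conv (kernel b) f) (multiplier b u) := by
  refine ⟨hf.1.conv _, fun g => ?_⟩
  obtain ⟨h, h1, h2⟩ := multiplier_test b g u
  have hi := conv_moderate_bound hf.1 (kernel b) g
  rw [h1, hf.2]
  simp_rw [conv_eq, ← integral_const_mul]
  rw [integral_integral_swap hi]
  refine integral_congr_ae (Eventually.of_forall fun y => ?_)
  simp only [h2]
  rw [← integral_sub_right_eq_self _ y, ← integral_mul_const]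
  refine integral_congr_ae (Eventually.of_forall fun z => ?_)
  simp only [add_sub_cancel]
  ring

/-! ### The `L^p` norm of a tempered distribution -/

lemma exists_represents_of_lpNorm_ne_top {p : ℝ≥0∞} (hp : 1 ≤ p) {u : 𝓢'(Space d, ℂ)}
    (h : lpNorm p u ≠ ⊤) :
    ∃ f, MemLp f p volume ∧ Represents f u ∧ eLpNorm f p volume = lpNorm p u := by
  obtain ⟨f, hf⟩ := iInf_lt_iff.1 (lt_top_iff_ne_top.2 h)
  obtain ⟨hm, hf⟩ := iInf_lt_iff.1 hf
  obtain ⟨hr, hf⟩ := iInf_lt_iff.1 hf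
  have : Represents f u := ⟨moderate_of_memLp hp hm, hr⟩
  exact ⟨f, hm, this, (this.lpNorm_eq hp).symm⟩

lemma lpNorm_add_le {p : ℝ≥0∞} (hp : 1 ≤ p) (u w : 𝓢'(Space d, ℂ)) :
    lpNorm p (u + w) ≤ lpNorm p u + lpNorm p w := by
  by_cases hu : lpNorm p u = ⊤
  · simp [hu]
  by_cases hw : lpNorm p w = ⊤
  · simp [hw]
  obtain ⟨f, hf, hfr, hfn⟩ := exists_represents_of_lpNorm_ne_top hp hu
  obtain ⟨g, hg, hgr, hgn⟩ := exists_represents_of_lpNorm_ne_top hp hw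
  rw [← hfn, ← hgn]
  exact ((hfr.add hgr).lpNorm_le p).trans (eLpNorm_add_le hf.1 hg.1 hp)

lemma lpNorm_smul_le {p : ℝ≥0∞} (hp : 1 ≤ p) (c : ℂ) (u : 𝓢'(Space d, ℂ)) :
    lpNorm p (c • u) ≤ ‖c‖ₑ * lpNorm p u := by
  by_cases hu : lpNorm p u = ⊤
  · by_cases hc : c = 0
    · subst hc
      have := (represents_zero (d := d)).lpNorm_le p
      have h0 : (0 : ℂ) • u = 0 := by ext; simp
      simpa [h0] using this
    · rw [hu, ENNReal.mul_top (by simpa using hc)]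
      exact le_top
  obtain ⟨f, hf, hfr, hfn⟩ := exists_represents_of_lpNorm_ne_top hp hu
  rw [← hfn, ← eLpNorm_const_smul]
  exact (hfr.const_smul c).lpNorm_le p

lemma lpNorm_zero (p : ℝ≥0∞) : lpNorm p (0 : 𝓢'(Space d, ℂ)) = 0 := by
  have := (represents_zero (d := d)).lpNorm_le p
  simpa using this

lemma lpNorm_sub_le {p : ℝ≥0∞} (hp : 1 ≤ p) (u w : 𝓢'(Space d, ℂ)) :
    lpNorm p (u - w) ≤ lpNorm p u + lpNorm p w := by
  have h := lpNorm_add_le hp u (-w)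
  have h2 := lpNorm_smul_le hp (-1) w
  have h3 : (-1 : ℂ) • w = -w := by ext; simp
  rw [h3] at h2
  rw [sub_eq_add_neg]
  refine h.trans ?_
  gcongr
  simpa using h2

lemma lpNorm_sum_le {p : ℝ≥0∞} (hp : 1 ≤ p) {ι : Type*} (s : Finset ι)
    (u : ι → 𝓢'(Space d, ℂ)) : lpNorm p (∑ i ∈ s, u i) ≤ ∑ i ∈ s, lpNorm p (u i) := by
  classical
  induction s using Finset.induction_on with
  | empty => simp [lpNorm_zero]
  | insert a s ha ih =>
    rw [Finset.sum_insert ha, Finset.sum_insert ha]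
    exact (lpNorm_add_le hp _ _).trans (by gcongr)

/-- A series of tempered distributions whose `L^p` norms are summable converges. -/
lemma exists_hasSum_of_lpNorm {p : ℝ≥0∞} (hp : 1 ≤ p) {ι : Type*} (u : ι → 𝓢'(Space d, ℂ))
    (h : ∑' i, lpNorm p (u i) ≠ ⊤) :
    ∃ U : 𝓢'(Space d, ℂ), lpNorm p U ≤ ∑' i, lpNorm p (u i) ∧
      ∀ g : 𝓢(Space d, ℂ), HasSum (fun i => u i g) (U g) := by
  have hfact : Fact (1 ≤ p) := ⟨hp⟩
  choose f hf hr hn using fun i => exists_represents_of_lpNorm_ne_top hp (ENNReal.ne_top_of_tsum_ne_top h i)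
  have hs : Summable fun i => (hf i).toLp := by
    refine Summable.of_nnnorm ?_
    rw [← ENNReal.tsum_coe_ne_top_iff_summable]
    convert h using 4 with i
    rw [← hn, ← enorm_eq_nnnorm, Lp.enorm_toLp]
  set F := ∑' i, (hf i).toLp
  have hF : MemLp F p volume := Lp.memLp F
  have hU : Represents F (Lp.toTemperedDistribution F) := by
    have := represents_of_memLp hF
    rwa [Lp.toLp_coeFn] at this
  refine ⟨Lp.toTemperedDistribution F, ?_, fun g => ?_⟩
  · refine (hU.lpNorm_le p).trans ?_
    rw [← Lp.enorm_def]
    refine (enorm_tsum_le_tsum_enorm (f := fun i => (hf i).toLp)).trans ?_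
    simp_rw [Lp.enorm_toLp, hn]
    rfl
  · have h1 := hs.hasSum.mapL (Lp.toTemperedDistributionCLM ℂ volume p)
    have h2 : HasSum (fun i => u i g) (Lp.toTemperedDistributionCLM ℂ volume p F g) := by
      rw [HasSum] at h1 ⊢
      have h3 := (PointwiseConvergenceCLM.tendsto_iff_forall_tendsto.1 h1) g
      refine h3.congr fun s => ?_
      simp only [sum_apply]
      refine Finset.sum_congr rfl fun i _ => ?_
      rw [(hr i).2, (represents_of_memLp (hf i)).2 g |>.symm]
      rfl
    exact h2

/-- Countable subadditivity. If the right-hand side is finite the series converges in L^p, and its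
sum is U by uniqueness of weak limits. -/
lemma lpNorm_le_tsum {p : ℝ≥0∞} (hp : 1 ≤ p) {u : ℕ → 𝓢'(Space d, ℂ)} {U : 𝓢'(Space d, ℂ)}
    (h : ∀ g, Tendsto (fun n => (∑ i ∈ Finset.range n, u i) g) atTop (𝓝 (U g))) :
    lpNorm p U ≤ ∑' i, lpNorm p (u i) := by
  by_cases hs : ∑' i, lpNorm p (u i) = ⊤
  · simp [hs]
  obtain ⟨W, hW, hW'⟩ := exists_hasSum_of_lpNorm hp u hs
  have : U = W := by
    ext g
    refine tendsto_nhds_unique (h g) ?_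
    simpa using (hW' g).tendsto_sum_nat
  rwa [this]

/-! ### Calculus of multipliers -/

lemma temperate_dilation {m : Space d → ℂ} (hm : m.HasTemperateGrowth) (c : ℝ) :
    (fun ξ => m (c • ξ)).HasTemperateGrowth := by
  exact hm.comp (f := fun ξ : Space d => c • ξ)
    ((c • ContinuousLinearMap.id ℝ (Space d)).hasTemperateGrowth)

lemma multiplier_multiplier {a b : Space d → ℂ} (ha : a.HasTemperateGrowth)
    (hb : b.HasTemperateGrowth) (u : 𝓢'(Space d, ℂ)) :
    multiplier a (multiplier b u) = multiplier (fun ξ => a ξ * b ξ) u := by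
  rw [multiplier, multiplier, TemperedDistribution.fourierMultiplierCLM_fourierMultiplierCLM_apply
    (temperate_dilation hb _) (temperate_dilation ha _), multiplier]
  congr 2
  ext ξ
  simp [mul_comm]

lemma multiplier_add {a b : Space d → ℂ} (ha : a.HasTemperateGrowth)
    (hb : b.HasTemperateGrowth) (u : 𝓢'(Space d, ℂ)) :
    multiplier (fun ξ => a ξ + b ξ) u = multiplier a u + multiplier b u := by
  ext g
  have := SchwartzMap.smulLeftCLM_add (F := ℂ) (temperate_dilation ha (2 * Real.pi))
    (temperate_dilation hb (2 * Real.pi))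
  simp only [multiplier, TemperedDistribution.fourierMultiplierCLM_apply_apply, add_apply]
  rw [← map_add, ← FourierTransform.fourier_add, ← add_apply, ← this]
  rfl

lemma multiplier_sum {ι : Type*} (s : Finset ι) {a : ι → Space d → ℂ}
    (ha : ∀ i ∈ s, (a i).HasTemperateGrowth) (u : 𝓢'(Space d, ℂ)) :
    multiplier (fun ξ => ∑ i ∈ s, a i ξ) u = ∑ i ∈ s, multiplier (a i) u := by
  classical
  induction s using Finset.induction_on with
  | empty =>
    ext g
    simp [multiplier]
  | insert i s hi ih =>
    simp_rw [Finset.sum_insert hi]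
    rw [multiplier_add (ha i (by simp))
      (Function.HasTemperateGrowth.sum fun j hj => ha j (by simp [hj])),
      ih fun j hj => ha j (by simp [hj])]

@[fun_prop]
lemma temperate_coord (i : Fin d) :
    (fun ξ : Space d => ((ξ i : ℝ) : ℂ)).HasTemperateGrowth :=
  (Complex.ofRealCLM.comp (EuclideanSpace.proj i : Space d →L[ℝ] ℝ)).hasTemperateGrowth

lemma lineDeriv_eq_multiplier (i : Fin d) (u : 𝓢'(Space d, ℂ)) :
    ∂_{EuclideanSpace.single i (1 : ℝ)} u = multiplier (fun ξ => Complex.I * (ξ i : ℂ)) u := by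
  have hi : (fun ξ : Space d => ((inner ℝ ξ (EuclideanSpace.single i (1 : ℝ)) : ℝ) : ℂ)).HasTemperateGrowth := by
    fun_prop
  rw [TemperedDistribution.lineDeriv_eq_fourierMultiplierCLM, multiplier]
  rw [← smul_apply, ← TemperedDistribution.fourierMultiplierCLM_smul hi]
  congr 2
  ext ξ
  simp [EuclideanSpace.inner_single_right]
  ring

lemma multiplier_lineDeriv {a : Space d → ℂ} (ha : a.HasTemperateGrowth) (i : Fin d)
    (u : 𝓢'(Space d, ℂ)) :
    multiplier a (∂_{EuclideanSpace.single i (1 : ℝ)} u)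
      = multiplier (fun ξ => Complex.I * (ξ i : ℂ) * a ξ) u := by
  rw [lineDeriv_eq_multiplier, multiplier_multiplier ha (by fun_prop)]
  congr 2
  ext ξ
  ring

lemma lineDeriv_multiplier {a : Space d → ℂ} (ha : a.HasTemperateGrowth) (i : Fin d)
    (u : 𝓢'(Space d, ℂ)) :
    ∂_{EuclideanSpace.single i (1 : ℝ)} (multiplier a u)
      = multiplier (fun ξ => Complex.I * (ξ i : ℂ) * a ξ) u := by
  rw [lineDeriv_eq_multiplier, multiplier_multiplier (by fun_prop) ha]

/-! ### Convergence of low frequency cut-offs -/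

/-- All derivatives of b(ε·) − 1 are O(ε(1 + ‖x‖)): for order zero by the mean value inequality and
b(0) = 1, for order i ≥ 1 because of the factor ε^i. The extra power of ‖x‖ only raises the Schwartz
seminorm of g by one index. -/
lemma tendsto_smulLeft_dilation {b : Space d → ℂ} (hb : ContDiff ℝ ∞ b) (hc : HasCompactSupport b)
    (h0 : b 0 = 1) (g : 𝓢(Space d, ℂ)) :
    Tendsto (fun ε : ℝ => SchwartzMap.smulLeftCLM ℂ (fun ξ => b (ε • ξ)) g) (𝓝[>] 0) (𝓝 g) := by
  have hbd : ∀ n, ∃ C, 0 ≤ C ∧ ∀ x, ‖iteratedFDeriv ℝ n b x‖ ≤ C := fun n => by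
    obtain ⟨C, hC⟩ := (hb.continuous_iteratedFDeriv (m := n) (mod_cast le_top)).bounded_above_of_compact_support
      (hc.iteratedFDeriv n)
    exact ⟨C, (norm_nonneg _).trans (hC 0), hC⟩
  choose C hC0 hC using hbd
  have hbε : ∀ ε : ℝ, ContDiff ℝ ∞ (fun x : Space d => b (ε • x)) := fun ε =>
    hb.comp (contDiff_const_smul ε)
  have hder : ∀ i ε x, 0 < ε → ε ≤ 1 →
      ‖iteratedFDeriv ℝ i (fun x => b (ε • x) - 1) x‖ ≤ (C i + C 1) * ε * (1 + ‖x‖) := by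
    intro i ε x hε hε1
    rcases Nat.eq_zero_or_pos i with rfl | hi
    · rw [norm_iteratedFDeriv_zero]
      have hl : ‖b (ε • x) - b 0‖ ≤ C 1 * ‖ε • x - 0‖ := by
        refine Convex.norm_image_sub_le_of_norm_fderiv_le (𝕜 := ℝ) (s := Set.univ)
          (fun y _ => (hb.differentiable (by simp)) y) (fun y _ => ?_) convex_univ
          (Set.mem_univ _) (Set.mem_univ _)
        have := hC 1 y
        rwa [norm_iteratedFDeriv_one] at this
      rw [h0, sub_zero, norm_smul, Real.norm_of_nonneg hε.le] at hl
      refine hl.trans ?_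
      have := hC0 0
      have := hC0 1
      have := norm_nonneg x
      nlinarith [mul_nonneg (hC0 0) (mul_nonneg hε.le (by linarith : 0 ≤ 1 + ‖x‖)),
        mul_nonneg (hC0 1) hε.le]
    · have h1 : iteratedFDeriv ℝ i (fun x => b (ε • x) - 1) x
          = ε ^ i • iteratedFDeriv ℝ i b (ε • x) := by
        have := congrFun (iteratedFDeriv_comp_const_smul (i := i) ε (hb.of_le (mod_cast le_top))) x
        rw [← this]
        have h2 : (fun x => b (ε • x) - 1) = (fun x => b (ε • x)) - fun _ : Space d => (1 : ℂ) := rfl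
        rw [h2, iteratedFDeriv_sub ((hbε ε).of_le (mod_cast le_top)) contDiff_const]
        rw [Pi.sub_apply, iteratedFDeriv_const_of_ne hi.ne']
        simp
      rw [h1, norm_smul, norm_pow, Real.norm_of_nonneg hε.le]
      have h3 : ε ^ i ≤ ε := pow_le_of_le_one hε.le hε1 hi.ne'
      calc ε ^ i * _ ≤ ε * (C i + C 1) := by
            gcongr
            exact (hC i _).trans (by linarith [hC0 1])
        _ ≤ _ := by nlinarith [mul_nonneg (mul_nonneg (add_nonneg (hC0 i) (hC0 1)) hε.le)
                      (norm_nonneg x)]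
  rw [(schwartz_withSeminorms ℝ (Space d) ℂ).tendsto_nhds]
  rintro ⟨k, n⟩ δ hδ
  set S : ℝ := ∑ i ∈ Finset.range (n + 1), (n.choose i : ℝ) * (C i + C 1) *
    (SchwartzMap.seminorm ℝ k (n - i) g + SchwartzMap.seminorm ℝ (k + 1) (n - i) g) with hS
  have hS0 : 0 ≤ S := Finset.sum_nonneg fun i _ => mul_nonneg
    (mul_nonneg (Nat.cast_nonneg _) (add_nonneg (hC0 i) (hC0 1))) (by positivity)
  have hev : ∀ᶠ ε : ℝ in 𝓝[>] 0, ε * S < δ ∧ 0 < ε ∧ ε ≤ 1 := by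
    have h1 : Tendsto (fun ε : ℝ => ε * S) (𝓝[>] 0) (𝓝 (0 * S)) :=
      (tendsto_id.mul_const S).mono_left nhdsWithin_le_nhds
    rw [zero_mul] at h1
    filter_upwards [h1.eventually_lt_const hδ, self_mem_nhdsWithin,
      Ioc_mem_nhdsGT (zero_lt_one (α := ℝ))] with ε a b c
    exact ⟨a, b, c.2⟩
  filter_upwards [hev] with ε ⟨h1, h2, h3⟩
  refine lt_of_le_of_lt (SchwartzMap.seminorm_le_bound ℝ k n _ (by positivity) fun x => ?_) h1
  have ht : (fun x : Space d => b (ε • x)).HasTemperateGrowth :=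
    temperate_dilation (hc.hasTemperateGrowth hb) ε
  have heq : ((SchwartzMap.smulLeftCLM ℂ (fun ξ => b (ε • ξ)) g - g : 𝓢(Space d, ℂ)) : Space d → ℂ)
      = fun x => (b (ε • x) - 1) * g x := by
    ext x
    rw [sub_apply, SchwartzMap.smulLeftCLM_apply_apply ht, smul_eq_mul]
    ring
  rw [heq]
  have hmul := norm_iteratedFDeriv_mul_le (n := n) (N := ∞) ((hbε ε).sub (contDiff_const (c := (1 : ℂ))))
    (g.smooth ⊤) x (mod_cast le_top)
  refine (mul_le_mul_of_nonneg_left hmul (by positivity)).trans ?_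
  rw [hS, Finset.mul_sum, Finset.mul_sum]
  refine Finset.sum_le_sum fun i _ => ?_
  have e1 := hder i ε x h2 h3
  have e2 := SchwartzMap.le_seminorm ℝ k (n - i) g x
  have e3 := SchwartzMap.le_seminorm ℝ (k + 1) (n - i) g x
  have e4 := hC0 i
  have e5 := hC0 1
  calc _ ≤ ‖x‖ ^ k * ((n.choose i : ℝ) * ((C i + C 1) * ε * (1 + ‖x‖)) *
        ‖iteratedFDeriv ℝ (n - i) g x‖) := by gcongr
    _ = ε * ((n.choose i : ℝ) * (C i + C 1) * (‖x‖ ^ k * ‖iteratedFDeriv ℝ (n - i) g x‖ +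
        ‖x‖ ^ (k + 1) * ‖iteratedFDeriv ℝ (n - i) g x‖)) := by ring
    _ ≤ _ := by gcongr

lemma tendsto_multiplier_dilation {b : Space d → ℂ} (hb : ContDiff ℝ ∞ b)
    (hc : HasCompactSupport b) (h0 : b 0 = 1) (u : 𝓢'(Space d, ℂ)) (g : 𝓢(Space d, ℂ)) :
    Tendsto (fun ε : ℝ => multiplier (fun ξ => b (ε • ξ)) u g) (𝓝[>] 0) (𝓝 (u g)) := by
  have h1 := tendsto_smulLeft_dilation (b := fun ξ => b ((2 * Real.pi) • ξ))
    (hb.comp (contDiff_const_smul _)) (hc.comp_smul (by positivity)) (by simpa using h0)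
    (FourierTransform.fourierInv g)
  have h2 := ((u.continuous.comp (FourierTransform.continuous_fourier (E := 𝓢(Space d, ℂ)))).tendsto _).comp h1
  simp only [Function.comp_def, FourierTransform.fourier_fourierInv_eq] at h2
  refine h2.congr fun ε => ?_
  rw [multiplier, TemperedDistribution.fourierMultiplierCLM_apply_apply]
  simp_rw [smul_comm ε]
  rfl

/-! ### Commutators -/

/-- The commutator of the Fourier multiplier with symbol `a` and the multiplication by `f`. -/
def comm (a f : Space d → ℂ) (T : 𝓢'(Space d, ℂ)) : 𝓢'(Space d, ℂ) :=
  multiplier a (TemperedDistribution.smulLeftCLM ℂ f T) -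
    TemperedDistribution.smulLeftCLM ℂ f (multiplier a T)

/-- The `i`-th component of a vector field as a complex function. -/
def component (v : Space d → Space d) (i : Fin d) (x : Space d) : ℂ := ((v x i : ℝ) : ℂ)

lemma temperate_component {v : Space d → Space d} (hv : v.HasTemperateGrowth) (i : Fin d) :
    (component v i).HasTemperateGrowth :=
  (Complex.ofRealCLM.comp (EuclideanSpace.proj i : Space d →L[ℝ] ℝ)).hasTemperateGrowth.comp hv

lemma fderiv_component {v : Space d → Space d} (hv : v.HasTemperateGrowth) (i : Fin d)
    (x e : Space d) : fderiv ℝ (component v i) x e = ((fderiv ℝ v x e i : ℝ) : ℂ) := by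
  have h : component v i =
      (Complex.ofRealCLM.comp (EuclideanSpace.proj i : Space d →L[ℝ] ℝ)) ∘ v := rfl
  rw [h, fderiv_comp x (ContinuousLinearMap.differentiableAt _) (hv.1.differentiable (by simp) x),
    ContinuousLinearMap.fderiv]
  rfl

lemma temperate_fderiv_apply {f : Space d → ℂ} (hf : f.HasTemperateGrowth) (e : Space d) :
    (fun x => fderiv ℝ f x e).HasTemperateGrowth := by
  have h : (fderiv ℝ f).HasTemperateGrowth := by
    refine ⟨hf.1.fderiv_right (by simp), fun n => ?_⟩
    obtain ⟨k, C, h⟩ := hf.2 (n + 1)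
    refine ⟨k, C, fun x => ?_⟩
    rw [norm_iteratedFDeriv_fderiv]
    exact h x
  exact (ContinuousLinearMap.apply ℝ ℂ e).hasTemperateGrowth.comp h

lemma lineDeriv_smulLeft {f : Space d → ℂ} (hf : f.HasTemperateGrowth) (e : Space d)
    (T : 𝓢'(Space d, ℂ)) :
    ∂_{e} (TemperedDistribution.smulLeftCLM ℂ f T) =
      TemperedDistribution.smulLeftCLM ℂ f (∂_{e} T) +
        TemperedDistribution.smulLeftCLM ℂ (fun x => fderiv ℝ f x e) T := by
  ext g
  simp only [TemperedDistribution.lineDerivOp_apply_apply, add_apply,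
    TemperedDistribution.smulLeftCLM_apply_apply]
  rw [← map_add]
  congr 1
  ext x
  simp only [add_apply, neg_apply, SchwartzMap.smulLeftCLM_apply_apply hf,
    SchwartzMap.smulLeftCLM_apply_apply (temperate_fderiv_apply hf e),
    SchwartzMap.lineDerivOp_apply_eq_fderiv, smul_eq_mul]
  have h1 : (SchwartzMap.smulLeftCLM ℂ f g : Space d → ℂ) = fun x => f x * g x := by
    ext y; simp [SchwartzMap.smulLeftCLM_apply_apply hf]
  rw [h1, fderiv_fun_mul (hf.1.differentiable (by simp) x)
    ((g.smooth ⊤).differentiable (by simp) x)]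
  simp
  ring

lemma advect_eq (v : Space d → Space d) (u : 𝓢'(Space d, ℂ)) :
    advect v u = ∑ i : Fin d, TemperedDistribution.smulLeftCLM ℂ (component v i)
      (∂_{EuclideanSpace.single i (1 : ℝ)} u) := rfl

/-- v·∇u = div(vu) since div v = 0. This form allows the derivative to be moved onto the symbol of a
multiplier. -/
lemma advect_eq_sum_lineDeriv {v : Space d → Space d} (hv : v.HasTemperateGrowth)
    (hdiv : ∀ x, divergence v x = 0) (u : 𝓢'(Space d, ℂ)) :
    advect v u = ∑ i : Fin d, ∂_{EuclideanSpace.single i (1 : ℝ)}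
      (TemperedDistribution.smulLeftCLM ℂ (component v i) u) := by
  simp_rw [lineDeriv_smulLeft (temperate_component hv _), Finset.sum_add_distrib]
  rw [← sum_apply, ← TemperedDistribution.smulLeftCLM_sum
    fun i _ => temperate_fderiv_apply (temperate_component hv i) _]
  have h : (fun x => ∑ i : Fin d, fderiv ℝ (component v i) x (EuclideanSpace.single i (1 : ℝ)))
      = fun _ => 0 := by
    ext x
    simp_rw [fderiv_component hv]
    have := hdiv x
    rw [divergence] at this
    exact_mod_cast this
  rw [h, advect_eq]
  ext g
  simp

/-- The advection operator as a continuous linear map. -/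
def advectCLM (v : Space d → Space d) : 𝓢'(Space d, ℂ) →L[ℂ] 𝓢'(Space d, ℂ) :=
  ∑ i : Fin d, (TemperedDistribution.smulLeftCLM ℂ (component v i)).comp
    (LineDeriv.lineDerivOpCLM ℂ 𝓢'(Space d, ℂ) (EuclideanSpace.single i (1 : ℝ)))

lemma advectCLM_apply (v : Space d → Space d) (u : 𝓢'(Space d, ℂ)) :
    advectCLM v u = advect v u := by
  rw [advectCLM, sum_apply]; rfl

/-- The commutator of a Fourier multiplier and the advection operator. -/
def advComm (v : Space d → Space d) (a : Space d → ℂ) (u : 𝓢'(Space d, ℂ)) : 𝓢'(Space d, ℂ) :=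
  multiplier a (advect v u) - advect v (multiplier a u)

/-- First form of the commutator: the derivative stays on u. It is the efficient one when u has
lower frequency than the symbol a. -/
lemma advComm_eq_sum_comm_lineDeriv (v : Space d → Space d) {a : Space d → ℂ}
    (ha : a.HasTemperateGrowth) (u : 𝓢'(Space d, ℂ)) :
    advComm v a u = ∑ i : Fin d, comm a (component v i)
      (∂_{EuclideanSpace.single i (1 : ℝ)} u) := by
  simp_rw [advComm, advect_eq, comm, map_sum, Finset.sum_sub_distrib, lineDeriv_multiplier ha,
    multiplier_lineDeriv ha]

/-- Second form of the commutator: the derivative is absorbed in the symbol, so no regularity of u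
is spent. It serves low-frequency symbols and arguments u of higher frequency than a. -/
lemma advComm_eq_sum_comm {v : Space d → Space d} (hv : v.HasTemperateGrowth)
    (hdiv : ∀ x, divergence v x = 0) {a : Space d → ℂ} (ha : a.HasTemperateGrowth)
    (u : 𝓢'(Space d, ℂ)) :
    advComm v a u = ∑ i : Fin d, comm (fun ξ => Complex.I * (ξ i : ℂ) * a ξ) (component v i) u := by
  rw [advComm, advect_eq_sum_lineDeriv hv hdiv, advect_eq]
  simp_rw [comm, map_sum, Finset.sum_sub_distrib, lineDeriv_multiplier ha,
    multiplier_lineDeriv ha]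

/-- Integration by parts in the commutator: the derivative on T goes either to the symbol or to f.
-/
lemma comm_lineDeriv {a f : Space d → ℂ} (ha : a.HasTemperateGrowth) (hf : f.HasTemperateGrowth)
    (l : Fin d) (T : 𝓢'(Space d, ℂ)) :
    comm a f (∂_{EuclideanSpace.single l (1 : ℝ)} T) =
      comm (fun ξ => Complex.I * (ξ l : ℂ) * a ξ) f T -
        multiplier a (TemperedDistribution.smulLeftCLM ℂ
          (fun x => fderiv ℝ f x (EuclideanSpace.single l (1 : ℝ))) T) := by
  have h := lineDeriv_smulLeft hf (EuclideanSpace.single l (1 : ℝ)) T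
  rw [comm, comm, ← multiplier_lineDeriv ha, ← multiplier_lineDeriv ha, h, map_add]
  abel

/-- The commutator with a multiplier whose symbol is a Schwartz function. -/
lemma Represents.comm {f G : Space d → ℂ} {T : 𝓢'(Space d, ℂ)} (hG : Represents G T)
    (hf : f.HasTemperateGrowth) (b : 𝓢(Space d, ℂ)) :
    Represents (fun x => ∫ z, kernel b z * ((f (x - z) - f x) * G (x - z))) (comm b f T) := by
  have h := ((hG.smulLeft hf).multiplier b).sub ((hG.multiplier b).smulLeft hf)
  refine (congrArg₂ Represents ?_ rfl).mpr h
  ext x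
  rw [conv, conv, ← integral_const_mul, ← integral_sub ((hG.1.mul hf).integrable_conv _ x)
    ((hG.1.integrable_conv _ x).const_mul _)]
  refine integral_congr_ae (Eventually.of_forall fun z => ?_)
  simp only
  ring

/-! ### Kernels localized at a given scale -/

/-- An integrable profile at scale `t⁻¹`. -/
def prof (t : ℝ) (z : Space d) : ℝ := t ^ d * ((1 + t * ‖z‖) ^ (d + 2))⁻¹

/-- The measure whose density is the profile at scale `t⁻¹`. -/
def profMeasure (d : ℕ) (t : ℝ) : Measure (Space d) :=
  volume.withDensity fun z => ENNReal.ofReal (prof t z)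

/-- The mass of the profiles. -/
def profMass (d : ℕ) : ℝ := ∫ z : Space d, ((1 + ‖z‖) ^ (d + 2))⁻¹

/-- A constant that dominates the powers of the mass with exponent in `[0,1]`. -/
def profConst (d : ℕ) : ℝ≥0∞ := 1 + ENNReal.ofReal (profMass d)

lemma profConst_ne_top : profConst d ≠ ⊤ := by simp [profConst]

lemma one_le_profConst : 1 ≤ profConst d := by simp [profConst]

lemma prof_nonneg {t : ℝ} (ht : 0 < t) (z : Space d) : 0 ≤ prof t z := by
  rw [prof]; positivity

lemma prof_le {t : ℝ} (ht : 0 < t) (z : Space d) : prof t z ≤ t ^ d := by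
  rw [prof]
  refine mul_le_of_le_one_right (by positivity) (inv_le_one_of_one_le₀ (one_le_pow₀ ?_))
  have : 0 ≤ t * ‖z‖ := by positivity
  linarith

lemma continuous_prof {t : ℝ} (ht : 0 < t) : Continuous (prof t : Space d → ℝ) := by
  unfold prof
  refine continuous_const.mul (Continuous.inv₀ (by fun_prop) fun z => ?_)
  have : 0 ≤ t * ‖z‖ := by positivity
  positivity

lemma integrable_profile : Integrable (fun z : Space d => ((1 + ‖z‖) ^ (d + 2))⁻¹) := by
  have := integrable_one_add_norm (E := Space d) (μ := volume) (r := (d + 2 : ℕ)) (by simp)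
  refine this.congr (Eventually.of_forall fun x => ?_)
  simp only
  rw [Real.rpow_neg (by positivity), Real.rpow_natCast]

lemma profMeasure_univ {t : ℝ} (ht : 0 < t) :
    profMeasure d t Set.univ = ENNReal.ofReal (profMass d) := by
  have hi : Integrable (prof t : Space d → ℝ) := by
    have := (integrable_profile (d := d)).comp_smul ht.ne'
    refine (this.const_mul (t ^ d)).congr (Eventually.of_forall fun z => ?_)
    simp [prof, norm_smul, abs_of_pos ht]
  rw [profMeasure, withDensity_apply _ MeasurableSet.univ, Measure.restrict_univ,
    ← ofReal_integral_eq_lintegral_ofReal hi (Eventually.of_forall (prof_nonneg ht))]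
  congr 1
  have h2 := Measure.integral_comp_smul_of_nonneg (volume : Measure (Space d))
    (fun z : Space d => ((1 + ‖z‖) ^ (d + 2))⁻¹) t (hR := ht.le)
  simp only [norm_smul, Real.norm_of_nonneg ht.le, finrank_euclideanSpace, Fintype.card_fin,
    smul_eq_mul] at h2
  simp only [prof]
  rw [integral_const_mul, h2, ← mul_assoc, mul_inv_cancel₀ (by positivity), one_mul, profMass]

instance (t : ℝ) : SFinite (profMeasure d t) := by unfold profMeasure; infer_instance

lemma profMeasure_univ_rpow_le {t : ℝ} (ht : 0 < t) {θ : ℝ} (h0 : 0 ≤ θ) (h1 : θ ≤ 1) :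
    profMeasure d t Set.univ ^ θ ≤ profConst d := by
  rw [profMeasure_univ ht]
  calc _ ≤ profConst d ^ θ := by gcongr; simp [profConst]
    _ ≤ profConst d ^ (1 : ℝ) := ENNReal.rpow_le_rpow_of_exponent_le one_le_profConst h1
    _ = _ := ENNReal.rpow_one _

lemma profMeasure_le {t : ℝ} (ht : 0 < t) :
    profMeasure d t ≤ ENNReal.ofReal (t ^ d) • volume := by
  rw [profMeasure, ← withDensity_const]
  exact withDensity_mono (Eventually.of_forall fun z => ENNReal.ofReal_le_ofReal (prof_le ht z))

lemma profMeasure_absolutelyContinuous (t : ℝ) : profMeasure d t ≪ volume :=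
  withDensity_absolutelyContinuous _ _

lemma lintegral_profMeasure {t : ℝ} (ht : 0 < t) (g : Space d → ℝ≥0∞) :
    ∫⁻ z, g z ∂(profMeasure d t) = ∫⁻ z, ENNReal.ofReal (prof t z) * g z := by
  rw [profMeasure, lintegral_withDensity_eq_lintegral_mul_non_measurable _
    (continuous_prof ht).measurable.ennreal_ofReal (by simp)]
  rfl

/-- The `L^s` norm with respect to the profile measure at scale `t⁻¹` of the translates of an
`L^q` function. -/
lemma eLpNorm_comp_sub_left_profMeasure_le {E : Type*} [NormedAddCommGroup E] {t : ℝ} (ht : 0 < t)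
    {s q : ℝ≥0∞} (hs : 1 ≤ s) (hsq : s ≤ q) {G : Space d → E}
    (hG : AEStronglyMeasurable G volume) (x : Space d) :
    eLpNorm (fun z => G (x - z)) s (profMeasure d t) ≤
      profConst d * ENNReal.ofReal t ^ ((d : ℝ) / q.toReal) * eLpNorm G q volume := by
  have hmp := Measure.measurePreserving_sub_left (volume : Measure (Space d)) x
  have hGx : AEStronglyMeasurable (fun z => G (x - z)) volume := hG.comp_measurePreserving hmp
  have h1 := eLpNorm_le_eLpNorm_mul_rpow_measure_univ hsq
    (hGx.mono_ac (profMeasure_absolutelyContinuous t))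
  have h2 : eLpNorm (fun z => G (x - z)) q (profMeasure d t) ≤
      -- The density of the profile is at most t^d, and the q-th root of this is the Bernstein
      -- factor t^{d/q}. The passage from exponent q to s only costs a power of the total mass, with
      -- exponent in [0,1].
      ENNReal.ofReal t ^ ((d : ℝ) / q.toReal) * eLpNorm G q volume := by
    refine (eLpNorm_mono_measure _ (profMeasure_le ht)).trans ?_
    rw [eLpNorm_smul_measure_of_ne_zero (by simp; positivity)]
    have h3 := eLpNorm_comp_measurePreserving (p := q) hG hmp
    rw [Function.comp_def] at h3
    rw [h3, smul_eq_mul, ENNReal.ofReal_pow ht.le, ← ENNReal.rpow_natCast, ← ENNReal.rpow_mul]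
    simp [div_eq_mul_inv]
  have hqs : 0 ≤ 1 / s.toReal - 1 / q.toReal ∧ 1 / s.toReal - 1 / q.toReal ≤ 1 := by
    by_cases hst : s = ⊤
    · subst hst
      have : q = ⊤ := top_le_iff.1 hsq
      simp [this]
    have hs1 : 1 ≤ s.toReal := by
      rw [← ENNReal.toReal_one]; exact (ENNReal.toReal_le_toReal (by simp) hst).2 hs
    have hle : 1 / s.toReal ≤ 1 := by rw [div_le_one (by linarith)]; exact hs1
    by_cases hqt : q = ⊤
    · subst hqt
      simp only [ENNReal.toReal_top, div_zero, sub_zero]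
      exact ⟨by positivity, hle⟩
    have : s.toReal ≤ q.toReal := (ENNReal.toReal_le_toReal hst hqt).2 hsq
    have h5 : 1 / q.toReal ≤ 1 / s.toReal := one_div_le_one_div_of_le (by linarith) this
    have h6 : 0 ≤ 1 / q.toReal := by positivity
    exact ⟨by linarith, by linarith⟩
  calc _ ≤ _ := h1
    _ ≤ (ENNReal.ofReal t ^ ((d : ℝ) / q.toReal) * eLpNorm G q volume) * profConst d := by
        gcongr
        exact profMeasure_univ_rpow_le ht hqs.1 hqs.2
    _ = _ := by ring

/-- The bound for convolution kernels at scale `t⁻¹`. -/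
def KerBound (t C : ℝ) (K : Space d → ℂ) : Prop :=
  ∀ z, ‖K z‖ ≤ C * (t ^ d * ((1 + t * ‖z‖) ^ (d + 3))⁻¹)

/-- The kernel decays with exponent d + 3 and the profile with d + 2: the spare power pays for
‖z‖^c, c ≤ 1, at the scale t⁻¹. This is the source of every gain t^{-c} in the commutator estimates.
-/
lemma KerBound.rpow_mul_norm_le {t C : ℝ} {K : Space d → ℂ} (h : KerBound t C K) (ht : 0 < t)
    {c : ℝ} (hc0 : 0 ≤ c) (hc1 : c ≤ 1) (z : Space d) :
    ‖z‖ ^ c * ‖K z‖ ≤ C * t ^ (-c) * prof t z := by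
  have h0 : 0 ≤ t * ‖z‖ := by positivity
  have h1 : ‖z‖ ^ c ≤ t ^ (-c) * (1 + t * ‖z‖) := by
    rw [Real.rpow_neg ht.le, ← div_eq_inv_mul, le_div_iff₀ (by positivity), mul_comm,
      ← Real.mul_rpow ht.le (norm_nonneg z)]
    calc _ ≤ (1 + t * ‖z‖) ^ c := by gcongr; linarith
      _ ≤ (1 + t * ‖z‖) ^ (1 : ℝ) := Real.rpow_le_rpow_of_exponent_le (by linarith) hc1
      _ = _ := Real.rpow_one _
  calc _ ≤ (t ^ (-c) * (1 + t * ‖z‖)) * (C * (t ^ d * ((1 + t * ‖z‖) ^ (d + 3))⁻¹)) := by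
        gcongr; exact h z
    _ = _ := by
        rw [prof]
        have : (1 + t * ‖z‖) ≠ 0 := by positivity
        field_simp
        ring

lemma KerBound.lintegral_le {t C : ℝ} {K : Space d → ℂ} (h : KerBound t C K) (ht : 0 < t)
    (hC : 0 ≤ C) {c : ℝ} (hc0 : 0 ≤ c) (hc1 : c ≤ 1) (Φ : Space d → ℝ≥0∞) :
    ∫⁻ z, ENNReal.ofReal (‖z‖ ^ c) * ‖K z‖ₑ * Φ z ≤
      ENNReal.ofReal (C * t ^ (-c)) * ∫⁻ z, Φ z ∂(profMeasure d t) := by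
  rw [lintegral_profMeasure ht, ← lintegral_const_mul' _ _ (by simp)]
  refine lintegral_mono fun z => ?_
  rw [← mul_assoc]
  refine mul_le_mul_left ?_ _
  rw [← ofReal_norm, ← ENNReal.ofReal_mul (by positivity), ← ENNReal.ofReal_mul (by positivity)]
  exact ENNReal.ofReal_le_ofReal (h.rpow_mul_norm_le ht hc0 hc1 z)

/-! ### Convolution estimates -/

lemma enorm_conv_le {t C : ℝ} {K : 𝓢(Space d, ℂ)} (h : KerBound t C K) (ht : 0 < t)
    (hC : 0 ≤ C) (G : Space d → ℂ) (x : Space d) :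
    ‖conv K G x‖ₑ ≤ ENNReal.ofReal C * eLpNorm (fun z => G (x - z)) 1 (profMeasure d t) := by
  refine (enorm_integral_le_lintegral_enorm _).trans ?_
  have := h.lintegral_le ht hC le_rfl zero_le_one (fun z => ‖G (x - z)‖ₑ)
  simpa [eLpNorm_one_eq_lintegral_enorm] using this

/-- Bernstein's inequality. -/
lemma lpNorm_top_multiplier_le {t C : ℝ} {b : 𝓢(Space d, ℂ)} (h : KerBound t C (kernel b))
    (ht : 0 < t) (hC : 0 ≤ C) {q : ℝ≥0∞} (hq : 1 ≤ q) {T : 𝓢'(Space d, ℂ)}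
    (hT : lpNorm q T ≠ ⊤) :
    lpNorm ⊤ (multiplier b T) ≤ ENNReal.ofReal C * (profConst d *
      ENNReal.ofReal t ^ ((d : ℝ) / q.toReal) * lpNorm q T) := by
  obtain ⟨G, hG, hr, hn⟩ := exists_represents_of_lpNorm_ne_top hq hT
  refine ((hr.multiplier b).lpNorm_le ⊤).trans ?_
  rw [eLpNorm_exponent_top, ← hn]
  refine eLpNormEssSup_le_of_ae_enorm_bound (Eventually.of_forall fun x => ?_)
  refine (enorm_conv_le h ht hC G x).trans ?_
  gcongr
  exact eLpNorm_comp_sub_left_profMeasure_le ht le_rfl hq hG.1 x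

lemma lintegral_translates {t : ℝ} (ht : 0 < t) {F : Space d → ℝ≥0∞} (hF : AEMeasurable F) :
    ∫⁻ x, ∫⁻ z, F (x - z) ∂(profMeasure d t) = ENNReal.ofReal (profMass d) * ∫⁻ x, F x := by
  rw [lintegral_lintegral_swap]
  · simp_rw [lintegral_sub_right_eq_self]
    rw [lintegral_const, profMeasure_univ ht, mul_comm]
  · have : Measure.QuasiMeasurePreserving (fun q : Space d × Space d => q.1 - q.2)
        (volume.prod (profMeasure d t)) volume :=
      (quasiMeasurePreserving_sub volume volume).mono
        (Measure.AbsolutelyContinuous.rfl.prod (profMeasure_absolutelyContinuous t)) 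
        Measure.AbsolutelyContinuous.rfl
    exact hF.comp_quasiMeasurePreserving this

/-- Young's inequality: Hölder with respect to the profile measure, then Fubini. Each of the two
steps costs one power of the mass, hence the square of `profConst`. -/
lemma lpNorm_multiplier_le {t C : ℝ} {b : 𝓢(Space d, ℂ)} (h : KerBound t C (kernel b))
    (ht : 0 < t) (hC : 0 ≤ C) {p : ℝ≥0∞} (hp : 1 ≤ p) {T : 𝓢'(Space d, ℂ)}
    (hT : lpNorm p T ≠ ⊤) :
    lpNorm p (multiplier b T) ≤ ENNReal.ofReal C * (profConst d ^ 2 * lpNorm p T) := by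
  by_cases hpt : p = ⊤
  · subst hpt
    refine (lpNorm_top_multiplier_le h ht hC hp hT).trans ?_
    simp only [ENNReal.toReal_top, div_zero, ENNReal.rpow_zero, mul_one]
    gcongr
    exact le_self_pow₀ one_le_profConst (by simp)
  have hp0 : p ≠ 0 := (zero_lt_one.trans_le hp).ne'
  have hp1 : 1 ≤ p.toReal := by
    rw [← ENNReal.toReal_one]; exact (ENNReal.toReal_le_toReal (by simp) hpt).2 hp
  obtain ⟨G, hG, hr, hn⟩ := exists_represents_of_lpNorm_ne_top hp hT
  refine ((hr.multiplier b).lpNorm_le p).trans ?_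
  have hpw : ∀ x, ‖conv (kernel b) G x‖ₑ ≤ ENNReal.ofReal C * (profConst d *
      (∫⁻ z, ‖G (x - z)‖ₑ ^ p.toReal ∂(profMeasure d t)) ^ (1 / p.toReal)) := fun x => by
    refine (enorm_conv_le h ht hC G x).trans ?_
    have hGx : AEStronglyMeasurable (fun z => G (x - z)) volume :=
      hG.1.comp_measurePreserving (Measure.measurePreserving_sub_left volume x)
    have h1 := eLpNorm_le_eLpNorm_mul_rpow_measure_univ hp
      (hGx.mono_ac (profMeasure_absolutelyContinuous t))
    have h6 : 1 / p.toReal ≤ 1 := by rw [div_le_one (by linarith)]; exact hp1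
    rw [eLpNorm_eq_lintegral_rpow_enorm_toReal hp0 hpt] at h1
    gcongr
    refine h1.trans ?_
    rw [mul_comm]
    gcongr
    exact profMeasure_univ_rpow_le ht (by simpa using h6) (by simp)
  rw [eLpNorm_eq_lintegral_rpow_enorm_toReal hp0 hpt]
  have hA : ENNReal.ofReal C * profConst d ≠ ⊤ := ENNReal.mul_ne_top (by simp) profConst_ne_top
  simp_rw [← mul_assoc] at hpw
  rw [pow_two, ← mul_assoc, ← mul_assoc, mul_assoc _ (profConst d) (lpNorm p T)]
  generalize ENNReal.ofReal C * profConst d = A at hpw hA ⊢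
  calc _ ≤ (∫⁻ x, A ^ p.toReal *
        ∫⁻ z, ‖G (x - z)‖ₑ ^ p.toReal ∂(profMeasure d t)) ^ (1 / p.toReal) := by
        gcongr with x
        refine (ENNReal.rpow_le_rpow (hpw x) (by linarith)).trans_eq ?_
        rw [ENNReal.mul_rpow_of_nonneg _ _ (by linarith), ← ENNReal.rpow_mul,
          one_div_mul_cancel (by linarith), ENNReal.rpow_one]
    _ = A * (profMeasure d t Set.univ ^ (1 / p.toReal) *
          eLpNorm G p volume) := by
        rw [lintegral_const_mul' _ _ (ENNReal.rpow_ne_top_of_nonneg (by linarith)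
          hA),
          lintegral_translates ht (F := fun y => ‖G y‖ₑ ^ p.toReal) (hG.1.enorm.pow_const _),
          ENNReal.mul_rpow_of_nonneg _ _ (by positivity), ENNReal.mul_rpow_of_nonneg _ _ (by positivity),
          ← ENNReal.rpow_mul, mul_one_div_cancel (by linarith), ENNReal.rpow_one,
          eLpNorm_eq_lintegral_rpow_enorm_toReal hp0 hpt, profMeasure_univ ht]
    _ ≤ A * (profConst d * lpNorm p T) := by
        rw [hn]
        gcongr
        exact profMeasure_univ_rpow_le ht (by positivity)
          (by rw [div_le_one (by linarith)]; exact hp1)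

/-! ### Commutator estimates -/

/-- The average of the gradient of a vector field over the segment from `x` to `x - z`. -/
def segmentMean (v : Space d → Space d) (x z : Space d) : ℝ≥0∞ :=
  ∫⁻ s in Set.Ioc (0 : ℝ) 1, ‖fderiv ℝ v (x - s • z)‖ₑ

/-- The fundamental theorem of calculus along the segment from x to x − z. -/
lemma enorm_component_sub_le_segmentMean {v : Space d → Space d} (hv : ContDiff ℝ ∞ v) (i : Fin d)
    (x z : Space d) :
    ‖component v i (x - z) - component v i x‖ₑ ≤ ENNReal.ofReal ‖z‖ * segmentMean v x z := by
  have h1 : ‖component v i (x - z) - component v i x‖ₑ ≤ ‖v (x - z) - v x‖ₑ := by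
    simp only [component]
    rw [← ofReal_norm, ← ofReal_norm, ← Complex.ofReal_sub, Complex.norm_real]
    exact ENNReal.ofReal_le_ofReal (by
      simpa using PiLp.norm_apply_le (v (x - z) - v x) i)
  refine h1.trans ?_
  have hd : ∀ s ∈ Set.uIcc (0 : ℝ) 1, HasDerivAt (fun s : ℝ => v (x - s • z))
      (fderiv ℝ v (x - s • z) (-z)) s := fun s _ => by
    have h2 := (hv.differentiable (by simp) (x - s • z)).hasFDerivAt
    have h3 : HasDerivAt (fun s : ℝ => x - s • z) (-z) s := by
      simpa using ((hasDerivAt_id s).smul_const z).const_sub x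
    exact h2.comp_hasDerivAt s h3
  have hc : Continuous fun s : ℝ => fderiv ℝ v (x - s • z) (-z) :=
    ((hv.continuous_fderiv (by simp)).comp (by fun_prop)).clm_apply continuous_const
  have h4 := intervalIntegral.integral_eq_sub_of_hasDerivAt hd (hc.intervalIntegrable _ _)
  simp only [one_smul, zero_smul, sub_zero] at h4
  rw [← h4, intervalIntegral.integral_of_le zero_le_one, segmentMean,
    ← lintegral_const_mul' _ _ (by simp)]
  refine (enorm_integral_le_lintegral_enorm _).trans (lintegral_mono fun s => ?_)
  refine (ContinuousLinearMap.le_opENorm _ _).trans_eq ?_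
  rw [enorm_neg, mul_comm, ofReal_norm]

lemma measurable_fderiv_segment {v : Space d → Space d} (hv : ContDiff ℝ ∞ v) :
    Measurable fun q : (Space d × Space d) × ℝ => ‖fderiv ℝ v (q.1.1 - q.2 • q.1.2)‖ₑ :=
  (((hv.continuous_fderiv (by simp)).comp (by fun_prop)).enorm).measurable

lemma measurable_segmentMean {v : Space d → Space d} (hv : ContDiff ℝ ∞ v) :
    Measurable fun q : Space d × Space d => segmentMean v q.1 q.2 :=
  (measurable_fderiv_segment hv).lintegral_prod_right'

lemma segmentMean_rpow_le {v : Space d → Space d} (hv : ContDiff ℝ ∞ v) {p : ℝ} (hp : 1 ≤ p)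
    (x z : Space d) : segmentMean v x z ^ p ≤
      ∫⁻ s in Set.Ioc (0 : ℝ) 1, ‖fderiv ℝ v (x - s • z)‖ₑ ^ p := by
  have : IsProbabilityMeasure (volume.restrict (Set.Ioc (0 : ℝ) 1)) := ⟨by simp⟩
  have h2 := eLpNorm_le_eLpNorm_of_exponent_le (μ := volume.restrict (Set.Ioc (0 : ℝ) 1))
    (f := fun s : ℝ => fderiv ℝ v (x - s • z)) (p := 1) (q := ENNReal.ofReal p)
    (by simpa using hp) 
    (((hv.continuous_fderiv (by simp)).comp (by fun_prop)).aestronglyMeasurable)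
  rw [eLpNorm_one_eq_lintegral_enorm, eLpNorm_eq_lintegral_rpow_enorm_toReal
    (by simp; linarith) (by simp), ENNReal.toReal_ofReal (by linarith)] at h2
  refine (ENNReal.rpow_le_rpow h2 (by linarith)).trans_eq ?_
  rw [← ENNReal.rpow_mul, one_div_mul_cancel (by linarith), ENNReal.rpow_one]

/-- Jensen on the unit interval, Fubini, and translation invariance make the bound uniform in z. -/
lemma lintegral_segmentMean_rpow_le {v : Space d → Space d} (hv : ContDiff ℝ ∞ v) {p : ℝ}
    (hp : 1 ≤ p) (z : Space d) :
    ∫⁻ x, segmentMean v x z ^ p ≤ ∫⁻ x, ‖fderiv ℝ v x‖ₑ ^ p := by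
  refine (lintegral_mono fun x => segmentMean_rpow_le hv hp x z).trans ?_
  rw [lintegral_lintegral_swap]
  · have : ∀ s : ℝ, ∫⁻ x, ‖fderiv ℝ v (x - s • z)‖ₑ ^ p = ∫⁻ x, ‖fderiv ℝ v x‖ₑ ^ p := fun s =>
      lintegral_sub_right_eq_self (fun x => ‖fderiv ℝ v x‖ₑ ^ p) (s • z)
    simp_rw [this]
    simp
  · exact (((measurable_fderiv_segment hv).pow_const p).comp
      (f := fun q : Space d × ℝ => ((q.1, z), q.2)) (by fun_prop)).aemeasurable

lemma lintegral_segmentMean_le {v : Space d → Space d} (hv : ContDiff ℝ ∞ v) {t : ℝ} (ht : 0 < t)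
    {p : ℝ} (hp : 1 ≤ p) :
    ∫⁻ x, ∫⁻ z, segmentMean v x z ^ p ∂(profMeasure d t) ≤
      profConst d * ∫⁻ x, ‖fderiv ℝ v x‖ₑ ^ p := by
  have hmeas := measurable_fderiv_segment hv
  calc _ ≤ ∫⁻ x, ∫⁻ z, (∫⁻ s in Set.Ioc (0 : ℝ) 1, ‖fderiv ℝ v (x - s • z)‖ₑ ^ p)
        ∂(profMeasure d t) := lintegral_mono fun x => lintegral_mono fun z => segmentMean_rpow_le hv hp x z
    _ = ∫⁻ z, (∫⁻ x, ∫⁻ s in Set.Ioc (0 : ℝ) 1, ‖fderiv ℝ v (x - s • z)‖ₑ ^ p)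
        ∂(profMeasure d t) := by
        rw [lintegral_lintegral_swap]
        exact ((hmeas.pow_const p).lintegral_prod_right').aemeasurable
    _ = ∫⁻ z, (∫⁻ s in Set.Ioc (0 : ℝ) 1, ∫⁻ x, ‖fderiv ℝ v (x - s • z)‖ₑ ^ p)
        ∂(profMeasure d t) := by
        congr with z
        rw [lintegral_lintegral_swap]
        exact (((hmeas.pow_const p).comp (f := fun q : Space d × ℝ => ((q.1, z), q.2))
          (by fun_prop))).aemeasurable
    _ = ENNReal.ofReal (profMass d) * ∫⁻ x, ‖fderiv ℝ v x‖ₑ ^ p := by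
        have : ∀ (z : Space d) (s : ℝ), ∫⁻ x, ‖fderiv ℝ v (x - s • z)‖ₑ ^ p
            = ∫⁻ x, ‖fderiv ℝ v x‖ₑ ^ p := fun z s =>
          lintegral_sub_right_eq_self (fun x => ‖fderiv ℝ v x‖ₑ ^ p) (s • z)
        simp_rw [this]
        simp [lintegral_const, profMeasure_univ ht, mul_comm]
    _ ≤ _ := by gcongr; simp [profConst]

/-- Commutator estimate in `L^p` for vector fields with gradient in `L^p`. -/
lemma lpNorm_comm_le {t C : ℝ} {b : 𝓢(Space d, ℂ)} (h : KerBound t C (kernel b))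
    (ht : 0 < t) (hC : 0 ≤ C) {p q : ℝ≥0∞} (hp : 2 ≤ p) (hpt : p ≠ ⊤) (hpq : p ≤ q)
    {v : Space d → Space d} (hv : v.HasTemperateGrowth) (i : Fin d)
    {T : 𝓢'(Space d, ℂ)} (hT : lpNorm q T ≠ ⊤) :
    lpNorm p (comm b (component v i) T) ≤ ENNReal.ofReal (C * t⁻¹) *
      (profConst d ^ 2 * ENNReal.ofReal t ^ ((d : ℝ) / q.toReal) * lpNorm q T) *
        eLpNorm (fderiv ℝ v) p volume := by
  have hp1 : 1 ≤ p := one_le_two.trans hp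
  obtain ⟨G, hG, hr, hn⟩ := exists_represents_of_lpNorm_ne_top (hp1.trans hpq) hT
  refine ((hr.comm (temperate_component hv i) b).lpNorm_le p).trans ?_
  rw [← hn]
  have hp0 : p ≠ 0 := (zero_lt_one.trans_le hp1).ne'
  have hp2 : 2 ≤ p.toReal := by
    rw [← ENNReal.toReal_ofNat]; exact (ENNReal.toReal_le_toReal (by simp) hpt).2 hp
  have hconj : p.toReal.HolderConjugate (p.toReal.conjExponent) :=
    Real.HolderConjugate.conjExponent (by linarith)
  set p' := p.toReal.conjExponent with hp'
  have hp'1 : 1 < p' := hconj.symm.lt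
  -- This is where p ≥ 2 enters: the conjugate exponent satisfies p' ≤ p ≤ q, so the L^{p'} norm of
  -- the translates of G against the finite profile measure is controlled by its L^q norm.
  have hp'p : p' ≤ p.toReal := by
    rw [hp', Real.conjExponent, div_le_iff₀ (by linarith)]
    nlinarith
  set B := profConst d * ENNReal.ofReal t ^ ((d : ℝ) / q.toReal) * eLpNorm G q volume with hB
  have hS : ∀ x, (∫⁻ z, ‖G (x - z)‖ₑ ^ p' ∂(profMeasure d t)) ^ (1 / p') ≤ B := fun x => by
    have := eLpNorm_comp_sub_left_profMeasure_le ht (s := ENNReal.ofReal p') (q := q)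
      (by simpa using hp'1.le) ((ENNReal.ofReal_le_of_le_toReal hp'p).trans hpq) hG.1 x
    rwa [eLpNorm_eq_lintegral_rpow_enorm_toReal (by simp; linarith) (by simp),
      ENNReal.toReal_ofReal (by linarith)] at this
  -- The factor ‖z‖ of the increment is absorbed by the kernel and gives t⁻¹; Hölder then separates
  -- the gradient mean, kept in L^p for Fubini, from G, which is bounded uniformly in x.
  have hpw : ∀ x, ‖∫ z, kernel b z * ((component v i (x - z) - component v i x) * G (x - z))‖ₑ ≤
      (ENNReal.ofReal (C * t⁻¹) * B) *
        (∫⁻ z, segmentMean v x z ^ p.toReal ∂(profMeasure d t)) ^ (1 / p.toReal) := fun x => by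
    refine (enorm_integral_le_lintegral_enorm _).trans ?_
    have h1 := h.lintegral_le ht hC zero_le_one le_rfl (fun z => segmentMean v x z * ‖G (x - z)‖ₑ)
    simp only [Real.rpow_one, Real.rpow_neg_one] at h1
    calc _ ≤ ∫⁻ z, ENNReal.ofReal ‖z‖ * ‖kernel b z‖ₑ * (segmentMean v x z * ‖G (x - z)‖ₑ) := by
          refine lintegral_mono fun z => ?_
          rw [enorm_mul, enorm_mul]
          calc _ ≤ ‖kernel b z‖ₑ * ((ENNReal.ofReal ‖z‖ * segmentMean v x z) * ‖G (x - z)‖ₑ) := by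
                gcongr
                exact enorm_component_sub_le_segmentMean hv.1 i x z
            _ = _ := by ring
      _ ≤ _ := h1
      _ ≤ ENNReal.ofReal (C * t⁻¹) *
          ((∫⁻ z, segmentMean v x z ^ p.toReal ∂(profMeasure d t)) ^ (1 / p.toReal) *
            (∫⁻ z, ‖G (x - z)‖ₑ ^ p' ∂(profMeasure d t)) ^ (1 / p')) := by
          gcongr
          refine ENNReal.lintegral_mul_le_Lp_mul_Lq _ hconj
            ((measurable_segmentMean hv.1).comp (by fun_prop : Measurable fun z => (x, z))).aemeasurable ?_
          have hGx : AEStronglyMeasurable (fun z => G (x - z)) volume :=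
            hG.1.comp_measurePreserving (Measure.measurePreserving_sub_left volume x)
          exact (hGx.mono_ac (profMeasure_absolutelyContinuous t)).enorm
      _ ≤ ENNReal.ofReal (C * t⁻¹) *
          ((∫⁻ z, segmentMean v x z ^ p.toReal ∂(profMeasure d t)) ^ (1 / p.toReal) * B) := by
          gcongr
          exact hS x
      _ = _ := by ring
  have hA : ENNReal.ofReal (C * t⁻¹) * B ≠ ⊤ := by
    refine ENNReal.mul_ne_top (by simp) (ENNReal.mul_ne_top (ENNReal.mul_ne_top profConst_ne_top
      (ENNReal.rpow_ne_top_of_nonneg (by positivity) (by simp))) hG.2.ne)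
  have hfin : ENNReal.ofReal (C * t⁻¹) * (profConst d ^ 2 *
      ENNReal.ofReal t ^ ((d : ℝ) / q.toReal) * eLpNorm G q volume) *
        eLpNorm (fderiv ℝ v) p volume = (ENNReal.ofReal (C * t⁻¹) * B) *
          (profConst d * eLpNorm (fderiv ℝ v) p volume) := by
    rw [hB]; ring
  rw [hfin]
  generalize ENNReal.ofReal (C * t⁻¹) * B = A at hpw hA ⊢
  rw [eLpNorm_eq_lintegral_rpow_enorm_toReal hp0 hpt, eLpNorm_eq_lintegral_rpow_enorm_toReal hp0 hpt]
  have h0 : 0 ≤ 1 / p.toReal := by positivity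
  calc _ ≤ (∫⁻ x, A ^ p.toReal *
        ∫⁻ z, segmentMean v x z ^ p.toReal ∂(profMeasure d t)) ^ (1 / p.toReal) := by
        gcongr with x
        refine (ENNReal.rpow_le_rpow (hpw x) (by linarith)).trans_eq ?_
        rw [ENNReal.mul_rpow_of_nonneg _ _ (by linarith), ← ENNReal.rpow_mul,
          one_div_mul_cancel (by linarith), ENNReal.rpow_one]
    _ = A * (∫⁻ x, ∫⁻ z, segmentMean v x z ^ p.toReal ∂(profMeasure d t)) ^ (1 / p.toReal) := by
        rw [lintegral_const_mul' _ _ (ENNReal.rpow_ne_top_of_nonneg (by linarith) hA),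
          ENNReal.mul_rpow_of_nonneg _ _ h0, ← ENNReal.rpow_mul,
          mul_one_div_cancel (by linarith), ENNReal.rpow_one]
    _ ≤ A * (profConst d * ∫⁻ x, ‖fderiv ℝ v x‖ₑ ^ p.toReal) ^ (1 / p.toReal) := by
        gcongr
        exact lintegral_segmentMean_le hv.1 ht (by linarith)
    _ = A * (profConst d ^ (1 / p.toReal) *
          (∫⁻ x, ‖fderiv ℝ v x‖ₑ ^ p.toReal) ^ (1 / p.toReal)) := by
        rw [ENNReal.mul_rpow_of_nonneg _ _ h0]
    _ ≤ _ := by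
        gcongr
        calc _ ≤ profConst d ^ (1 : ℝ) := ENNReal.rpow_le_rpow_of_exponent_le one_le_profConst
              (by rw [div_le_one (by linarith)]; linarith)
          _ = _ := ENNReal.rpow_one _

/-- Commutator estimate in `L^∞` for vector fields with a Hölder modulus of continuity. -/
lemma lpNorm_top_comm_le {t C : ℝ} {b : 𝓢(Space d, ℂ)} (h : KerBound t C (kernel b))
    (ht : 0 < t) (hC : 0 ≤ C) {q : ℝ≥0∞} (hq : 1 ≤ q)
    {v : Space d → Space d} (hv : v.HasTemperateGrowth) (i : Fin d) {Λ : ℝ≥0∞} {c : ℝ}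
    (hc0 : 0 ≤ c) (hc1 : c ≤ 1)
    (hΛ : ∀ x z, ‖component v i (x - z) - component v i x‖ₑ ≤
      Λ * (ENNReal.ofReal (‖z‖ ^ (1 : ℝ)) + ENNReal.ofReal (‖z‖ ^ c)))
    {T : 𝓢'(Space d, ℂ)} (hT : lpNorm q T ≠ ⊤) :
    lpNorm ⊤ (comm b (component v i) T) ≤
      (ENNReal.ofReal (C * t ^ (-1 : ℝ)) + ENNReal.ofReal (C * t ^ (-c))) *
      (profConst d * ENNReal.ofReal t ^ ((d : ℝ) / q.toReal) * lpNorm q T) * Λ := by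
  obtain ⟨G, hG, hr, hn⟩ := exists_represents_of_lpNorm_ne_top hq hT
  refine ((hr.comm (temperate_component hv i) b).lpNorm_le ⊤).trans ?_
  rw [eLpNorm_exponent_top, ← hn]
  refine eLpNormEssSup_le_of_ae_enorm_bound (Eventually.of_forall fun x => ?_)
  refine (enorm_integral_le_lintegral_enorm _).trans ?_
  -- The two terms of the modulus of continuity are treated as two moments of the kernel, of orders
  -- 1 and c.
  have h1 := h.lintegral_le ht hC zero_le_one le_rfl (fun z => Λ * ‖G (x - z)‖ₑ)
  have h2 := h.lintegral_le ht hC hc0 hc1 (fun z => Λ * ‖G (x - z)‖ₑ)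
  have hGx : AEStronglyMeasurable (fun z => G (x - z)) volume :=
    hG.1.comp_measurePreserving (Measure.measurePreserving_sub_left volume x)
  have h3 : ∫⁻ z, Λ * ‖G (x - z)‖ₑ ∂(profMeasure d t) ≤ 
      Λ * (profConst d * ENNReal.ofReal t ^ ((d : ℝ) / q.toReal) * eLpNorm G q volume) := by
    rw [lintegral_const_mul'' _ (hGx.mono_ac (profMeasure_absolutelyContinuous t)).enorm,
      ← eLpNorm_one_eq_lintegral_enorm]
    gcongr
    exact eLpNorm_comp_sub_left_profMeasure_le ht le_rfl hq hG.1 x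
  calc _ ≤ ∫⁻ z, (ENNReal.ofReal (‖z‖ ^ (1 : ℝ)) * ‖kernel b z‖ₑ * (Λ * ‖G (x - z)‖ₑ) +
        ENNReal.ofReal (‖z‖ ^ c) * ‖kernel b z‖ₑ * (Λ * ‖G (x - z)‖ₑ)) := by
        refine lintegral_mono fun z => ?_
        rw [enorm_mul, enorm_mul]
        calc _ ≤ ‖kernel b z‖ₑ * ((Λ * (ENNReal.ofReal (‖z‖ ^ (1 : ℝ)) +
              ENNReal.ofReal (‖z‖ ^ c))) * ‖G (x - z)‖ₑ) := by
              gcongr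
              exact hΛ x z
          _ = _ := by ring
    _ = _ := lintegral_add_left' (((by fun_prop : Measurable fun z : Space d =>
          ENNReal.ofReal (‖z‖ ^ (1 : ℝ))).aemeasurable.mul
            (kernel b).continuous.enorm.measurable.aemeasurable).mul
              (hGx.enorm.const_mul Λ)) _
    _ ≤ _ := add_le_add h1 h2
    _ ≤ (ENNReal.ofReal (C * t ^ (-1 : ℝ)) + ENNReal.ofReal (C * t ^ (-c))) *
      (Λ * (profConst d * ENNReal.ofReal t ^ ((d : ℝ) / q.toReal) * eLpNorm G q volume)) := by
        rw [← add_mul]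
        gcongr
    _ = _ := by ring

/-! ### Bounded families of symbols -/

/-- A family of smooth functions supported in a common ball with uniformly bounded derivatives. -/
structure BddFamily {ι : Type*} (F : ι → Space d → ℂ) : Prop where
  smooth : ∀ i, ContDiff ℝ ∞ (F i)
  support : ∃ R : ℝ, ∀ i ξ, R < ‖ξ‖ → F i ξ = 0
  bound : ∀ n : ℕ, ∃ M : ℝ, ∀ i ξ, ‖iteratedFDeriv ℝ n (F i) ξ‖ ≤ M

lemma BddFamily.hasCompactSupport {ι : Type*} {F : ι → Space d → ℂ} (hF : BddFamily F) (i : ι) :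
    HasCompactSupport (F i) := by
  obtain ⟨R, hR⟩ := hF.support
  refine HasCompactSupport.intro (isCompact_closedBall (0 : Space d) R) fun ξ hξ => hR i ξ ?_
  simpa using hξ

lemma bddFamily_const {ψ : Space d → ℂ} (hψ : ContDiff ℝ ∞ ψ) (hc : HasCompactSupport ψ) :
    BddFamily (fun _ : Unit => ψ) where
  smooth _ := hψ
  support := by
    obtain ⟨R, hR⟩ := hc.isCompact.isBounded.subset_closedBall (0 : Space d)
    refine ⟨R, fun _ ξ hξ => image_eq_zero_of_notMem_tsupport fun h => ?_⟩
    have := hR h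
    simp at this
    linarith
  bound n := by
    obtain ⟨M, hM⟩ := (hψ.continuous_iteratedFDeriv (m := n)
      (mod_cast le_top)).bounded_above_of_compact_support (hc.iteratedFDeriv n)
    exact ⟨M, fun _ => hM⟩

/-- The inverse Fourier transform is continuous on Schwartz space, so the two seminorms that control
decay of order d + 3 are bounded by finitely many seminorms of the symbols. Those are uniformly
bounded because of the common support. -/
lemma exists_kerBound_one {ι : Type*} {F : ι → Space d → ℂ} (hF : BddFamily F) :
    ∃ C : ℝ, 0 ≤ C ∧ ∀ i, KerBound 1 C
      (kernel ((hF.hasCompactSupport i).toSchwartzMap (hF.smooth i))) := by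
  set b : ι → 𝓢(Space d, ℂ) := fun i => (hF.hasCompactSupport i).toSchwartzMap (hF.smooth i)
  obtain ⟨R, hR⟩ := hF.support
  have hsem : ∀ k n : ℕ, ∃ M : ℝ, 0 ≤ M ∧ ∀ i, SchwartzMap.seminorm ℂ k n (b i) ≤ M := by
    intro k n
    obtain ⟨M, hM⟩ := hF.bound n
    refine ⟨|R| ^ k * |M|, by positivity, fun i =>
      SchwartzMap.seminorm_le_bound ℂ k n _ (by positivity) fun ξ => ?_⟩
    by_cases hξ : ‖ξ‖ ≤ |R|
    · gcongr
      exact (hM i ξ).trans (le_abs_self M)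
    · have h0 : iteratedFDeriv ℝ n (F i) ξ = 0 := by
        refine image_eq_zero_of_notMem_tsupport fun h => hξ ?_
        have h1 : tsupport (iteratedFDeriv ℝ n (F i)) ⊆ Metric.closedBall 0 |R| :=
          (tsupport_iteratedFDeriv_subset n).trans (closure_minimal (fun x hx => by
            by_contra hx'
            simp only [Metric.mem_closedBall, dist_zero_right, not_le] at hx'
            exact hx (hR i x ((le_abs_self R).trans_lt hx'))) Metric.isClosed_closedBall)
        simpa using h1 h
      have h1 : iteratedFDeriv ℝ n (b i) ξ = 0 := h0
      rw [h1, norm_zero, mul_zero]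
      positivity
  choose M hM0 hM using hsem
  set L : 𝓢(Space d, ℂ) →L[ℂ] 𝓢(Space d, ℂ) :=
    (FourierTransform.fourierInvCLM ℂ 𝓢(Space d, ℂ)).comp
      (SchwartzMap.compCLMOfContinuousLinearEquiv ℂ (dilation (2 * Real.pi) (by positivity)))
  have hL : ∀ k, ∃ D : ℝ, 0 ≤ D ∧ ∀ i, SchwartzMap.seminorm ℂ k 0 (L (b i)) ≤ D := by
    intro k
    have hc : Continuous ((SchwartzMap.seminorm ℂ k 0 : Seminorm ℂ 𝓢(Space d, ℂ)).comp
        L.toLinearMap) := 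
      ((schwartz_withSeminorms ℂ (Space d) ℂ).continuous_seminorm (k, 0)).comp L.continuous
    obtain ⟨s, D, -, hD⟩ := Seminorm.bound_of_continuous
      (schwartz_withSeminorms ℂ (Space d) ℂ) _ hc
    refine ⟨D * ∑ q ∈ s, M q.1 q.2, mul_nonneg D.2 (Finset.sum_nonneg fun q _ => hM0 _ _),
      fun i => (hD (b i)).trans ?_⟩
    have h1 : (s.sup (schwartzSeminormFamily ℂ (Space d) ℂ)) (b i) ≤ ∑ q ∈ s, M q.1 q.2 :=
      Seminorm.finset_sup_apply_le (Finset.sum_nonneg fun q _ => hM0 _ _) fun q hq =>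
        (hM q.1 q.2 i).trans (Finset.single_le_sum (f := fun q : ℕ × ℕ => M q.1 q.2)
          (fun q _ => hM0 q.1 q.2) hq)
    rw [smul_apply]
    exact mul_le_mul_of_nonneg_left h1 D.2
  choose D hD0 hD using hL
  refine ⟨2 ^ (d + 3) * (D 0 + D (d + 3)), by have := hD0 0; have := hD0 (d + 3); positivity,
    fun i z => ?_⟩
  have e0 := (SchwartzMap.norm_pow_mul_le_seminorm ℂ (L (b i)) 0 z).trans (hD 0 i)
  have e1 := (SchwartzMap.norm_pow_mul_le_seminorm ℂ (L (b i)) (d + 3) z).trans (hD (d + 3) i)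
  have hk : kernel (b i) = L (b i) := rfl
  rw [hk, one_pow, one_mul, one_mul, ← div_eq_mul_inv, le_div_iff₀ (by positivity)]
  have h2 : (1 + ‖z‖) ^ (d + 3) ≤ 2 ^ (d + 3) * (1 + ‖z‖ ^ (d + 3)) := by
    have h3 : 1 + ‖z‖ ≤ 2 * max 1 ‖z‖ := by
      linarith [le_max_left 1 ‖z‖, le_max_right 1 ‖z‖]
    calc _ ≤ (2 * max 1 ‖z‖) ^ (d + 3) := by gcongr
      _ = 2 ^ (d + 3) * (max 1 ‖z‖) ^ (d + 3) := mul_pow _ _ _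
      _ ≤ _ := by
        gcongr
        rcases max_choice 1 ‖z‖ with h | h <;> rw [h]
        · rw [one_pow]; linarith [pow_nonneg (norm_nonneg z) (d + 3)]
        · linarith
  rw [pow_zero, one_mul] at e0
  calc _ ≤ ‖L (b i) z‖ * (2 ^ (d + 3) * (1 + ‖z‖ ^ (d + 3))) := by gcongr
    _ = 2 ^ (d + 3) * (‖L (b i) z‖ + ‖z‖ ^ (d + 3) * ‖L (b i) z‖) := by ring
    _ ≤ _ := by gcongr

/-- `a` is a Schwartz symbol whose kernel is localized at scale `t⁻¹`. -/
def Localized (t C : ℝ) (a : Space d → ℂ) : Prop :=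
  ∃ b : 𝓢(Space d, ℂ), (b : Space d → ℂ) = a ∧ KerBound t C (kernel b)

/-- The change of variables ξ → tξ in the inverse Fourier integral. -/
lemma kernel_dilation (b b' : 𝓢(Space d, ℂ)) {t : ℝ} (ht : 0 < t) (h : ∀ ξ, b' ξ = b (t⁻¹ • ξ))
    (z : Space d) : kernel b' z = t ^ d * kernel b (t • z) := by
  have hk : ∀ (b : 𝓢(Space d, ℂ)) z, kernel b z = ∫ ξ : Space d,
      Complex.exp (↑(2 * Real.pi * inner ℝ ξ z) * Complex.I) • b ((2 * Real.pi) • ξ) := fun b z => by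
    rw [kernel, SchwartzMap.fourierInv_coe, Real.fourierInv_eq']
    rfl
  rw [hk, hk]
  have h2 := Measure.integral_comp_smul_of_nonneg (volume : Measure (Space d))
    (fun ξ : Space d => Complex.exp (↑(2 * Real.pi * inner ℝ ξ (t • z)) * Complex.I) •
      b ((2 * Real.pi) • ξ)) t⁻¹ (hR := (inv_pos.2 ht).le)
  have h3 : ∀ ξ : Space d, b ((2 * Real.pi) • t⁻¹ • ξ) = b' ((2 * Real.pi) • ξ) := fun ξ => by
    rw [h, smul_comm]
  have h4 : ∀ ξ : Space d, inner ℝ (t⁻¹ • ξ) (t • z) = inner ℝ ξ z := fun ξ => by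
    rw [inner_smul_left, inner_smul_right]
    simp [ht.ne']
  simp only [h3, h4] at h2
  rw [h2, finrank_euclideanSpace, Fintype.card_fin, inv_pow, inv_inv]
  simp

lemma kernel_smul (b : 𝓢(Space d, ℂ)) (A : ℂ) : kernel (A • b) = A • kernel b := by
  rw [kernel, map_smul, FourierTransform.fourierInv_smul, kernel]

/-- The dilations of a bounded family of symbols are localized uniformly. -/
lemma BddFamily.localized {ι : Type*} {F : ι → Space d → ℂ} (hF : BddFamily F) :
    ∃ C : ℝ, 0 ≤ C ∧ ∀ (i : ι) (t : ℝ) (A : ℂ), 0 < t →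
      Localized t (‖A‖ * C) (fun ξ => A * F i (t⁻¹ • ξ)) := by
  obtain ⟨C, hC, h⟩ := exists_kerBound_one hF
  refine ⟨C, hC, fun i t A ht => ?_⟩
  set b := (hF.hasCompactSupport i).toSchwartzMap (hF.smooth i)
  set b' := SchwartzMap.compCLMOfContinuousLinearEquiv ℂ
    (dilation t⁻¹ (inv_ne_zero ht.ne')) b
  refine ⟨A • b', rfl, fun z => ?_⟩
  rw [kernel_smul, smul_apply, kernel_dilation b b' ht fun ξ => rfl]
  have h1 := h i (t • z)
  rw [one_pow, one_mul, one_mul, norm_smul, Real.norm_of_nonneg ht.le] at h1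
  rw [smul_eq_mul, norm_mul, norm_mul, norm_pow, Complex.norm_real, Real.norm_of_nonneg ht.le]
  calc _ ≤ ‖A‖ * (t ^ d * (C * ((1 + t * ‖z‖) ^ (d + 3))⁻¹)) := by gcongr
    _ = _ := by ring

lemma Localized.temperate {t C : ℝ} {a : Space d → ℂ} (h : Localized t C a) :
    a.HasTemperateGrowth := by
  obtain ⟨b, rfl, -⟩ := h
  exact b.hasTemperateGrowth

lemma Localized.mono {t C C' : ℝ} {a : Space d → ℂ} (h : Localized t C a) (ht : 0 < t)
    (hC : C ≤ C') : Localized t C' a := by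
  obtain ⟨b, hb, h⟩ := h
  exact ⟨b, hb, fun z => (h z).trans (by gcongr)⟩

/-! ### Families depending smoothly on parameters -/

/-- Restricting to a slice is composition with the inclusion of the second factor, which has norm at
most one. -/
lemma norm_iteratedFDeriv_slice_le {V W F : Type*} [NormedAddCommGroup V] [NormedSpace ℝ V]
    [NormedAddCommGroup W] [NormedSpace ℝ W] [NormedAddCommGroup F] [NormedSpace ℝ F]
    {G : V × W → F} {s : V} {ζ : W} (h : ContDiffAt ℝ ∞ G (s, ζ)) (n : ℕ) :
    ‖iteratedFDeriv ℝ n (fun w => G (s, w)) ζ‖ ≤ ‖iteratedFDeriv ℝ n G (s, ζ)‖ := by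
  set H : V × W → F := fun q => G ((s, 0) + q) with hH
  have hHd : ContDiffAt ℝ n H (0, ζ) := by
    have : ContDiffAt ℝ n G ((s, 0) + (0, ζ)) := by
      simpa using h.of_le (mod_cast le_top)
    exact this.comp (0, ζ) (contDiffAt_const.add contDiffAt_id)
  obtain ⟨u, hu, hHu⟩ := hHd.contDiffOn le_rfl (by simp)
  obtain ⟨u', hu', hopen, hmem⟩ := mem_nhds_iff.1 hu
  have hpre : IsOpen (ContinuousLinearMap.inr ℝ V W ⁻¹' u') :=
    hopen.preimage (ContinuousLinearMap.inr ℝ V W).continuous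
  have h1 := (ContinuousLinearMap.inr ℝ V W).iteratedFDerivWithin_comp_right (hHu.mono hu')
    hopen.uniqueDiffOn hpre.uniqueDiffOn (x := ζ) hmem (i := n) le_rfl
  rw [iteratedFDerivWithin_of_isOpen n hpre (by exact hmem),
    iteratedFDerivWithin_of_isOpen n hopen (by exact hmem)] at h1
  have h2 : H ∘ (ContinuousLinearMap.inr ℝ V W) = fun w => G (s, w) := by
    ext w; simp [hH]
  have h3 : iteratedFDeriv ℝ n H (0, ζ) = iteratedFDeriv ℝ n G (s, ζ) := by
    rw [hH, iteratedFDeriv_comp_add_left]; simp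
  rw [h2] at h1
  rw [h1]
  refine (ContinuousMultilinearMap.norm_compContinuousLinearMap_le _ _).trans ?_
  rw [ContinuousLinearMap.inr_apply, h3, Finset.prod_const]
  refine mul_le_of_le_one_right (norm_nonneg _) (pow_le_one₀ (norm_nonneg _) ?_)
  exact ContinuousLinearMap.norm_inr_le_one ℝ V W

/-- Joint smoothness in parameter and frequency makes each derivative continuous on the compact
product of the parameter set and the support, hence bounded. Uniform symbol estimates thus reduce to
the choice of a compact parametrization. -/
lemma bddFamily_of_compact {V ι : Type*} [NormedAddCommGroup V] [NormedSpace ℝ V] {Θ : Set V}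
    (hΘ : IsCompact Θ) {Kc : Set (Space d)} (hK : IsCompact Kc) {G : V × Space d → ℂ}
    (hG : ∀ s ∈ Θ, ∀ ζ ∈ Kc, ContDiffAt ℝ ∞ G (s, ζ)) (h0 : ∀ s ∈ Θ, ∀ ζ ∉ Kc, G (s, ζ) = 0)
    (σ : ι → V) (hσ : ∀ i, σ i ∈ Θ) :
    BddFamily (fun i ζ => G (σ i, ζ)) := by
  have hloc : ∀ i, ∀ ζ ∉ Kc, (fun w => G (σ i, w)) =ᶠ[𝓝 ζ] fun _ => 0 := fun i ζ hζ => by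
    filter_upwards [hK.isClosed.isOpen_compl.mem_nhds hζ] with w hw
    exact h0 _ (hσ i) w hw
  refine ⟨fun i => contDiff_iff_contDiffAt.2 fun ζ => ?_, ?_, fun n => ?_⟩
  · by_cases hζ : ζ ∈ Kc
    · exact (hG _ (hσ i) ζ hζ).comp ζ (contDiffAt_const.prodMk contDiffAt_id)
    · exact contDiffAt_const.congr_of_eventuallyEq (hloc i ζ hζ)
  · obtain ⟨R, hR⟩ := hK.isBounded.subset_closedBall (0 : Space d)
    refine ⟨R, fun i ξ hξ => h0 _ (hσ i) ξ fun h => ?_⟩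
    have := hR h
    simp at this
    linarith
  · have hc : ContinuousOn (iteratedFDeriv ℝ n G) (Θ ×ˢ Kc) := fun q hq =>
      ((hG q.1 hq.1 q.2 hq.2).iteratedFDeriv_right (m := 0) (i := n)
        (by simp; exact_mod_cast le_top)).continuousAt.continuousWithinAt
    obtain ⟨M, hM⟩ := (hΘ.prod hK).exists_bound_of_continuousOn hc
    refine ⟨max M 0, fun i ζ => ?_⟩
    by_cases hζ : ζ ∈ Kc
    · exact (norm_iteratedFDeriv_slice_le (hG _ (hσ i) ζ hζ) n).trans
        ((hM (σ i, ζ) ⟨hσ i, hζ⟩).trans (le_max_left _ _))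
    · rw [(hloc i ζ hζ).iteratedFDeriv ℝ n |>.eq_of_nhds]
      have : iteratedFDeriv ℝ n (fun _ : Space d => (0 : ℂ)) ζ = 0 := by
        rw [iteratedFDeriv_fun_zero]; rfl
      rw [this, norm_zero]
      exact le_max_right _ _

/-- A test function supported away from the origin. -/
structure Annular (ψ : Space d → ℂ) : Prop where
  smooth : ContDiff ℝ ∞ ψ
  compact : HasCompactSupport ψ
  away : (0 : Space d) ∉ tsupport ψ

lemma Annular.ne_zero {ψ : Space d → ℂ} (hψ : Annular ψ) {ζ : Space d} (hζ : ζ ∈ tsupport ψ) :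
    ζ ≠ 0 := fun h => hψ.away (h ▸ hζ)

lemma Annular.map_zero {ψ : Space d → ℂ} (hψ : Annular ψ) : ψ 0 = 0 :=
  image_eq_zero_of_notMem_tsupport hψ.away

/-- The product of an annular cut-off and a function which is smooth away from the origin. -/
lemma Annular.mul {ψ h : Space d → ℂ} (hψ : Annular ψ) (hh : ∀ ζ ≠ 0, ContDiffAt ℝ ∞ h ζ) :
    Annular (fun ξ => ψ ξ * h ξ) := by
  have hs : tsupport (fun ξ => ψ ξ * h ξ) ⊆ tsupport ψ :=
    closure_mono fun x hx => left_ne_zero_of_mul hx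
  refine ⟨contDiff_iff_contDiffAt.2 fun ζ => ?_, hψ.compact.mul_right, fun h0 => hψ.away (hs h0)⟩
  by_cases hζ : ζ ∈ tsupport ψ
  · exact hψ.smooth.contDiffAt.mul (hh ζ (hψ.ne_zero hζ))
  · have : (fun ξ => ψ ξ * h ξ) =ᶠ[𝓝 ζ] fun _ => 0 := by
      filter_upwards [(isClosed_tsupport ψ).isOpen_compl.mem_nhds hζ] with w hw
      rw [image_eq_zero_of_notMem_tsupport hw, zero_mul]
    exact contDiffAt_const.congr_of_eventuallyEq this

lemma contDiffAt_coord {V : Type*} [NormedAddCommGroup V] [NormedSpace ℝ V] {f : V → Space d}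
    {x : V} (hf : ContDiffAt ℝ ∞ f x) (i : Fin d) : ContDiffAt ℝ ∞ (fun y => f y i) x :=
  (EuclideanSpace.proj i : Space d →L[ℝ] ℝ).contDiff.contDiffAt.comp x hf

/-- The rescaled high frequency parts of the logarithmic Riesz symbol form a bounded family. -/
lemma Annular.exists_bddFamily_logRieszSymbol [NeZero d] {α lam : ℝ} (hlam : 1 < lam)
    {ψ : Space d → ℂ} (hψ : Annular ψ) :
    ∃ F : ℕ → Space d → ℂ, BddFamily F ∧ ∀ (k : ℕ) (ξ : Space d),
      ψ (((2 : ℝ) ^ k)⁻¹ • ξ) * logRieszSymbol α lam ξ =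
      ((((k : ℝ) + 1) ^ α : ℝ) : ℂ) * F k (((2 : ℝ) ^ k)⁻¹ • ξ) := by
  -- With s = 2^{-k}, τ = 1/(k+1) and ξ = 2^k ζ, the logarithm log(λ + |ξ|) equals (k+1)(log 2 +
  -- τ(log(λs + |ζ|) − log 2)). The parameters (s, τ) converge to (0,0); adding the limit makes the
  -- parameter set compact, and there the bracket is log 2 > 0.
  set σ : ℕ → ℝ × ℝ := fun k => (((2 : ℝ) ^ k)⁻¹, 1 / ((k : ℝ) + 1)) with hσ
  set Θ : Set (ℝ × ℝ) := insert (0, 0) (Set.range σ) with hΘdef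
  have hΘ : IsCompact Θ := by
    refine Tendsto.isCompact_insert_range (Tendsto.prodMk_nhds ?_ ?_)
    · exact (tendsto_pow_atTop_atTop_of_one_lt one_lt_two).inv_tendsto_atTop
    · exact tendsto_one_div_add_atTop_nhds_zero_nat
  set G : (ℝ × ℝ) × Space d → ℂ := fun q => ψ q.2 * (Complex.I * (((q.2 0 / ‖q.2‖) *
    (Real.log 2 + q.1.2 * (Real.log (lam * q.1.1 + ‖q.2‖) - Real.log 2)) ^ α : ℝ) : ℂ)) with hG
  have hbase : ∀ (k : ℕ) (ζ : Space d), ζ ≠ 0 → ((k : ℝ) + 1) * (Real.log 2 + (σ k).2 *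
      (Real.log (lam * (σ k).1 + ‖ζ‖) - Real.log 2)) = Real.log (lam + 2 ^ k * ‖ζ‖) := by
    intro k ζ hζ
    have hpos : 0 < ‖ζ‖ := norm_pos_iff.2 hζ
    have h1 : lam + 2 ^ k * ‖ζ‖ = 2 ^ k * (lam * ((2 : ℝ) ^ k)⁻¹ + ‖ζ‖) := by
      field_simp
    rw [h1, Real.log_mul (by positivity) (by positivity), Real.log_pow]
    simp only [hσ]
    field_simp
    ring
  have hpos : ∀ (k : ℕ) (ζ : Space d), ζ ≠ 0 → 0 < Real.log 2 + (σ k).2 *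
      (Real.log (lam * (σ k).1 + ‖ζ‖) - Real.log 2) := by
    intro k ζ hζ
    have h1 := hbase k ζ hζ
    have h2 : 0 < Real.log (lam + 2 ^ k * ‖ζ‖) := Real.log_pos (by
      have : 0 ≤ 2 ^ k * ‖ζ‖ := by positivity
      linarith)
    rw [← h1] at h2
    exact pos_of_mul_pos_right h2 (by positivity)
  have hGd : ∀ s ∈ Θ, ∀ ζ ∈ tsupport ψ, ContDiffAt ℝ ∞ G (s, ζ) := by
    intro s hs ζ hζ
    have hζ0 := hψ.ne_zero hζ
    have hn : 0 < ‖ζ‖ := norm_pos_iff.2 hζ0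
    -- Positivity of the bracket keeps its power α smooth. For finite k it comes from λ > 1, which
    -- makes the logarithm positive.
    have hs0 : 0 ≤ s.1 ∧ 0 < Real.log 2 + s.2 * (Real.log (lam * s.1 + ‖ζ‖) - Real.log 2) := by
      rcases hs with rfl | ⟨k, rfl⟩
      · exact ⟨le_rfl, by simp [Real.log_pos one_lt_two]⟩
      · exact ⟨by simp [hσ], hpos k ζ hζ0⟩
    have c2 : ContDiffAt ℝ ∞ (fun q : (ℝ × ℝ) × Space d => q.2) (s, ζ) := contDiffAt_snd
    have cs : ContDiffAt ℝ ∞ (fun q : (ℝ × ℝ) × Space d => q.1.1) (s, ζ) :=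
      contDiffAt_fst.fst
    have cτ : ContDiffAt ℝ ∞ (fun q : (ℝ × ℝ) × Space d => q.1.2) (s, ζ) :=
      contDiffAt_fst.snd
    have cn : ContDiffAt ℝ ∞ (fun q : (ℝ × ℝ) × Space d => ‖q.2‖) (s, ζ) := c2.norm ℝ hζ0
    have cl := ((contDiffAt_const (c := lam)).mul cs).add cn
    have cl2 := cl.log (by have := mul_nonneg (by linarith : 0 ≤ lam) hs0.1; simp; positivity)
    have cb := (contDiffAt_const (c := Real.log 2)).add
      (cτ.mul (cl2.sub (contDiffAt_const (c := Real.log 2))))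
    have cr := ((contDiffAt_coord c2 0).div cn hn.ne').mul
      (cb.rpow_const_of_ne (p := α) hs0.2.ne')
    exact (hψ.smooth.contDiffAt.comp _ c2).mul (contDiffAt_const.mul
      (Complex.ofRealCLM.contDiff.contDiffAt.comp _ cr))
  have hF := bddFamily_of_compact hΘ hψ.compact hGd
    (fun s _ ζ hζ => by simp [hG, image_eq_zero_of_notMem_tsupport hζ]) σ
    (fun k => Set.mem_insert_of_mem _ ⟨k, rfl⟩)
  refine ⟨_, hF, fun k ξ => ?_⟩
  by_cases hξ : ξ = 0
  · subst hξ
    simp [hG, hψ.map_zero]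
  set ζ : Space d := ((2 : ℝ) ^ k)⁻¹ • ξ with hζ
  have hζ0 : ζ ≠ 0 := smul_ne_zero (by positivity) hξ
  have hξζ : ξ = (2 : ℝ) ^ k • ζ := by rw [hζ, smul_smul, mul_inv_cancel₀ (by positivity), one_smul]
  simp only [hG, logRieszSymbol]
  have h3 : Real.log (lam + ‖ξ‖) ^ α = ((k : ℝ) + 1) ^ α * (Real.log 2 + (σ k).2 *
      (Real.log (lam * (σ k).1 + ‖ζ‖) - Real.log 2)) ^ α := by
    rw [← Real.mul_rpow (by positivity) (hpos k ζ hζ0).le, hbase k ζ hζ0, hξζ, norm_smul]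
    simp
  have h4 : ξ 0 / ‖ξ‖ = ζ 0 / ‖ζ‖ := by
    rw [hξζ, norm_smul, PiLp.smul_apply, smul_eq_mul, Real.norm_of_nonneg (by positivity),
      mul_div_mul_left _ _ (by positivity)]
  rw [h3, h4]
  push_cast
  ring

/-- The logarithmic Riesz symbol is localized with the logarithmic weight on high frequencies. -/
lemma Annular.localized_mul_logRieszSymbol [NeZero d] {α lam : ℝ} (hlam : 1 < lam)
    {ψ : Space d → ℂ} (hψ : Annular ψ) :
    ∃ C : ℝ, 0 ≤ C ∧ ∀ (k : ℕ) (A : ℂ), Localized (2 ^ k) (‖A‖ * C * ((k : ℝ) + 1) ^ α)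
      (fun ξ => A * (ψ (((2 : ℝ) ^ k)⁻¹ • ξ) * logRieszSymbol α lam ξ)) := by
  obtain ⟨F, hF, hFe⟩ := hψ.exists_bddFamily_logRieszSymbol (α := α) hlam
  obtain ⟨C, hC, h⟩ := hF.localized
  refine ⟨C, hC, fun k A => ?_⟩
  have h1 := h k (2 ^ k) (A * ((((k : ℝ) + 1) ^ α : ℝ) : ℂ)) (by positivity)
  have h2 : ‖A * ((((k : ℝ) + 1) ^ α : ℝ) : ℂ)‖ * C = ‖A‖ * C * ((k : ℝ) + 1) ^ α := by
    rw [norm_mul, Complex.norm_real, Real.norm_of_nonneg (by positivity)]; ring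
  rw [h2] at h1
  convert h1 using 2 with ξ
  rw [hFe, mul_assoc]

/-- At frequency 2^{-n} the rescaled symbol depends only on 2^{-n} in [0,1] and on R 2^{-n}. When
the latter is bounded by T, the parameters lie in a compact rectangle. -/
lemma localized_low_aux [NeZero d] {α lam : ℝ} (hlam : 1 < lam) {ψ : Space d → ℂ}
    (hψ : Annular ψ) {η : Space d → ℝ} (hη : ContDiff ℝ ∞ η) (T : ℝ) :
    ∃ C : ℝ, 0 ≤ C ∧ ∀ (n : ℕ) (R : ℝ) (A : ℂ), 0 ≤ R → R * ((2 : ℝ) ^ n)⁻¹ ≤ T →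
      Localized ((2 ^ n)⁻¹) (‖A‖ * C) (fun ξ => A * (ψ (((2 : ℝ) ^ n) • ξ) *
        (logRieszSymbol α lam ξ * (1 - (η (R • ξ) : ℂ))))) := by
  set Θ : Set (ℝ × ℝ) := Set.Icc 0 1 ×ˢ Set.Icc 0 T
  have hΘ : IsCompact Θ := isCompact_Icc.prod isCompact_Icc
  set G : (ℝ × ℝ) × Space d → ℂ := fun q => ψ q.2 * ((Complex.I * (((q.2 0 / ‖q.2‖) *
    Real.log (lam + q.1.1 * ‖q.2‖) ^ α : ℝ) : ℂ)) * (1 - (η (q.1.2 • q.2) : ℂ))) with hG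
  have hGd : ∀ s ∈ Θ, ∀ ζ ∈ tsupport ψ, ContDiffAt ℝ ∞ G (s, ζ) := by
    intro s hs ζ hζ
    have hζ0 := hψ.ne_zero hζ
    have hn : 0 < ‖ζ‖ := norm_pos_iff.2 hζ0
    have hs0 : 0 ≤ s.1 * ‖ζ‖ := mul_nonneg hs.1.1 hn.le
    have c2 : ContDiffAt ℝ ∞ (fun q : (ℝ × ℝ) × Space d => q.2) (s, ζ) := contDiffAt_snd
    have cs : ContDiffAt ℝ ∞ (fun q : (ℝ × ℝ) × Space d => q.1.1) (s, ζ) :=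
      contDiffAt_fst.fst
    have cτ : ContDiffAt ℝ ∞ (fun q : (ℝ × ℝ) × Space d => q.1.2) (s, ζ) :=
      contDiffAt_fst.snd
    have cn : ContDiffAt ℝ ∞ (fun q : (ℝ × ℝ) × Space d => ‖q.2‖) (s, ζ) := c2.norm ℝ hζ0
    have cl := (contDiffAt_const (c := lam)).add (cs.mul cn)
    have cl2 := cl.log (by simp; linarith)
    have cr := ((contDiffAt_coord c2 0).div cn hn.ne').mul
      (cl2.rpow_const_of_ne (p := α) (Real.log_pos (by simp; linarith)).ne')
    have ce := hη.contDiffAt.comp (s, ζ) (cτ.smul c2)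
    exact (hψ.smooth.contDiffAt.comp _ c2).mul ((contDiffAt_const.mul
      (Complex.ofRealCLM.contDiff.contDiffAt.comp _ cr)).mul (contDiffAt_const.sub
        (Complex.ofRealCLM.contDiff.contDiffAt.comp _ ce)))
  have hF := bddFamily_of_compact hΘ hψ.compact hGd
    (fun s _ ζ hζ => by simp [hG, image_eq_zero_of_notMem_tsupport hζ]) (fun s : Θ => (s : ℝ × ℝ))
    (fun s => s.2)
  obtain ⟨C, hC, h⟩ := hF.localized
  refine ⟨C, hC, fun n R A hR hRT => ?_⟩
  have h1 := h ⟨(((2 : ℝ) ^ n)⁻¹, R * ((2 : ℝ) ^ n)⁻¹), ⟨⟨by positivity,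
    inv_le_one_of_one_le₀ (one_le_pow₀ one_le_two)⟩, ⟨by positivity, hRT⟩⟩⟩ ((2 ^ n)⁻¹) A
      (by positivity)
  convert h1 using 2 with ξ
  rw [inv_inv]
  by_cases hξ : ξ = 0
  · subst hξ
    simp [hG, hψ.map_zero]
  simp only [hG, logRieszSymbol]
  rw [norm_smul, PiLp.smul_apply, smul_eq_mul, Real.norm_of_nonneg (by positivity),
    mul_div_mul_left _ _ (by positivity), inv_mul_cancel_left₀ (by positivity), smul_smul,
    inv_mul_cancel_right₀ (by positivity)]

/-- On low frequencies the logarithmic Riesz symbol is localized uniformly with respect to the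
additional cut-off of the lowest frequencies. -/
lemma Annular.localized_mul_logRieszSymbol_low [NeZero d] {α lam : ℝ} (hlam : 1 < lam)
    {ψ : Space d → ℂ} (hψ : Annular ψ) {η : Space d → ℝ} (hη : ContDiff ℝ ∞ η)
    (hηc : HasCompactSupport η) :
    ∃ C : ℝ, 0 ≤ C ∧ ∀ (n : ℕ) (R : ℝ) (A : ℂ), 0 ≤ R →
      Localized ((2 ^ n)⁻¹) (‖A‖ * C) (fun ξ => A * (ψ (((2 : ℝ) ^ n) • ξ) *
        (logRieszSymbol α lam ξ * (1 - (η (R • ξ) : ℂ))))) := by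
  obtain ⟨r, hr, hr0⟩ : ∃ r > 0, ∀ ζ, ψ ζ ≠ 0 → r ≤ ‖ζ‖ := by
    obtain ⟨r, hr, h⟩ := Metric.mem_nhds_iff.1 ((isClosed_tsupport ψ).isOpen_compl.mem_nhds hψ.away)
    refine ⟨r, hr, fun ζ hζ => ?_⟩
    by_contra hlt
    exact h (by simpa using hlt : ζ ∈ Metric.ball 0 r) (subset_tsupport ψ hζ)
  obtain ⟨M, hM⟩ := hηc.isCompact.isBounded.subset_closedBall (0 : Space d)
  -- Here ψ vanishes on the ball of radius r and η outside that of radius M. If R 2^{-n} > M/r, then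
  -- η(R·) vanishes on the support of the dyadic piece, so the case η = 0 applies.
  obtain ⟨C₁, hC₁, h₁⟩ := localized_low_aux (α := α) hlam hψ hη (M / r)
  obtain ⟨C₂, hC₂, h₂⟩ := localized_low_aux (α := α) hlam hψ (η := fun _ => 0) contDiff_const 0
  refine ⟨C₁ + C₂, by positivity, fun n R A hR => ?_⟩
  have ht : (0 : ℝ) < (2 ^ n)⁻¹ := by positivity
  by_cases hRT : R * ((2 : ℝ) ^ n)⁻¹ ≤ M / r
  · exact (h₁ n R A hR hRT).mono ht (by gcongr; linarith)
  · have h3 := (h₂ n 0 A le_rfl (by simp)).mono ht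
      (C' := ‖A‖ * (C₁ + C₂)) (by gcongr; linarith)
    convert h3 using 2 with ξ
    by_cases hz : ψ ((2 : ℝ) ^ n • ξ) = 0
    · simp [hz]
    have h4 := hr0 _ hz
    have h5 : η (R • ξ) = 0 := by
      refine image_eq_zero_of_notMem_tsupport fun h => ?_
      have h6 := hM h
      rw [Metric.mem_closedBall, dist_zero_right, norm_smul, Real.norm_of_nonneg hR] at h6
      rw [norm_smul, Real.norm_of_nonneg (by positivity)] at h4
      push Not at hRT
      rw [div_lt_iff₀ hr] at hRT
      have : R * ((2 : ℝ) ^ n)⁻¹ * r ≤ R * ‖ξ‖ := by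
        rw [mul_assoc]
        gcongr
        rw [inv_mul_le_iff₀ (by positivity)]
        exact h4
      linarith
    rw [h5]

/-- Dilations of a fixed symbol. -/
lemma localized_dilation {ψ : Space d → ℂ} (hψ : ContDiff ℝ ∞ ψ) (hc : HasCompactSupport ψ) :
    ∃ C : ℝ, 0 ≤ C ∧ ∀ (t : ℝ) (A : ℂ), 0 < t →
      Localized t (‖A‖ * C) (fun ξ => A * ψ (t⁻¹ • ξ)) := by
  obtain ⟨C, hC, h⟩ := (bddFamily_const hψ hc).localized
  exact ⟨C, hC, fun t A ht => h () t A ht⟩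

/-! ### The Littlewood-Paley decomposition -/

namespace LittlewoodPaley

variable (P : LittlewoodPaley d)

/-- The partitions of unity at ξ and at ξ/2 differ by a shift of the index; subtracting them leaves
this telescoping form. -/
lemma φ_eq (ξ : Space d) : P.φ ξ = P.χ ((2 : ℝ)⁻¹ • ξ) - P.χ ξ := by
  have h1 := (hasSum_nat_add_iff' 1).2 (P.partition ξ)
  have h2 := P.partition ((2 : ℝ)⁻¹ • ξ)
  have h3 : (fun q : ℕ => P.φ ((2 : ℝ) ^ (-(q : ℤ)) • (2 : ℝ)⁻¹ • ξ)) =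
      fun q : ℕ => P.φ ((2 : ℝ) ^ (-((q + 1 : ℕ) : ℤ)) • ξ) := by
    ext q
    rw [smul_smul, ← zpow_neg_one, ← zpow_add₀ two_ne_zero]
    congr 3
    push_cast
    ring
  rw [h3] at h2
  have h4 := h1.unique h2
  simp only [Finset.range_one, Finset.sum_singleton, Nat.cast_zero, neg_zero, zpow_zero,
    one_smul] at h4
  linarith

/-- Near the origin every dilate of φ in the partition vanishes, since φ is supported away from 0.
-/
lemma exists_χ_eq_one : ∃ r > 0, ∀ ξ : Space d, ‖ξ‖ < r → P.χ ξ = 1 := by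
  obtain ⟨r, hr, h⟩ := Metric.mem_nhds_iff.1
    ((isClosed_tsupport P.φ).isOpen_compl.mem_nhds P.φ_away)
  refine ⟨r, hr, fun ξ hξ => ?_⟩
  have h0 : ∀ q : ℕ, P.φ ((2 : ℝ) ^ (-(q : ℤ)) • ξ) = 0 := fun q => by
    refine image_eq_zero_of_notMem_tsupport (h ?_)
    rw [mem_ball_zero_iff, norm_smul, zpow_neg, zpow_natCast, norm_inv, norm_pow,
      Real.norm_ofNat]
    refine (mul_le_of_le_one_left (norm_nonneg _) ?_).trans_lt hξ
    exact inv_le_one_of_one_le₀ (one_le_pow₀ one_le_two)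
  have h1 := P.partition ξ
  simp only [h0] at h1
  linarith [h1.unique hasSum_zero]

lemma χ_zero : P.χ 0 = 1 := by
  obtain ⟨r, hr, h⟩ := P.exists_χ_eq_one
  exact h 0 (by simpa)

/-- The symbol of the block of lowest frequencies. -/
def low (ξ : Space d) : ℂ := (P.χ ξ : ℂ)

/-- The symbol whose dilations generate the dyadic blocks. -/
def ring (ξ : Space d) : ℂ := (P.χ ξ : ℂ) - (P.χ ((2 : ℝ) • ξ) : ℂ)

/-- A cut-off equal to one on the support of `ring`. -/
def ring' (ξ : Space d) : ℂ := (P.χ ((2 : ℝ)⁻¹ • ξ) : ℂ) - (P.χ ((4 : ℝ) • ξ) : ℂ)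

lemma low_contDiff : ContDiff ℝ ∞ P.low := Complex.ofRealCLM.contDiff.comp P.χ_smooth

lemma low_compact : HasCompactSupport P.low :=
  P.χ_compact.comp_left (g := fun x : ℝ => (x : ℂ)) rfl

lemma hasCompactSupport_low_smul {c : ℝ} (hc : c ≠ 0) :
    HasCompactSupport (fun ξ => (P.χ (c • ξ) : ℂ)) :=
  HasCompactSupport.comp_smul P.low_compact hc

lemma contDiff_low_smul (c : ℝ) : ContDiff ℝ ∞ (fun ξ => (P.χ (c • ξ) : ℂ)) :=
  P.low_contDiff.comp (contDiff_const_smul c)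

lemma annular_sub {a b : ℝ} (ha : a ≠ 0) (hb : b ≠ 0) :
    Annular (fun ξ => (P.χ (a • ξ) : ℂ) - (P.χ (b • ξ) : ℂ)) := by
  refine ⟨(P.contDiff_low_smul a).sub (P.contDiff_low_smul b),
    (P.hasCompactSupport_low_smul ha).sub (P.hasCompactSupport_low_smul hb), ?_⟩
  rw [notMem_tsupport_iff_eventuallyEq]
  obtain ⟨r, hr, h⟩ := P.exists_χ_eq_one
  have h1 : ∀ c : ℝ, ∀ᶠ ξ : Space d in 𝓝 0, P.χ (c • ξ) = 1 := fun c => by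
    have : Tendsto (fun ξ : Space d => c • ξ) (𝓝 0) (𝓝 0) := by
      simpa using ((continuous_const_smul c).tendsto (0 : Space d))
    filter_upwards [this (Metric.ball_mem_nhds 0 hr)] with ξ hξ
    exact h _ (by simpa using hξ)
  filter_upwards [h1 a, h1 b] with ξ ha hb
  simp [ha, hb]

lemma annular_ring : Annular P.ring := by
  have h := P.annular_sub one_ne_zero two_ne_zero
  simp only [one_smul] at h
  exact h

lemma annular_ring' : Annular P.ring' := P.annular_sub (by norm_num) (by norm_num)

/-- The argument is doubled because `ring` is normalized so that the block with natural index n,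
which is Δ_{n−1}, lives at scale 2^n. -/
lemma ring_eq (ξ : Space d) : P.ring ξ = (P.φ ((2 : ℝ) • ξ) : ℂ) := by
  rw [φ_eq, smul_smul, inv_mul_cancel₀ two_ne_zero, one_smul, ring]
  push_cast
  rfl

lemma χ_half_eq_one {ξ : Space d} (h : ∀ q : ℕ, P.φ ((2 : ℝ) ^ (-((q + 1 : ℕ) : ℤ)) • ξ) = 0) :
    P.χ ((2 : ℝ)⁻¹ • ξ) = 1 := by
  have h1 := P.partition ((2 : ℝ)⁻¹ • ξ)
  have h3 : (fun q : ℕ => P.φ ((2 : ℝ) ^ (-(q : ℤ)) • (2 : ℝ)⁻¹ • ξ)) = fun _ => 0 := by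
    ext q
    rw [← h q, smul_smul, ← zpow_neg_one, ← zpow_add₀ two_ne_zero]
    congr 3
    push_cast
    ring
  rw [h3] at h1
  linarith [h1.unique hasSum_zero]

/-- Where φ(2ξ) ≠ 0, the support conditions exclude all non-neighbouring annuli: χ(4ξ) = 0, and
every φ(2^{-q-1}ξ) with q ≥ 0 vanishes, so that χ(ξ/2) = 1. -/
lemma ring'_mul_ring (ξ : Space d) : P.ring' ξ * P.ring ξ = P.ring ξ := by
  by_cases h : P.φ ((2 : ℝ) • ξ) = 0
  · simp [ring_eq, h]
  have h1 : P.χ ((4 : ℝ) • ξ) = 0 := by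
    refine image_eq_zero_of_notMem_tsupport fun h4 => ?_
    refine Set.disjoint_left.1 (P.disjoint_χ 1 le_rfl) h4 (subset_tsupport _ ?_)
    have : (2 : ℝ) ^ (-((1 : ℕ) : ℤ)) • (4 : ℝ) • ξ = (2 : ℝ) • ξ := by
      rw [smul_smul]; norm_num
    rwa [Function.mem_support, this]
  have h2 : P.χ ((2 : ℝ)⁻¹ • ξ) = 1 := P.χ_half_eq_one fun q => by
    refine image_eq_zero_of_notMem_tsupport
      (f := fun ξ => P.φ ((2 : ℝ) ^ (-((q + 1 : ℕ) : ℤ)) • ξ)) fun h4 => ?_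
    refine Set.disjoint_left.1 (P.disjoint_φ (-1) ((q + 1 : ℕ) : ℤ) ?_) (subset_tsupport _ ?_) h4
    · rw [abs_sub_comm, abs_of_nonneg] <;> push_cast <;> omega
    · rw [Function.mem_support]
      simpa using h
  rw [ring', h1, h2]
  simp

lemma low_half_mul_low (ξ : Space d) : P.low ((2 : ℝ)⁻¹ • ξ) * P.low ξ = P.low ξ := by
  by_cases h : P.χ ξ = 0
  · simp [low, h]
  have h2 : P.χ ((2 : ℝ)⁻¹ • ξ) = 1 := P.χ_half_eq_one fun q => by
    refine image_eq_zero_of_notMem_tsupport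
      (f := fun ξ => P.φ ((2 : ℝ) ^ (-((q + 1 : ℕ) : ℤ)) • ξ)) fun h4 => ?_
    exact Set.disjoint_left.1 (P.disjoint_χ (q + 1) (by omega)) (subset_tsupport _ h) h4
  simp [low, h2]

/-- The symbol of the block `Δ_{n-1}`. -/
def sym (n : ℕ) (ξ : Space d) : ℂ := if n = 0 then P.low ξ else P.ring (((2 : ℝ) ^ n)⁻¹ • ξ)

lemma sym_zero : P.sym 0 = P.low := by ext; simp [sym]

lemma sym_of_ne {n : ℕ} (hn : n ≠ 0) : P.sym n = fun ξ => P.ring (((2 : ℝ) ^ n)⁻¹ • ξ) := by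
  ext; simp [sym, hn]

lemma block_eq (n : ℕ) : block P ((n : ℤ) - 1) = multiplier (P.sym n) := by
  unfold block
  congr 1
  ext ξ
  rcases Nat.eq_zero_or_pos n with rfl | hn
  · simp [sym, low]
  · have h1 : ¬ ((n : ℤ) - 1 < 0) := by omega
    rw [if_neg h1, sym, if_neg hn.ne', ring_eq, smul_smul]
    congr 3
    rw [← zpow_natCast, ← zpow_neg, mul_comm, ← zpow_add_one₀ two_ne_zero]
    congr 1
    ring

/-- A cut-off equal to one on the support of `sym n`. -/
def sym' (n : ℕ) (ξ : Space d) : ℂ :=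
  if n = 0 then P.low ((2 : ℝ)⁻¹ • ξ) else P.ring' (((2 : ℝ) ^ n)⁻¹ • ξ)

lemma sym'_mul_sym (n : ℕ) (ξ : Space d) : P.sym' n ξ * P.sym n ξ = P.sym n ξ := by
  unfold sym' sym
  split_ifs
  · exact P.low_half_mul_low ξ
  · exact P.ring'_mul_ring _

lemma sum_sym (N : ℕ) (ξ : Space d) :
    ∑ n ∈ Finset.range (N + 1), P.sym n ξ = P.low (((2 : ℝ) ^ N)⁻¹ • ξ) := by
  induction N with
  | zero => simp [sym]
  | succ N ih =>
    rw [Finset.sum_range_succ, ih, sym, if_neg (Nat.succ_ne_zero N), ring, low, low, smul_smul]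
    have : (2 : ℝ) * (2 ^ (N + 1))⁻¹ = (2 ^ N)⁻¹ := by
      rw [pow_succ]; field_simp
    rw [this]
    ring

lemma sum_ring (N : ℕ) (ξ : Space d) :
    ∑ n ∈ Finset.range N, P.ring ((2 : ℝ) ^ n • ξ) = P.low ξ - P.low ((2 : ℝ) ^ N • ξ) := by
  induction N with
  | zero => simp
  | succ N ih =>
    rw [Finset.sum_range_succ, ih, ring, low, low, low, smul_smul, ← pow_succ']
    ring

end LittlewoodPaley

lemma temperate_of_contDiff {ψ : Space d → ℂ} (hψ : ContDiff ℝ ∞ ψ) (hc : HasCompactSupport ψ) :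
    ψ.HasTemperateGrowth :=
  hc.hasTemperateGrowth hψ

lemma LittlewoodPaley.temperate_low (P : LittlewoodPaley d) : P.low.HasTemperateGrowth :=
  temperate_of_contDiff P.low_contDiff P.low_compact

lemma LittlewoodPaley.temperate_ring (P : LittlewoodPaley d) : P.ring.HasTemperateGrowth :=
  temperate_of_contDiff P.annular_ring.smooth P.annular_ring.compact

lemma LittlewoodPaley.temperate_sym (P : LittlewoodPaley d) (n : ℕ) :
    (P.sym n).HasTemperateGrowth := by
  rcases eq_or_ne n 0 with rfl | hn
  · rw [P.sym_zero]
    exact P.temperate_low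
  · rw [P.sym_of_ne hn]
    exact temperate_dilation P.temperate_ring _

/-- The Littlewood-Paley decomposition converges to the identity. -/
lemma tendsto_sum_block (P : LittlewoodPaley d) (u : 𝓢'(Space d, ℂ)) (g : 𝓢(Space d, ℂ)) :
    Tendsto (fun N => (∑ n ∈ Finset.range N, multiplier (P.sym n) u) g) atTop (𝓝 (u g)) := by
  rw [← tendsto_add_atTop_iff_nat 1]
  have h1 : ∀ N, ∑ n ∈ Finset.range (N + 1), multiplier (P.sym n) u =
      multiplier (fun ξ => P.low (((2 : ℝ) ^ N)⁻¹ • ξ)) u := fun N => by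
    rw [← multiplier_sum _ (fun n _ => P.temperate_sym n)]
    simp only [P.sum_sym]
  simp only [h1]
  refine (tendsto_multiplier_dilation P.low_contDiff P.low_compact
    (by simp [LittlewoodPaley.low, P.χ_zero]) u g).comp
    (tendsto_nhdsWithin_iff.2 ⟨?_, Eventually.of_forall fun N => ?_⟩)
  · exact (tendsto_pow_atTop_atTop_of_one_lt one_lt_two).inv_tendsto_atTop
  · rw [Set.mem_Ioi]; positivity

/-- The logarithmic Riesz symbol without its low frequencies. -/
def highSymbol [NeZero d] (P : LittlewoodPaley d) (α lam : ℝ) (ξ : Space d) : ℂ :=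
  logRieszSymbol α lam ξ * (1 - P.low ξ)

lemma temperate_highSymbol [NeZero d] (P : LittlewoodPaley d) (α : ℝ) {lam : ℝ} (hlam : 1 < lam) :
    (highSymbol P α lam).HasTemperateGrowth := by
  obtain ⟨r, hr, hχ⟩ := P.exists_χ_eq_one
  obtain ⟨F, hF, hFe⟩ := P.annular_ring.exists_bddFamily_logRieszSymbol (α := α) hlam
  set s : ℕ → Space d → ℂ := fun N ξ => ∑ n ∈ Finset.range N,
    (((((n + 1 : ℕ) : ℝ) + 1) ^ α : ℝ) : ℂ) • F (n + 1) (((2 : ℝ) ^ (n + 1))⁻¹ • ξ) with hs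
  have hterm : ∀ n : ℕ, ContDiff ℝ ∞ (fun ξ : Space d =>
      F (n + 1) (((2 : ℝ) ^ (n + 1))⁻¹ • ξ)) := fun n =>
    (hF.smooth _).comp (contDiff_const_smul _)
  have hsd : ∀ N, ContDiff ℝ ∞ (s N) := fun N =>
    ContDiff.sum fun n _ => (hterm n).const_smul _
  -- On the unit ball around ξ the first N annular pieces already give the whole symbol once N ≥
  -- (‖ξ‖ + 1)/r, because χ(2^{-N}·) = 1 there. N is linear in ‖ξ‖, which suffices for polynomial
  -- growth.
  have hloc : ∀ (N : ℕ) (ξ : Space d), (‖ξ‖ + 1) / r ≤ N → highSymbol P α lam =ᶠ[𝓝 ξ] s N := by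
    intro N ξ hN
    filter_upwards [Metric.ball_mem_nhds ξ one_pos] with y hy
    have hy1 : ‖y‖ < ‖ξ‖ + 1 := by
      have := norm_le_norm_add_norm_sub' y ξ
      rw [mem_ball_iff_norm] at hy
      linarith
    have h1 : P.low (((2 : ℝ) ^ N)⁻¹ • y) = 1 := by
      have : P.χ (((2 : ℝ) ^ N)⁻¹ • y) = 1 := by
        refine hχ _ ?_
        rw [norm_smul, Real.norm_of_nonneg (by positivity), inv_mul_lt_iff₀ (by positivity)]
        rw [div_le_iff₀ hr] at hN
        have h2 : (N : ℝ) ≤ 2 ^ N := mod_cast (Nat.lt_two_pow_self).le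
        calc ‖y‖ < N * r := by linarith
          _ ≤ _ := by gcongr
      simp [LittlewoodPaley.low, this]
    have h2 := P.sum_sym N y
    rw [Finset.sum_range_succ', h1, LittlewoodPaley.sym, if_pos rfl] at h2
    rw [highSymbol, ← h2, add_sub_cancel_right, Finset.mul_sum]
    refine Finset.sum_congr rfl fun n _ => ?_
    rw [LittlewoodPaley.sym, if_neg (Nat.succ_ne_zero n), mul_comm, hFe, smul_eq_mul]
  refine ⟨contDiff_iff_contDiffAt.2 fun ξ => ?_, fun n => ?_⟩
  · obtain ⟨N, hN⟩ := exists_nat_ge ((‖ξ‖ + 1) / r)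
    exact (hsd N).contDiffAt.congr_of_eventuallyEq (hloc N ξ hN)
  obtain ⟨M, hM⟩ := hF.bound n
  -- Each of the N pieces has size at most (N+1)^κ times a fixed bound, so the derivatives grow at
  -- most like (1 + ‖ξ‖)^{κ+1}.
  obtain ⟨κ, hκ⟩ := exists_nat_ge |α|
  refine ⟨κ + 1, (1 / r + 2) ^ (κ + 1) * |M|, fun ξ => ?_⟩
  set N : ℕ := ⌈(‖ξ‖ + 1) / r⌉₊ with hNdef
  have hN1 : (N : ℝ) + 1 ≤ (1 / r + 2) * (1 + ‖ξ‖) := by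
    have := (Nat.ceil_lt_add_one (by positivity : 0 ≤ (‖ξ‖ + 1) / r)).le
    rw [← hNdef] at this
    have h3 : (1 / r + 2) * (1 + ‖ξ‖) = (‖ξ‖ + 1) / r + 2 + 2 * ‖ξ‖ := by ring
    rw [h3]
    linarith [norm_nonneg ξ]
  rw [((hloc N ξ (Nat.le_ceil _)).iteratedFDeriv ℝ n).eq_of_nhds, hs]
  have hnn : ((n : ℕ∞) : ℕ∞ω) ≤ ((⊤ : ℕ∞) : ℕ∞ω) := mod_cast le_top
  rw [iteratedFDeriv_fun_sum_apply fun m _ =>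
    (((hterm m).const_smul _).of_le hnn).contDiffAt]
  calc _ ≤ ∑ m ∈ Finset.range N, ‖iteratedFDeriv ℝ n (fun ξ : Space d =>
        (((((m + 1 : ℕ) : ℝ) + 1) ^ α : ℝ) : ℂ) • F (m + 1) (((2 : ℝ) ^ (m + 1))⁻¹ • ξ)) ξ‖ := by
        exact norm_sum_le _ _
    _ ≤ ∑ m ∈ Finset.range N, ((N : ℝ) + 1) ^ κ * |M| := by
        refine Finset.sum_le_sum fun m hm => ?_
        rw [Finset.mem_range] at hm
        rw [iteratedFDeriv_const_smul_apply' ((hterm m).of_le hnn).contDiffAt, norm_smul,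
          iteratedFDeriv_comp_const_smul _ ((hF.smooth _).of_le hnn), norm_smul,
          Complex.norm_real, Real.norm_of_nonneg (by positivity)]
        gcongr
        · have hm1 : (1 : ℝ) ≤ ((m + 1 : ℕ) : ℝ) + 1 := by push_cast; linarith [m.cast_nonneg (α := ℝ)]
          calc _ ≤ (((m + 1 : ℕ) : ℝ) + 1) ^ (κ : ℝ) :=
                Real.rpow_le_rpow_of_exponent_le hm1 ((le_abs_self α).trans hκ)
            _ = (((m + 1 : ℕ) : ℝ) + 1) ^ κ := Real.rpow_natCast _ _
            _ ≤ _ := by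
              gcongr
              exact_mod_cast hm
        · refine (mul_le_of_le_one_left (norm_nonneg _) ?_).trans ((hM _ _).trans (le_abs_self M))
          rw [norm_pow, norm_inv, norm_pow, Real.norm_ofNat]
          exact pow_le_one₀ (by positivity) (inv_le_one_of_one_le₀ (one_le_pow₀ one_le_two))
    _ = N * (((N : ℝ) + 1) ^ κ * |M|) := by simp
    _ ≤ ((N : ℝ) + 1) * (((N : ℝ) + 1) ^ κ * |M|) := by gcongr; linarith
    _ = ((N : ℝ) + 1) ^ (κ + 1) * |M| := by ring
    _ ≤ ((1 / r + 2) * (1 + ‖ξ‖)) ^ (κ + 1) * |M| := by gcongr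
    _ = _ := by rw [mul_pow]; ring

/-! ### Symbols localized together with their products by coordinates -/

/-- `a` and its products with up to two coordinates are localized at the frequency `t`. -/
structure SymbolBound (t C : ℝ) (a : Space d → ℂ) : Prop where
  base : Localized t C a
  coord : ∀ i, Localized t (C * t) (fun ξ => Complex.I * (ξ i : ℂ) * a ξ)
  coord_coord : ∀ i l, Localized t (C * t ^ 2)
    (fun ξ => Complex.I * (ξ l : ℂ) * (Complex.I * (ξ i : ℂ) * a ξ))

lemma SymbolBound.mono {t C C' : ℝ} {a : Space d → ℂ} (h : SymbolBound t C a) (ht : 0 < t)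
    (hC : C ≤ C') : SymbolBound t C' a :=
  ⟨h.base.mono ht hC, fun i => (h.coord i).mono ht (by gcongr),
    fun i l => (h.coord_coord i l).mono ht (by gcongr)⟩

/-- With ξ = tζ, multiplying by iξ_i amounts to replacing ψ by ζ_i ψ and gaining a factor t. A class
of cut-offs stable under multiplication by coordinates therefore needs only the estimate without
coordinates. Finiteness of the index set allows summing the constants. -/
lemma exists_symbolBound {ι : Type*} {t w : ι → ℝ} (ht : ∀ k, 0 < t k) (hw : ∀ k, 0 ≤ w k)
    {h : ι → Space d → ℂ} (good : (Space d → ℂ) → Prop)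
    (hgood : ∀ ψ i, good ψ → good (fun ζ => ψ ζ * (ζ i : ℂ)))
    (H : ∀ ψ, good ψ → ∃ C : ℝ, 0 ≤ C ∧ ∀ (k : ι) (A : ℂ),
      Localized (t k) (‖A‖ * (C * w k)) (fun ξ => A * (ψ ((t k)⁻¹ • ξ) * h k ξ)))
    {ψ : Space d → ℂ} (hψ : good ψ) :
    ∃ C : ℝ, 0 ≤ C ∧ ∀ k, SymbolBound (t k) (C * w k) (fun ξ => ψ ((t k)⁻¹ • ξ) * h k ξ) := by
  obtain ⟨C₀, hC₀, h₀⟩ := H ψ hψ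
  choose C₁ hC₁ h₁ using fun i => H _ (hgood ψ i hψ)
  choose C₂ hC₂ h₂ using fun i l => H _ (hgood _ l (hgood ψ i hψ))
  have hs₁ : 0 ≤ ∑ i, C₁ i := Finset.sum_nonneg fun i _ => hC₁ i
  have hs₂ : 0 ≤ ∑ i, ∑ l, C₂ i l :=
    Finset.sum_nonneg fun i _ => Finset.sum_nonneg fun l _ => hC₂ i l
  refine ⟨C₀ + ∑ i, C₁ i + ∑ i, ∑ l, C₂ i l, by positivity, fun k => ⟨?_, fun i => ?_,
    fun i l => ?_⟩⟩
  · have h3 := h₀ k 1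
    simp only [norm_one, one_mul] at h3
    exact h3.mono (ht k) (mul_le_mul_of_nonneg_right (by linarith) (hw k))
  · have h3 := (h₁ i k (Complex.I * (t k : ℂ))).mono (ht k)
      (C' := (C₀ + ∑ i, C₁ i + ∑ i, ∑ l, C₂ i l) * w k * t k) (by
        have h4 : C₁ i ≤ ∑ i, C₁ i := Finset.single_le_sum (fun i _ => hC₁ i) (Finset.mem_univ i)
        rw [norm_mul, Complex.norm_I, one_mul, Complex.norm_real, Real.norm_of_nonneg (ht k).le,
          mul_comm (t k)]
        exact mul_le_mul_of_nonneg_right (mul_le_mul_of_nonneg_right (by linarith) (hw k))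
          (ht k).le)
    convert h3 using 2 with ξ
    have := (ht k).ne'
    have h5 : ((t k : ℝ) : ℂ) ≠ 0 := by exact_mod_cast this
    rw [PiLp.smul_apply, smul_eq_mul]
    push_cast
    field_simp
  · have h3 := (h₂ i l k (Complex.I * (t k : ℂ) * (Complex.I * (t k : ℂ)))).mono (ht k)
      (C' := (C₀ + ∑ i, C₁ i + ∑ i, ∑ l, C₂ i l) * w k * t k ^ 2) (by
        have h4 : C₂ i l ≤ ∑ i, ∑ l, C₂ i l :=
          (Finset.single_le_sum (fun l _ => hC₂ i l) (Finset.mem_univ l)).trans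
            (Finset.single_le_sum (f := fun i => ∑ l, C₂ i l)
              (fun i _ => Finset.sum_nonneg fun l _ => hC₂ i l) (Finset.mem_univ i))
        rw [norm_mul, norm_mul, Complex.norm_I, one_mul, Complex.norm_real,
          Real.norm_of_nonneg (ht k).le, ← sq, mul_comm (t k ^ 2)]
        exact mul_le_mul_of_nonneg_right (mul_le_mul_of_nonneg_right (by linarith) (hw k))
          (by positivity))
    convert h3 using 2 with ξ
    have := (ht k).ne'
    have h5 : ((t k : ℝ) : ℂ) ≠ 0 := by exact_mod_cast this
    rw [PiLp.smul_apply, smul_eq_mul, PiLp.smul_apply, smul_eq_mul]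
    push_cast
    field_simp

lemma contDiff_coord_complex (i : Fin d) : ContDiff ℝ ∞ (fun ζ : Space d => ((ζ i : ℝ) : ℂ)) :=
  (temperate_coord i).1

lemma Annular.mul_coord {ψ : Space d → ℂ} (hψ : Annular ψ) (i : Fin d) :
    Annular (fun ζ => ψ ζ * (ζ i : ℂ)) :=
  hψ.mul fun _ _ => (contDiff_coord_complex i).contDiffAt

lemma exists_symbolBound_dilation {ψ : Space d → ℂ} (hψ : ContDiff ℝ ∞ ψ)
    (hc : HasCompactSupport ψ) : ∃ C : ℝ, 0 ≤ C ∧ ∀ t : ℝ, 0 < t →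
      SymbolBound t C (fun ξ => ψ (t⁻¹ • ξ)) := by
  obtain ⟨C, hC, h⟩ := exists_symbolBound (ι := Set.Ioi (0 : ℝ)) (t := fun k => k) (w := fun _ => 1)
    (h := fun _ _ => 1) (fun k => k.2) (fun _ => zero_le_one)
    (fun ψ : Space d → ℂ => ContDiff ℝ ∞ ψ ∧ HasCompactSupport ψ)
    (fun ψ i h => ⟨h.1.mul (contDiff_coord_complex i), h.2.mul_right⟩)
    (fun ψ h => by
      obtain ⟨C, hC, h⟩ := localized_dilation h.1 h.2
      exact ⟨C, hC, fun k A => by simpa using h k A k.2⟩) ⟨hψ, hc⟩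
  exact ⟨C, hC, fun t ht => by simpa using h ⟨t, ht⟩⟩

/-! ### Symbol bounds for the dyadic blocks and for the pieces of the logarithmic Riesz symbol -/

namespace LittlewoodPaley

variable (P : LittlewoodPaley d)

lemma exists_symbolBound_sym :
    ∃ C : ℝ, 0 ≤ C ∧ ∀ n, SymbolBound (2 ^ n) C (P.sym n) := by
  obtain ⟨C₁, hC₁, h₁⟩ := exists_symbolBound_dilation P.low_contDiff P.low_compact
  obtain ⟨C₂, hC₂, h₂⟩ := exists_symbolBound_dilation P.annular_ring.smooth P.annular_ring.compact
  refine ⟨C₁ + C₂, by positivity, fun n => ?_⟩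
  rcases eq_or_ne n 0 with rfl | hn
  · rw [P.sym_zero, pow_zero]
    have := (h₁ 1 one_pos).mono one_pos (by linarith : C₁ ≤ C₁ + C₂)
    simpa using this
  · rw [P.sym_of_ne hn]
    exact (h₂ (2 ^ n) (by positivity)).mono (by positivity) (by linarith)

lemma exists_symbolBound_sym' :
    ∃ C : ℝ, 0 ≤ C ∧ ∀ n, SymbolBound (2 ^ n) C (P.sym' n) := by
  have hc : HasCompactSupport (fun ξ => P.low ((2 : ℝ)⁻¹ • ξ)) :=
    P.hasCompactSupport_low_smul (by norm_num)
  obtain ⟨C₁, hC₁, h₁⟩ := exists_symbolBound_dilation (P.contDiff_low_smul 2⁻¹) hc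
  obtain ⟨C₂, hC₂, h₂⟩ :=
    exists_symbolBound_dilation P.annular_ring'.smooth P.annular_ring'.compact
  refine ⟨C₁ + C₂, by positivity, fun n => ?_⟩
  rcases eq_or_ne n 0 with rfl | hn
  · have h3 : P.sym' 0 = fun ξ => (P.χ ((2 : ℝ)⁻¹ • ξ) : ℂ) := by ext; simp [sym', low]
    rw [h3, pow_zero]
    have := (h₁ 1 one_pos).mono one_pos (by linarith : C₁ ≤ C₁ + C₂)
    simpa using this
  · have h3 : P.sym' n = fun ξ => P.ring' (((2 : ℝ) ^ n)⁻¹ • ξ) := by ext; simp [sym', hn]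
    rw [h3]
    exact (h₂ (2 ^ n) (by positivity)).mono (by positivity) (by linarith)

lemma exists_symbolBound_sym_mul_logRieszSymbol [NeZero d] (α : ℝ) {lam : ℝ} (hlam : 1 < lam) :
    ∃ C : ℝ, 0 ≤ C ∧ ∀ n : ℕ, n ≠ 0 → SymbolBound (2 ^ n) (C * ((n : ℝ) + 1) ^ α)
      (fun ξ => P.sym n ξ * logRieszSymbol α lam ξ) := by
  obtain ⟨C, hC, h⟩ := exists_symbolBound (ι := ℕ) (t := fun n => 2 ^ n)
    (w := fun n => ((n : ℝ) + 1) ^ α) (h := fun _ => logRieszSymbol α lam)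
    (fun k => by positivity) (fun k => by positivity) (Annular (d := d))
    (fun ψ i h => h.mul_coord i)
    (fun ψ h => by
      obtain ⟨C, hC, h⟩ := h.localized_mul_logRieszSymbol (α := α) hlam
      exact ⟨C, hC, fun k A => by simpa [mul_assoc] using h k A⟩) P.annular_ring
  refine ⟨C, hC, fun n hn => ?_⟩
  rw [P.sym_of_ne hn]
  exact h n

lemma exists_localized_sym'_mul_logRieszSymbol [NeZero d] (α : ℝ) {lam : ℝ} (hlam : 1 < lam) :
    ∃ C : ℝ, 0 ≤ C ∧ ∀ n : ℕ, n ≠ 0 → Localized (2 ^ n) (C * ((n : ℝ) + 1) ^ α)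
      (fun ξ => P.sym' n ξ * logRieszSymbol α lam ξ) := by
  obtain ⟨C, hC, h⟩ := P.annular_ring'.localized_mul_logRieszSymbol (α := α) hlam
  refine ⟨C, hC, fun n hn => ?_⟩
  simpa [sym', hn] using h n 1

/-- The low frequency parts of the logarithmic Riesz symbol, with the lowest frequencies removed. -/
lemma exists_symbolBound_low [NeZero d] (α : ℝ) {lam : ℝ} (hlam : 1 < lam) {η : Space d → ℝ}
    (hη : ContDiff ℝ ∞ η) (hηc : HasCompactSupport η) :
    ∃ C : ℝ, 0 ≤ C ∧ ∀ (n : ℕ) (R : ℝ), 0 ≤ R → SymbolBound ((2 ^ n)⁻¹) C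
      (fun ξ => P.ring ((2 : ℝ) ^ n • ξ) * (logRieszSymbol α lam ξ * (1 - (η (R • ξ) : ℂ)))) := by
  obtain ⟨C, hC, h⟩ := exists_symbolBound (ι := ℕ × Set.Ici (0 : ℝ)) (t := fun n => (2 ^ n.1)⁻¹)
    (w := fun _ => 1)
    (h := fun n ξ => logRieszSymbol α lam ξ * (1 - (η ((n.2 : ℝ) • ξ) : ℂ)))
    (fun k => by positivity) (fun k => by positivity) (Annular (d := d))
    (fun ψ i h => h.mul_coord i)
    (fun ψ h => by
      obtain ⟨C, hC, h⟩ := h.localized_mul_logRieszSymbol_low (α := α) hlam hη hηc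
      exact ⟨C, hC, fun k A => by simpa using h k.1 k.2 A k.2.2⟩) P.annular_ring
  exact ⟨C, hC, fun n R hR => by simpa using h ⟨n, ⟨R, hR⟩⟩⟩

end LittlewoodPaley

/-! ### Inverting the divergence on an annulus -/

/-- The symbol of the `l`-th potential of the multiplier with symbol `ψ (ξ / t)`. -/
def potential (ψ : Space d → ℂ) (t : ℝ) (l : Fin d) (ξ : Space d) : ℂ :=
  ψ (t⁻¹ • ξ) * (-Complex.I * (((ξ l / ‖ξ‖ ^ 2 : ℝ)) : ℂ))

/-- The function ξ_l/‖ξ‖² is homogeneous of degree −1 and smooth on the annulus, so the potential is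
a dilate of a fixed annular symbol times t⁻¹. -/
lemma Annular.exists_symbolBound_potential {ψ : Space d → ℂ} (hψ : Annular ψ) :
    ∃ C : ℝ, 0 ≤ C ∧ ∀ (t : ℝ) (l : Fin d), 0 < t →
      SymbolBound t (C * t⁻¹) (potential ψ t l) := by
  have hh : ∀ l : Fin d, ∀ ζ : Space d, ζ ≠ 0 → ContDiffAt ℝ ∞
      (fun ζ : Space d => -Complex.I * (((ζ l / ‖ζ‖ ^ 2 : ℝ)) : ℂ)) ζ := fun l ζ hζ => by
    have h1 : ContDiffAt ℝ ∞ (fun ζ : Space d => ‖ζ‖ ^ 2) ζ := (contDiff_norm_sq ℝ).contDiffAt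
    have h2 := (contDiffAt_coord (contDiffAt_id (x := ζ)) l).div h1
      (pow_ne_zero 2 (norm_ne_zero_iff.2 hζ))
    exact contDiffAt_const.mul (Complex.ofRealCLM.contDiff.contDiffAt.comp _ h2)
  have key : ∀ l : Fin d, ∃ C : ℝ, 0 ≤ C ∧ ∀ k : Set.Ioi (0 : ℝ),
      SymbolBound (k : ℝ) (C * (k : ℝ)⁻¹) (potential ψ k l) := fun l => by
    refine exists_symbolBound (ι := Set.Ioi (0 : ℝ)) (t := fun k => k) (w := fun k => (k : ℝ)⁻¹)
      (h := fun _ ξ => -Complex.I * (((ξ l / ‖ξ‖ ^ 2 : ℝ)) : ℂ)) (fun k => k.2)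
      (fun k => inv_nonneg.2 (le_of_lt k.2)) (Annular (d := d)) (fun ψ i h => h.mul_coord i)
      (fun ψ hψ => ?_) hψ
    obtain ⟨C, hC, h⟩ := localized_dilation (hψ.mul (hh l)).smooth (hψ.mul (hh l)).compact
    refine ⟨C, hC, fun k A => ?_⟩
    have hk : (0 : ℝ) < k := k.2
    have h1 := h k (A * ((k : ℝ)⁻¹ : ℝ)) hk
    rw [norm_mul, Complex.norm_real, Real.norm_of_nonneg (by positivity), mul_assoc,
      mul_comm _ C] at h1
    convert h1 using 2 with ξ
    rw [norm_smul, PiLp.smul_apply, smul_eq_mul, Real.norm_of_nonneg (by positivity)]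
    by_cases hξ : ξ = 0
    · simp [hξ]
    have h5 : ((‖ξ‖ : ℝ) : ℂ) ≠ 0 := by exact_mod_cast norm_ne_zero_iff.2 hξ
    have h6 : (((k : ℝ)) : ℂ) ≠ 0 := by exact_mod_cast hk.ne'
    push_cast
    field_simp
  choose C hC h using key
  refine ⟨∑ l, C l, Finset.sum_nonneg fun l _ => hC l, fun t l ht => ?_⟩
  refine (h l ⟨t, ht⟩).mono ht ?_
  have h4 : C l ≤ ∑ l, C l := Finset.single_le_sum (fun i _ => hC i) (Finset.mem_univ l)
  exact mul_le_mul_of_nonneg_right h4 (by positivity)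

/-- Reduces to ∑ ξ_l² = ‖ξ‖²; the condition ψ(0) = 0 settles the origin, where the potentials take a
default value. -/
lemma sum_potential {ψ : Space d → ℂ} (hψ : ψ 0 = 0) (t : ℝ) (ξ : Space d) :
    ∑ l, Complex.I * (ξ l : ℂ) * potential ψ t l ξ = ψ (t⁻¹ • ξ) := by
  by_cases hξ : ξ = 0
  · simp [hξ, hψ]
  have h1 : ∑ l, Complex.I * (ξ l : ℂ) * potential ψ t l ξ =
      (∑ l, ((ξ l ^ 2 / ‖ξ‖ ^ 2 : ℝ) : ℂ)) * ψ (t⁻¹ • ξ) := by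
    rw [Finset.sum_mul]
    refine Finset.sum_congr rfl fun l _ => ?_
    rw [potential]
    push_cast
    linear_combination (-(ξ l : ℂ) ^ 2 / (‖ξ‖ : ℂ) ^ 2 * ψ (t⁻¹ • ξ)) * Complex.I_sq
  rw [h1, ← Complex.ofReal_sum, ← Finset.sum_div, ← EuclideanSpace.real_norm_sq_eq, div_self
    (pow_ne_zero 2 (norm_ne_zero_iff.2 hξ)), Complex.ofReal_one, one_mul]

/-! ### Convergence of the low frequency parts -/

lemma enorm_apply_le_lpNorm {p : ℝ≥0∞} (hp : 1 ≤ p) (T : 𝓢'(Space d, ℂ)) (hT : lpNorm p T ≠ ⊤)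
    (g : 𝓢(Space d, ℂ)) :
    ‖T g‖ₑ ≤ eLpNorm g p.conjExponent volume * lpNorm p T := by
  obtain ⟨f, hf, hr, hn⟩ := exists_represents_of_lpNorm_ne_top hp hT
  have : p.HolderConjugate p.conjExponent := .conjExponent hp
  rw [hr.2, ← hn]
  refine (enorm_integral_le_lintegral_enorm _).trans ?_
  have h1 := eLpNorm_smul_le_mul_eLpNorm (p := p.conjExponent) (q := p) (r := 1) hf.1
    (g.memLp p.conjExponent volume).1
  rwa [eLpNorm_one_eq_lintegral_enorm] at h1

/-- Dominated convergence for series of tempered distributions. -/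
lemma tendsto_of_hasSum_of_lpNorm_le {p : ℝ≥0∞} (hp : 1 ≤ p) {T : ℕ → ℝ → 𝓢'(Space d, ℂ)}
    {T' : ℕ → 𝓢'(Space d, ℂ)} {S : ℝ → 𝓢'(Space d, ℂ)} {F : 𝓢'(Space d, ℂ)} {b : ℕ → ℝ≥0∞}
    (hb : ∑' n, b n ≠ ⊤) (h1 : ∀ n, ∀ᶠ R in atTop, T n R = T' n)
    (h2 : ∀ n R, 0 < R → lpNorm p (T n R) ≤ b n)
    (h3 : ∀ R, 0 < R → ∀ g, HasSum (fun n => T n R g) (S R g))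
    (h4 : ∀ g, HasSum (fun n => T' n g) (F g)) : Tendsto S atTop (𝓝 F) := by
  rw [PointwiseConvergenceCLM.tendsto_iff_forall_tendsto]
  intro g
  rw [← (h4 g).tsum_eq]
  have hbn : ∀ n, b n ≠ ⊤ := ENNReal.ne_top_of_tsum_ne_top hb
  set G := eLpNorm g p.conjExponent volume
  have hG : G ≠ ⊤ := (g.memLp p.conjExponent volume).2.ne
  have h5 : Tendsto (fun R => ∑' n, T n R g) atTop (𝓝 (∑' n, T' n g)) := by
    refine tendsto_tsum_of_dominated_convergence (bound := fun n => (G * b n).toReal) ?_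
      (fun n => ?_) ?_
    · refine ENNReal.summable_toReal ?_
      rw [ENNReal.tsum_mul_left]
      exact ENNReal.mul_ne_top hG hb
    · refine tendsto_const_nhds.congr' ?_
      filter_upwards [h1 n] with R hR
      rw [hR]
    · filter_upwards [eventually_gt_atTop 0] with R hR n
      have hT := h2 n R hR
      have := (enorm_apply_le_lpNorm hp (T n R) (hT.trans_lt (hbn n).lt_top).ne g).trans
        (mul_le_mul_right hT G)
      rw [← toReal_enorm]
      exact ENNReal.toReal_mono (ENNReal.mul_ne_top hG (hbn n)) this
  refine h5.congr' ?_
  filter_upwards [eventually_gt_atTop 0] with R hR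
  exact (h3 R hR g).tsum_eq

/-- For large R the support of η(R·) shrinks into the ball on which f vanishes. -/
lemma eventually_mul_cutoff_eq_zero {f : Space d → ℂ} {r : ℝ} (hr : 0 < r)
    (hf : ∀ ξ, ‖ξ‖ < r → f ξ = 0) {η : Space d → ℝ} (hη : HasCompactSupport η) :
    ∀ᶠ R : ℝ in atTop, ∀ ξ, f ξ * (η (R • ξ) : ℂ) = 0 := by
  obtain ⟨M, hM⟩ := hη.isCompact.isBounded.subset_closedBall (0 : Space d)
  filter_upwards [eventually_gt_atTop 0, eventually_gt_atTop (M / r)] with R hR hRM ξ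
  rcases lt_or_ge ‖ξ‖ r with h | h
  · rw [hf ξ h, zero_mul]
  have h5 : η (R • ξ) = 0 := by
    refine image_eq_zero_of_notMem_tsupport fun h' => ?_
    have h6 := hM h'
    rw [Metric.mem_closedBall, dist_zero_right, norm_smul, Real.norm_of_nonneg hR.le] at h6
    rw [div_lt_iff₀ hr] at hRM
    have : R * r ≤ R * ‖ξ‖ := by gcongr
    linarith
  simp [h5]

namespace LittlewoodPaley

variable (P : LittlewoodPaley d)

lemma exists_ring_eq_zero : ∃ r > 0, ∀ ξ, ‖ξ‖ < r → P.ring ξ = 0 := by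
  obtain ⟨r, hr, h⟩ := P.exists_χ_eq_one
  refine ⟨r / 2, by positivity, fun ξ hξ => ?_⟩
  rw [ring, h ξ (by linarith), h, sub_self]
  rw [norm_smul, Real.norm_ofNat]
  linarith

lemma exists_ring_smul_eq_zero {c : ℝ} (hc : 0 < c) :
    ∃ r > 0, ∀ ξ, ‖ξ‖ < r → P.ring (c • ξ) = 0 := by
  obtain ⟨r, hr, h⟩ := P.exists_ring_eq_zero
  refine ⟨r / c, by positivity, fun ξ hξ => h _ ?_⟩
  rw [norm_smul, Real.norm_of_nonneg hc.le]
  rwa [lt_div_iff₀ hc, mul_comm] at hξ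

variable [NeZero d] {α lam : ℝ}

/-- The logarithmic Riesz symbol cut off near the origin at scale `R⁻¹`. -/
def _root_.LogRiesz.cutSymbol (α lam : ℝ) (η : Space d → ℝ) (R : ℝ) (ξ : Space d) : ℂ :=
  logRieszSymbol α lam ξ * (1 - (η (R • ξ) : ℂ))

/-- For fixed R the factor 1 − η(R·) kills a neighbourhood of the origin, so only finitely many low
annuli contribute and the telescoping sum is exact. -/
lemma exists_sum_low (α lam : ℝ) {η : Space d → ℝ} (hη1 : ∀ᶠ ξ in 𝓝 0, η ξ = 1) {R : ℝ}
    (hR : 0 < R) : ∃ N₀ : ℕ,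
      (∀ n, N₀ ≤ n → ∀ ξ, P.ring ((2 : ℝ) ^ n • ξ) * cutSymbol α lam η R ξ = 0) ∧
      ∀ ξ, P.low ξ * cutSymbol α lam η R ξ =
        ∑ n ∈ Finset.range N₀, P.ring ((2 : ℝ) ^ n • ξ) * cutSymbol α lam η R ξ := by
  obtain ⟨r, hr, h⟩ := Metric.mem_nhds_iff.1 hη1
  obtain ⟨M, hM⟩ := P.χ_compact.isCompact.isBounded.subset_closedBall (0 : Space d)
  obtain ⟨N₀, hN₀⟩ := pow_unbounded_of_one_lt (M * R / r) one_lt_two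
  have key : ∀ n, N₀ ≤ n → ∀ ξ, P.low ((2 : ℝ) ^ n • ξ) * cutSymbol α lam η R ξ = 0 := by
    intro n hn ξ
    by_cases h0 : P.χ ((2 : ℝ) ^ n • ξ) = 0
    · simp [low, h0]
    have h1 := hM (subset_tsupport _ h0)
    rw [Metric.mem_closedBall, dist_zero_right, norm_smul, Real.norm_of_nonneg (by positivity)]
      at h1
    have h2 : η (R • ξ) = 1 := by
      refine h ?_
      rw [mem_ball_zero_iff, norm_smul, Real.norm_of_nonneg hR.le]
      have h3 : M * R / r < 2 ^ n := hN₀.trans_le (pow_le_pow_right₀ one_le_two hn)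
      rw [div_lt_iff₀ hr] at h3
      have h4 : 2 ^ n * ‖ξ‖ * R ≤ M * R := by gcongr
      have h5 : (2 : ℝ) ^ n * (R * ‖ξ‖) < 2 ^ n * r := by linarith
      exact lt_of_mul_lt_mul_left h5 (by positivity)
    simp [cutSymbol, h2]
  refine ⟨N₀, fun n hn ξ => ?_, fun ξ => ?_⟩
  · have h1 := key n hn ξ
    have h2 := key (n + 1) (by omega) ξ
    rw [pow_succ', mul_smul] at h2
    rw [ring, sub_mul]
    unfold low at h1 h2
    rw [h1, h2, sub_zero]
  · rw [← Finset.sum_mul, P.sum_ring, sub_mul, key N₀ le_rfl, sub_zero]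

lemma temperate_ring_mul_cutSymbol (α : ℝ) (hlam : 1 < lam) {η : Space d → ℝ}
    (hη : ContDiff ℝ ∞ η) (hηc : HasCompactSupport η) (n : ℕ) {R : ℝ} (hR : 0 ≤ R) :
    (fun ξ => P.ring ((2 : ℝ) ^ n • ξ) * cutSymbol α lam η R ξ).HasTemperateGrowth := by
  obtain ⟨C, hC, h⟩ := P.exists_symbolBound_low α hlam hη hηc
  exact (h n R hR).base.temperate

lemma temperate_low_mul_cutSymbol (α : ℝ) (hlam : 1 < lam) {η : Space d → ℝ}
    (hη : ContDiff ℝ ∞ η) (hηc : HasCompactSupport η) (hη1 : ∀ᶠ ξ in 𝓝 0, η ξ = 1) {R : ℝ}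
    (hR : 0 < R) : (fun ξ => P.low ξ * cutSymbol α lam η R ξ).HasTemperateGrowth := by
  obtain ⟨N₀, -, h⟩ := P.exists_sum_low α lam hη1 hR
  simp only [h]
  exact Function.HasTemperateGrowth.sum fun n _ =>
    P.temperate_ring_mul_cutSymbol α hlam hη hηc n hR.le

/-- The low frequency limit exists for every additive function of the symbol which satisfies
summable bounds on the dyadic pieces. -/
lemma exists_low_limit (α : ℝ) (hlam : 1 < lam) : ∃ C₀ : ℝ, 0 ≤ C₀ ∧
    ∀ (p : ℝ≥0∞), 1 ≤ p → ∀ Φ : (Space d → ℂ) → 𝓢'(Space d, ℂ),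
    (∀ (s : Finset ℕ) (a : ℕ → Space d → ℂ), (∀ i ∈ s, (a i).HasTemperateGrowth) →
      Φ (fun ξ => ∑ i ∈ s, a i ξ) = ∑ i ∈ s, Φ (a i)) →
    ∀ b : ℕ → ℝ≥0∞, ∑' n, b n ≠ ⊤ →
    (∀ (n : ℕ) (C : ℝ) (a : Space d → ℂ), 0 ≤ C → SymbolBound ((2 ^ n)⁻¹) C a →
      lpNorm p (Φ a) ≤ ENNReal.ofReal C * b n) →
    ∃ F : 𝓢'(Space d, ℂ), lpNorm p F ≤ ENNReal.ofReal C₀ * ∑' n, b n ∧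
      ∀ η : Space d → ℝ, ContDiff ℝ ∞ η → HasCompactSupport η → (∀ᶠ ξ in 𝓝 0, η ξ = 1) →
        Tendsto (fun R : ℝ => Φ (fun ξ => P.low ξ * cutSymbol α lam η R ξ)) atTop (𝓝 F) := by
  -- The choice η = 0 gives the pieces without cut-off; their sum defines the limit F, which
  -- therefore does not depend on η.
  obtain ⟨C₀, hC₀, h₀⟩ := P.exists_symbolBound_low α hlam (η := fun _ => 0) contDiff_const
    HasCompactSupport.zero
  have h₀' : ∀ n, SymbolBound ((2 ^ n)⁻¹) C₀
      (fun ξ => P.ring ((2 : ℝ) ^ n • ξ) * logRieszSymbol α lam ξ) := fun n => by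
    simpa using h₀ n 0 le_rfl
  refine ⟨C₀, hC₀, fun p hp Φ hΦ b hb hbd => ?_⟩
  have hle : ∀ C : ℝ, ∑' n, ENNReal.ofReal C * b n ≠ ⊤ := fun C => by
    rw [ENNReal.tsum_mul_left]
    exact ENNReal.mul_ne_top ENNReal.ofReal_ne_top hb
  have h1 := ENNReal.tsum_le_tsum fun n => hbd n C₀ _ hC₀ (h₀' n)
  obtain ⟨F, hF, hF'⟩ := exists_hasSum_of_lpNorm hp _ (h1.trans_lt (hle C₀).lt_top).ne
  refine ⟨F, (hF.trans h1).trans ENNReal.tsum_mul_left.le, fun η hη hηc hη1 => ?_⟩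
  -- This constant depends on η but serves only as a dominating bound; each piece is eventually
  -- equal to the one without cut-off.
  obtain ⟨C, hC, h⟩ := P.exists_symbolBound_low α hlam hη hηc
  refine tendsto_of_hasSum_of_lpNorm_le hp (hle C)
    (T := fun n R => Φ (fun ξ => P.ring ((2 : ℝ) ^ n • ξ) * cutSymbol α lam η R ξ))
    (fun n => ?_) (fun n R hR => hbd n C _ hC (h n R hR.le)) (fun R hR g => ?_) hF'
  · obtain ⟨r, hr, hr0⟩ := P.exists_ring_smul_eq_zero (c := 2 ^ n) (by positivity)
    filter_upwards [eventually_mul_cutoff_eq_zero hr hr0 hηc] with R hR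
    congr 1
    ext ξ
    rw [cutSymbol]
    linear_combination (-logRieszSymbol α lam ξ) * hR ξ
  · obtain ⟨N₀, h2, h3⟩ := P.exists_sum_low α lam hη1 hR
    have h4 : Φ (fun ξ => P.low ξ * cutSymbol α lam η R ξ) = ∑ n ∈ Finset.range N₀,
        Φ (fun ξ => P.ring ((2 : ℝ) ^ n • ξ) * cutSymbol α lam η R ξ) := by
      rw [← hΦ _ _ fun n _ => P.temperate_ring_mul_cutSymbol α hlam hη hηc n hR.le]
      congr 1
      ext ξ
      exact h3 ξ
    have h5 : Φ (fun _ => 0) = 0 := by simpa using hΦ ∅ (fun _ _ => 0) (by simp)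
    rw [h4, sum_apply]
    refine hasSum_sum_of_ne_finset_zero fun n hn => ?_
    rw [Finset.mem_range, not_lt] at hn
    simp only [h2 n hn, h5]
    rfl

/-- Existence of `R_α U` from the existence of its low frequency part, and its dyadic blocks. -/
lemma isLogRiesz_of_low (hlam : 1 < lam) {U W : 𝓢'(Space d, ℂ)}
    (hW : ∀ η : Space d → ℝ, ContDiff ℝ ∞ η → HasCompactSupport η → (∀ᶠ ξ in 𝓝 0, η ξ = 1) →
      Tendsto (fun R : ℝ => multiplier (fun ξ => P.low ξ * cutSymbol α lam η R ξ) U) atTop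
        (𝓝 W)) :
    IsLogRiesz α lam U (W + multiplier (highSymbol P α lam) U) ∧
    multiplier (P.sym 0) (W + multiplier (highSymbol P α lam) U) = W ∧
    ∀ n ≠ 0, multiplier (P.sym n) (W + multiplier (highSymbol P α lam) U) =
      multiplier (fun ξ => P.sym n ξ * logRieszSymbol α lam ξ) U := by
  obtain ⟨r, hr, hχ⟩ := P.exists_χ_eq_one
  have hhigh := temperate_highSymbol P α hlam
  -- For large R, η(R·) is supported where χ = 1 and does not affect the high frequency part.
  have hsplit : ∀ η : Space d → ℝ, HasCompactSupport η → ∀ᶠ R : ℝ in atTop,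
      cutSymbol α lam η R = fun ξ => P.low ξ * cutSymbol α lam η R ξ + highSymbol P α lam ξ := by
    intro η hηc
    filter_upwards [eventually_mul_cutoff_eq_zero (f := fun ξ => 1 - P.low ξ) hr
      (fun ξ hξ => by simp [low, hχ ξ hξ]) hηc] with R hR
    ext ξ
    rw [cutSymbol, highSymbol]
    linear_combination (-logRieszSymbol α lam ξ) * hR ξ
  have hmain : IsLogRiesz α lam U (W + multiplier (highSymbol P α lam) U) := by
    intro η hη hηc hη1
    refine ((hW η hη hηc hη1).add_const _).congr' ?_
    filter_upwards [hsplit η hηc, eventually_gt_atTop 0] with R hR hR0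
    change _ = multiplier (cutSymbol α lam η R) U
    rw [← multiplier_add (P.temperate_low_mul_cutSymbol α hlam hη hηc hη1 hR0) hhigh]
    exact congrArg (fun a => multiplier a U) hR.symm
  have hη1 : ∀ᶠ ξ in 𝓝 0, P.χ ξ = 1 := by
    filter_upwards [Metric.ball_mem_nhds (0 : Space d) hr] with ξ hξ
    exact hχ ξ (by simpa using hξ)
  -- Any admissible cut-off computes the blocks of the limit; χ itself is used.
  have hlim := fun n => ((multiplier (P.sym n)).continuous.tendsto _).comp
    (hmain P.χ P.χ_smooth P.χ_compact hη1)
  have hblock : ∀ n, ∀ᶠ R : ℝ in atTop, multiplier (P.sym n)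
      (multiplier (cutSymbol α lam P.χ R) U) =
        multiplier (fun ξ => P.sym n ξ * cutSymbol α lam P.χ R ξ) U := by
    intro n
    filter_upwards [hsplit P.χ P.χ_compact, eventually_gt_atTop 0] with R hR hR0
    have h6 : (cutSymbol α lam P.χ R).HasTemperateGrowth := by
      rw [hR]
      exact (P.temperate_low_mul_cutSymbol α hlam P.χ_smooth P.χ_compact hη1 hR0).add hhigh
    rw [multiplier_multiplier (P.temperate_sym n) h6]
  refine ⟨hmain, ?_, fun n hn => ?_⟩
  · refine tendsto_nhds_unique (hlim 0) ((hW P.χ P.χ_smooth P.χ_compact hη1).congr' ?_)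
    filter_upwards [hblock 0] with R hR
    rw [P.sym_zero] at hR ⊢
    exact hR.symm
  · refine tendsto_nhds_unique (hlim n) (tendsto_const_nhds.congr' ?_)
    obtain ⟨r', hr', hr0⟩ := P.exists_ring_smul_eq_zero (c := (2 ^ n)⁻¹) (by positivity)
    filter_upwards [hblock n, eventually_mul_cutoff_eq_zero hr' hr0 P.χ_compact] with R hR hR'
    refine Eq.trans ?_ hR.symm
    congr 2
    ext ξ
    rw [cutSymbol, P.sym_of_ne hn]
    linear_combination (logRieszSymbol α lam ξ) * hR' ξ

end LittlewoodPaley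

/-! ### From commutator estimates on dyadic blocks to the commutator with `R_α` -/

/-- Estimates in `L^p` of the commutators of `v · ∇` with localized multipliers. -/
structure CommBound (P : LittlewoodPaley d) (v : Space d → Space d) (p ρ K Λ : ℝ≥0∞)
    (β : ℕ → ℕ → ℝ≥0∞) : Prop where
  low : ∀ (n : ℕ) (C : ℝ) (a : Space d → ℂ) (T : 𝓢'(Space d, ℂ)), 0 ≤ C →
    SymbolBound ((2 ^ n)⁻¹) C a → lpNorm ρ T ≠ ⊤ →
    lpNorm p (advComm v a T) ≤ ENNReal.ofReal C *
      (K * Λ * ENNReal.ofReal ((2 ^ n)⁻¹) ^ ((d : ℝ) / ρ.toReal) * lpNorm ρ T)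
  high : ∀ (n j : ℕ) (C : ℝ) (a : Space d → ℂ) (U : 𝓢'(Space d, ℂ)), 0 ≤ C →
    SymbolBound (2 ^ n) C a → lpNorm ⊤ (multiplier (P.sym j) U) ≠ ⊤ →
    lpNorm p (advComm v a (multiplier (P.sym j) U)) ≤ ENNReal.ofReal C *
      (K * Λ * (β n j * lpNorm ⊤ (multiplier (P.sym j) U)))

lemma advComm_sum_symbol (v : Space d → Space d) {ι : Type*} (s : Finset ι)
    {a : ι → Space d → ℂ} (ha : ∀ i ∈ s, (a i).HasTemperateGrowth) (u : 𝓢'(Space d, ℂ)) :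
    advComm v (fun ξ => ∑ i ∈ s, a i ξ) u = ∑ i ∈ s, advComm v (a i) u := by
  simp only [advComm, multiplier_sum s ha, ← advectCLM_apply, map_sum, Finset.sum_sub_distrib]

lemma multiplier_advect (v : Space d → Space d) (a : Space d → ℂ) (u : 𝓢'(Space d, ℂ)) :
    multiplier a (advect v u) = advComm v a u + advect v (multiplier a u) := by
  rw [advComm, sub_add_cancel]

lemma tendsto_advComm_sum (P : LittlewoodPaley d) (v : Space d → Space d) (a : Space d → ℂ)
    (u : 𝓢'(Space d, ℂ)) (g : 𝓢(Space d, ℂ)) :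
    Tendsto (fun N => (∑ n ∈ Finset.range N, advComm v a (multiplier (P.sym n) u)) g) atTop
      (𝓝 (advComm v a u g)) := by
  have h1 : Tendsto (fun N => ∑ n ∈ Finset.range N, multiplier (P.sym n) u) atTop (𝓝 u) :=
    PointwiseConvergenceCLM.tendsto_iff_forall_tendsto.2 fun g => tendsto_sum_block P u g
  set L := (multiplier a).comp (advectCLM v) - (advectCLM v).comp (multiplier a) with hL
  have hLu : ∀ U, L U = advComm v a U := fun U => by
    rw [advComm, ← advectCLM_apply, ← advectCLM_apply]
    rfl
  have h2 := (L.continuous.tendsto u).comp h1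
  rw [hLu] at h2
  refine (PointwiseConvergenceCLM.tendsto_iff_forall_tendsto.1 h2 g).congr fun N => ?_
  rw [Function.comp_apply, map_sum]
  simp only [hLu]

lemma CommBound.lpNorm_le {P : LittlewoodPaley d} {v : Space d → Space d} {p ρ K Λ : ℝ≥0∞}
    {β : ℕ → ℕ → ℝ≥0∞} (h : CommBound P v p ρ K Λ β) (hp : 1 ≤ p) {n : ℕ} {C : ℝ}
    {a : Space d → ℂ} (hC : 0 ≤ C) (ha : SymbolBound (2 ^ n) C a) {U : 𝓢'(Space d, ℂ)}
    (hU : ∀ j, lpNorm ⊤ (multiplier (P.sym j) U) ≠ ⊤) :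
    lpNorm p (advComm v a U) ≤ ENNReal.ofReal C *
      (K * Λ * ∑' j, β n j * lpNorm ⊤ (multiplier (P.sym j) U)) := by
  refine (lpNorm_le_tsum hp (tendsto_advComm_sum P v a U)).trans ?_
  rw [← ENNReal.tsum_mul_left, ← ENNReal.tsum_mul_left]
  exact ENNReal.tsum_le_tsum fun j => h.high n j C a U hC ha (hU j)

lemma Localized.lpNorm_le {t C : ℝ} {a : Space d → ℂ} (h : Localized t C a) (ht : 0 < t)
    (hC : 0 ≤ C) {p : ℝ≥0∞} (hp : 1 ≤ p) {T : 𝓢'(Space d, ℂ)} (hT : lpNorm p T ≠ ⊤) :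
    lpNorm p (multiplier a T) ≤ ENNReal.ofReal C * (profConst d ^ 2 * lpNorm p T) := by
  obtain ⟨b, rfl, hb⟩ := h
  exact lpNorm_multiplier_le hb ht hC hp hT

lemma Localized.lpNorm_top_le {t C : ℝ} {a : Space d → ℂ} (h : Localized t C a) (ht : 0 < t)
    (hC : 0 ≤ C) {p : ℝ≥0∞} (hp : 1 ≤ p) {T : 𝓢'(Space d, ℂ)} (hT : lpNorm p T ≠ ⊤) :
    lpNorm ⊤ (multiplier a T) ≤ ENNReal.ofReal C * (profConst d *
      ENNReal.ofReal t ^ ((d : ℝ) / p.toReal) * lpNorm p T) := by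
  obtain ⟨b, rfl, hb⟩ := h
  exact lpNorm_top_multiplier_le hb ht hC hp hT

lemma lpNorm_top_block_ne_top (P : LittlewoodPaley d) {ρ : ℝ≥0∞} (hρ : 1 ≤ ρ)
    {u : 𝓢'(Space d, ℂ)} (hu : lpNorm ρ u ≠ ⊤) (n : ℕ) :
    lpNorm ⊤ (multiplier (P.sym n) u) ≠ ⊤ := by
  obtain ⟨C, hC, h⟩ := P.exists_symbolBound_sym
  refine (((h n).base.lpNorm_top_le (by positivity) hC hρ hu).trans_lt ?_).ne
  refine ENNReal.mul_lt_top ENNReal.ofReal_lt_top (ENNReal.mul_lt_top (ENNReal.mul_lt_top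
    profConst_ne_top.lt_top (ENNReal.rpow_lt_top_of_nonneg (by positivity)
      ENNReal.ofReal_ne_top)) hu.lt_top)

/-- A geometric series of ratio 2^{-d/ρ}, smaller than one exactly because d ≥ 1 and ρ < ∞. -/
lemma tsum_low_ne_top [NeZero d] {ρ : ℝ≥0∞} (hρ : 1 ≤ ρ) (hρt : ρ ≠ ⊤) :
    ∑' n : ℕ, ENNReal.ofReal ((2 ^ n)⁻¹) ^ ((d : ℝ) / ρ.toReal) ≠ ⊤ := by
  have hρ0 : 0 < ρ.toReal := ENNReal.toReal_pos (zero_lt_one.trans_le hρ).ne' hρt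
  have hd : 0 < (d : ℝ) := Nat.cast_pos.2 (NeZero.pos d)
  have h1 : ∀ n : ℕ, ENNReal.ofReal ((2 ^ n)⁻¹) ^ ((d : ℝ) / ρ.toReal) =
      (ENNReal.ofReal 2⁻¹ ^ ((d : ℝ) / ρ.toReal)) ^ n := fun n => by
    rw [← inv_pow, ENNReal.ofReal_pow (by positivity), ← ENNReal.rpow_natCast,
      ← ENNReal.rpow_natCast, ← ENNReal.rpow_mul, ← ENNReal.rpow_mul, mul_comm]
  simp only [h1]
  rw [ENNReal.tsum_geometric]
  refine ENNReal.inv_ne_top.2 (tsub_pos_of_lt ?_).ne'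
  refine ENNReal.rpow_lt_one ?_ (by positivity)
  rw [ENNReal.ofReal_lt_one]
  norm_num

/-- The commutator with `R_α` is controlled by the dyadic blocks of `u`. -/
lemma exists_commutator_bound [NeZero d] (P : LittlewoodPaley d) (α : ℝ) {lam : ℝ}
    (hlam : 1 < lam) {p ρ K : ℝ≥0∞} (hp : 1 ≤ p) (hρ : 1 ≤ ρ) (hρt : ρ ≠ ⊤) (hK : K ≠ ⊤) :
    ∃ C : ℝ≥0∞, C ≠ ⊤ ∧ ∀ (v : Space d → Space d) (Λ : ℝ≥0∞) (β : ℕ → ℕ → ℝ≥0∞)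
      (u : 𝓢'(Space d, ℂ)), Λ ≠ ⊤ → lpNorm ρ u ≠ ⊤ → CommBound P v p ρ K Λ β → 1 ≤ β 0 0 →
      ∃ A B : 𝓢'(Space d, ℂ), IsLogRiesz α lam (advect v u) A ∧ IsLogRiesz α lam u B ∧
        ∀ n : ℕ, lpNorm p (multiplier (P.sym n) (A - advect v B)) ≤
          C * Λ * ∑' j : ℕ, β n j * ((ENNReal.ofReal (((n : ℝ) + 1) ^ α) +
            ENNReal.ofReal (((j : ℝ) + 1) ^ α)) * (lpNorm ⊤ (multiplier (P.sym j) u) +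
              if j = 0 then lpNorm ρ u else 0)) := by
  obtain ⟨C₀, hC₀, h₀⟩ := P.exists_low_limit α hlam
  obtain ⟨Cs, hCs, hs⟩ := P.exists_symbolBound_sym
  obtain ⟨Cm, hCm, hm⟩ := P.exists_symbolBound_sym_mul_logRieszSymbol α hlam
  obtain ⟨Cn, hCn, hn⟩ := P.exists_localized_sym'_mul_logRieszSymbol α hlam
  set S : ℝ≥0∞ := ∑' n : ℕ, ENNReal.ofReal ((2 ^ n)⁻¹) ^ ((d : ℝ) / ρ.toReal) with hS
  have hSt : S ≠ ⊤ := tsum_low_ne_top hρ hρt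
  have hpc : profConst d ≠ ⊤ := profConst_ne_top
  -- Constant for the blocks of R_α u: the first term bounds the low block by the L^ρ norm of u, the
  -- second every other block by that of u with the logarithmic weight.
  set CB : ℝ≥0∞ := ENNReal.ofReal C₀ * (profConst d * S) + ENNReal.ofReal Cn * profConst d ^ 2
    with hCB
  have hCBt : CB ≠ ⊤ := by finiteness
  refine ⟨K * (ENNReal.ofReal Cm + ENNReal.ofReal Cs * CB + ENNReal.ofReal C₀ * S),
    by finiteness, fun v Λ β u hΛ hu hcb hβ => ?_⟩
  have hfin := lpNorm_top_block_ne_top P hρ hu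
  obtain ⟨Bl, hBl, hBl'⟩ := h₀ ⊤ le_top (fun a => multiplier a u)
    (fun s a ha => multiplier_sum s ha u)
    (fun n => profConst d * ENNReal.ofReal ((2 ^ n)⁻¹) ^ ((d : ℝ) / ρ.toReal) * lpNorm ρ u)
    (by rw [ENNReal.tsum_mul_right, ENNReal.tsum_mul_left]; finiteness)
    (fun n C a hC ha => ha.base.lpNorm_top_le (by positivity) hC hρ hu)
  obtain ⟨F, hF, hF'⟩ := h₀ p hp (fun a => advComm v a u)
    (fun s a ha => advComm_sum_symbol v s ha u)
    (fun n => K * Λ * ENNReal.ofReal ((2 ^ n)⁻¹) ^ ((d : ℝ) / ρ.toReal) * lpNorm ρ u)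
    (by rw [ENNReal.tsum_mul_right, ENNReal.tsum_mul_left]; finiteness)
    (fun n C a hC ha => hcb.low n C a u hC ha hu)
  rw [ENNReal.tsum_mul_right, ENNReal.tsum_mul_left, ← hS] at hBl hF
  obtain ⟨hB, hB0, hBn⟩ := P.isLogRiesz_of_low hlam hBl'
  -- a(D)(v·∇u) is the commutator plus v·∇(a(D)u). Both low limits are already known, and v·∇ is
  -- continuous on tempered distributions, so the low part of R_α(v·∇u) converges.
  obtain ⟨hA, hA0, hAn⟩ := P.isLogRiesz_of_low (α := α) hlam (U := advect v u)
    (W := F + advect v Bl) (fun η hη hηc hη1 => by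
      simp only [multiplier_advect]
      refine (hF' η hη hηc hη1).add ?_
      simpa only [Function.comp_def, advectCLM_apply] using
        ((advectCLM v).continuous.tendsto Bl).comp (hBl' η hη hηc hη1))
  set B := Bl + multiplier (highSymbol P α lam) u with hBdef
  set A := F + advect v Bl + multiplier (highSymbol P α lam) (advect v u) with hAdef
  refine ⟨A, B, hA, hB, ?_⟩
  have hsub : ∀ n, multiplier (P.sym n) (A - advect v B) = multiplier (P.sym n) A -
      (advComm v (P.sym n) B + advect v (multiplier (P.sym n) B)) := fun n => by
    rw [map_sub, multiplier_advect]
  have hw : ∀ n : ℕ, 0 ≤ ((n : ℝ) + 1) ^ α := fun n => by positivity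
  set ν : ℕ → ℝ≥0∞ := fun j => lpNorm ⊤ (multiplier (P.sym j) u) +
    if j = 0 then lpNorm ρ u else 0 with hν
  have hNB : ∀ j, lpNorm ⊤ (multiplier (P.sym j) B) ≤
      CB * (ENNReal.ofReal (((j : ℝ) + 1) ^ α) * ν j) := by
    intro j
    rcases eq_or_ne j 0 with rfl | hj
    · rw [hB0]
      simp only [Nat.cast_zero, zero_add, Real.one_rpow, ENNReal.ofReal_one, one_mul]
      refine hBl.trans ?_
      rw [← mul_assoc]
      refine mul_le_mul' le_self_add ?_
      simp [hν]
    · rw [hBn j hj]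
      -- The fattened cut-off is inserted so that a localized multiplier acts on the block of u and
      -- only its L^∞ norm is needed.
      have h1 : multiplier (fun ξ => P.sym j ξ * logRieszSymbol α lam ξ) u =
          multiplier (fun ξ => P.sym' j ξ * logRieszSymbol α lam ξ) (multiplier (P.sym j) u) := by
        rw [multiplier_multiplier (hn j hj).temperate (P.temperate_sym j)]
        congr 2
        ext ξ
        linear_combination (-logRieszSymbol α lam ξ) * P.sym'_mul_sym j ξ
      rw [h1]
      refine ((hn j hj).lpNorm_le (by positivity) (by positivity) le_top (hfin j)).trans ?_
      rw [ENNReal.ofReal_mul hCn]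
      calc _ = ENNReal.ofReal Cn * profConst d ^ 2 * (ENNReal.ofReal (((j : ℝ) + 1) ^ α) *
            lpNorm ⊤ (multiplier (P.sym j) u)) := by ring
        _ ≤ _ := by
          gcongr
          · exact le_add_self
          · exact le_self_add
  have hfinB : ∀ j, lpNorm ⊤ (multiplier (P.sym j) B) ≠ ⊤ := fun j => by
    refine ((hNB j).trans_lt ?_).ne
    have : ν j ≠ ⊤ := by
      refine ENNReal.add_ne_top.2 ⟨hfin j, ?_⟩
      split_ifs <;> simp [hu]
    finiteness
  intro n
  set w : ℕ → ℝ≥0∞ := fun n => ENNReal.ofReal (((n : ℝ) + 1) ^ α) with hwdef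
  set Z : ℝ≥0∞ := ∑' j, β n j * ((w n + w j) * ν j) with hZ
  have hcB : lpNorm p (advComm v (P.sym n) B) ≤ ENNReal.ofReal Cs * CB * (K * Λ * Z) := by
    refine (hcb.lpNorm_le hp hCs (hs n) hfinB).trans ?_
    have h1 : ∑' j, β n j * lpNorm ⊤ (multiplier (P.sym j) B) ≤ CB * Z := by
      rw [hZ, ← ENNReal.tsum_mul_left]
      refine ENNReal.tsum_le_tsum fun j => ?_
      calc _ ≤ β n j * (CB * (w j * ν j)) := by gcongr; exact hNB j
        _ ≤ β n j * (CB * ((w n + w j) * ν j)) := by gcongr; exact le_add_self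
        _ = _ := by ring
    calc _ ≤ ENNReal.ofReal Cs * (K * Λ * (CB * Z)) := by gcongr
      _ = _ := by ring
  rcases eq_or_ne n 0 with rfl | hn0
  -- For n = 0 the terms v·∇ of the low part of R_α u cancel, leaving the low limit F of the
  -- commutator and one commutator with the block itself.
  · have h1 : multiplier (P.sym 0) (A - advect v B) = F - advComm v (P.sym 0) B := by
      rw [hsub, hA0, hB0]; abel
    rw [h1]
    refine (lpNorm_sub_le hp _ _).trans ((add_le_add hF hcB).trans ?_)
    -- The low part F is controlled by the L^ρ norm alone; it enters the sum through the entry j =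
    -- 0, where β 0 0 ≥ 1 and the weights equal one.
    have h2 : lpNorm ρ u ≤ Z := by
      refine le_trans ?_ (ENNReal.le_tsum 0)
      have h3 : lpNorm ρ u ≤ ν 0 := by simp [hν]
      calc lpNorm ρ u ≤ 1 * (1 * ν 0) := by simpa using h3
        _ ≤ _ := by
          gcongr
          simp [hwdef]
    calc _ ≤ ENNReal.ofReal C₀ * (K * Λ * S * Z) + ENNReal.ofReal Cs * CB * (K * Λ * Z) := by
          gcongr
      _ = K * (ENNReal.ofReal Cs * CB + ENNReal.ofReal C₀ * S) * Λ * Z := by ring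
      _ ≤ _ := by
        gcongr
        exact le_add_self
  · have h1 : multiplier (P.sym n) (A - advect v B) =
        advComm v (fun ξ => P.sym n ξ * logRieszSymbol α lam ξ) u - advComm v (P.sym n) B := by
      rw [hsub, hAn n hn0, hBn n hn0, multiplier_advect]; abel
    rw [h1]
    have h2 := hcb.lpNorm_le hp (by have := hw n; positivity) (hm n hn0) hfin
    have h3 : ENNReal.ofReal (Cm * ((n : ℝ) + 1) ^ α) *
        (K * Λ * ∑' j, β n j * lpNorm ⊤ (multiplier (P.sym j) u)) ≤
          ENNReal.ofReal Cm * (K * Λ * Z) := by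
      rw [ENNReal.ofReal_mul hCm]
      calc _ = ENNReal.ofReal Cm * (K * Λ * (w n *
            ∑' j, β n j * lpNorm ⊤ (multiplier (P.sym j) u))) := by rw [hwdef]; ring
        _ ≤ _ := by
          gcongr
          rw [← ENNReal.tsum_mul_left]
          refine ENNReal.tsum_le_tsum fun j => ?_
          calc _ = β n j * (w n * lpNorm ⊤ (multiplier (P.sym j) u)) := by ring
            _ ≤ _ := by
              gcongr
              · exact le_self_add
              · exact le_self_add
    refine (lpNorm_sub_le hp _ _).trans ((add_le_add (h2.trans h3) hcB).trans ?_)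
    calc _ = K * (ENNReal.ofReal Cm + ENNReal.ofReal Cs * CB) * Λ * Z := by ring
      _ ≤ _ := mul_le_mul' (mul_le_mul' (mul_le_mul' le_rfl le_self_add) le_rfl) le_rfl

/-! ### Bernstein estimates for the dyadic blocks -/

/-- A block is reproduced by its fattened cut-off, whose product with iξ_i is localized with size
2^n. -/
lemma lpNorm_top_lineDeriv_block_le (P : LittlewoodPaley d) :
    ∃ C : ℝ≥0∞, C ≠ ⊤ ∧ ∀ (n : ℕ) (i : Fin d) (U : 𝓢'(Space d, ℂ)),
      lpNorm ⊤ (multiplier (P.sym n) U) ≠ ⊤ →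
      lpNorm ⊤ (∂_{EuclideanSpace.single i (1 : ℝ)} (multiplier (P.sym n) U)) ≤
        C * 2 ^ n * lpNorm ⊤ (multiplier (P.sym n) U) := by
  obtain ⟨C, hC, h⟩ := P.exists_symbolBound_sym'
  have hpc : profConst d ≠ ⊤ := profConst_ne_top
  refine ⟨ENNReal.ofReal C * profConst d ^ 2, by finiteness, fun n i U hU => ?_⟩
  have h1 : multiplier (P.sym n) U = multiplier (P.sym' n) (multiplier (P.sym n) U) := by
    rw [multiplier_multiplier (h n).base.temperate (P.temperate_sym n)]
    simp only [P.sym'_mul_sym]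
  conv_lhs => rw [h1, lineDeriv_multiplier (h n).base.temperate]
  refine (((h n).coord i).lpNorm_le (by positivity) (by positivity) le_top hU).trans_eq ?_
  rw [ENNReal.ofReal_mul hC, ENNReal.ofReal_pow zero_le_two, ENNReal.ofReal_ofNat]
  ring

/-- The converse Bernstein estimate: a block away from the origin is a divergence, of potentials
smaller by 2^{-n}. The fattened cut-off makes the potentials act on the block itself. -/
lemma exists_potential_block (P : LittlewoodPaley d) :
    ∃ C : ℝ≥0∞, C ≠ ⊤ ∧ ∀ (n : ℕ) (U : 𝓢'(Space d, ℂ)), n ≠ 0 →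
      lpNorm ⊤ (multiplier (P.sym n) U) ≠ ⊤ → ∃ H : Fin d → 𝓢'(Space d, ℂ),
      multiplier (P.sym n) U = ∑ l, ∂_{EuclideanSpace.single l (1 : ℝ)} (H l) ∧
      ∀ l, lpNorm ⊤ (H l) ≤ C * 2⁻¹ ^ n * lpNorm ⊤ (multiplier (P.sym n) U) := by
  obtain ⟨C, hC, h⟩ := P.annular_ring'.exists_symbolBound_potential
  have hpc : profConst d ≠ ⊤ := profConst_ne_top
  refine ⟨ENNReal.ofReal C * profConst d ^ 2, by finiteness, fun n U hn hU => ?_⟩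
  have ht : (0 : ℝ) < 2 ^ n := by positivity
  set b : Fin d → Space d → ℂ := potential P.ring' (2 ^ n) with hb
  have hbl : ∀ l, Localized (2 ^ n) (C * (2 ^ n)⁻¹) (b l) := fun l => (h _ l ht).base
  refine ⟨fun l => multiplier (b l) (multiplier (P.sym n) U), ?_, fun l => ?_⟩
  · have hs := P.temperate_sym n
    have h2 : ∀ l, (fun ξ => b l ξ * P.sym n ξ).HasTemperateGrowth := fun l =>
      (hbl l).temperate.mul hs
    have h1 : ∀ l, ∂_{EuclideanSpace.single l (1 : ℝ)} (multiplier (b l)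
        (multiplier (P.sym n) U)) =
          multiplier (fun ξ => Complex.I * (ξ l : ℂ) * (b l ξ * P.sym n ξ)) U := by
      intro l
      rw [multiplier_multiplier (hbl l).temperate hs, lineDeriv_multiplier (h2 l)]
    have h3 : ∀ ξ, ∑ l, Complex.I * (ξ l : ℂ) * (b l ξ * P.sym n ξ) = P.sym n ξ := fun ξ => by
      have h4 := P.sym'_mul_sym n ξ
      rw [LittlewoodPaley.sym', if_neg hn, ← sum_potential P.annular_ring'.map_zero,
        Finset.sum_mul] at h4
      rw [← h4]
      exact Finset.sum_congr rfl fun l _ => by rw [hb]; simp only [h4]; ring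
    simp only [h1]
    rw [← multiplier_sum]
    · simp only [h3]
    · intro l _
      exact ((Function.HasTemperateGrowth.const Complex.I).mul (temperate_coord l)).mul (h2 l)
  · refine ((hbl l).lpNorm_le (by positivity) (by positivity) le_top hU).trans_eq ?_
    rw [ENNReal.ofReal_mul hC, ← inv_pow, ENNReal.ofReal_pow (by positivity),
      ENNReal.ofReal_inv_of_pos two_pos, ENNReal.ofReal_ofNat]
    ring

/-! ### Commutator estimates in `L^p`, `2 ≤ p < ∞` -/

lemma norm_fderiv_component_le {v : Space d → Space d} (hv : v.HasTemperateGrowth) (i l : Fin d)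
    (x : Space d) :
    ‖fderiv ℝ (component v i) x (EuclideanSpace.single l (1 : ℝ))‖ ≤ ‖fderiv ℝ v x‖ := by
  rw [fderiv_component hv, Complex.norm_real]
  refine (PiLp.norm_apply_le _ i).trans (((fderiv ℝ v x).le_opNorm _).trans_eq ?_)
  simp

lemma lpNorm_smulLeft_fderiv_le {v : Space d → Space d} (hv : v.HasTemperateGrowth) (i l : Fin d)
    (p : ℝ≥0∞) {H : 𝓢'(Space d, ℂ)} (hH : lpNorm ⊤ H ≠ ⊤) :
    lpNorm p (TemperedDistribution.smulLeftCLM ℂ (fun x => fderiv ℝ (component v i) x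
      (EuclideanSpace.single l (1 : ℝ))) H) ≤ eLpNorm (fderiv ℝ v) p volume * lpNorm ⊤ H := by
  obtain ⟨h, hh, hr, hn⟩ := exists_represents_of_lpNorm_ne_top le_top hH
  have ht := temperate_fderiv_apply (temperate_component hv i) (EuclideanSpace.single l (1 : ℝ))
  refine ((hr.smulLeft ht).lpNorm_le p).trans ?_
  rw [← hn]
  refine (eLpNorm_smul_le_mul_eLpNorm (p := p) (q := ⊤) (r := p) hh.1
    ht.1.continuous.aestronglyMeasurable).trans ?_
  gcongr
  exact eLpNorm_mono (norm_fderiv_component_le hv i l)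

lemma comm_sum (a f : Space d → ℂ) {ι : Type*} (s : Finset ι) (T : ι → 𝓢'(Space d, ℂ)) :
    comm a f (∑ l ∈ s, T l) = ∑ l ∈ s, comm a f (T l) := by
  simp only [comm, map_sum, Finset.sum_sub_distrib]

lemma Localized.lpNorm_comm_le {t C : ℝ} {a : Space d → ℂ} (h : Localized t C a) (ht : 0 < t)
    (hC : 0 ≤ C) {p q : ℝ≥0∞} (hp : 2 ≤ p) (hpt : p ≠ ⊤) (hpq : p ≤ q)
    {v : Space d → Space d} (hv : v.HasTemperateGrowth) (i : Fin d)
    {T : 𝓢'(Space d, ℂ)} (hT : lpNorm q T ≠ ⊤) :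
    lpNorm p (comm a (component v i) T) ≤ ENNReal.ofReal (C * t⁻¹) *
      (profConst d ^ 2 * ENNReal.ofReal t ^ ((d : ℝ) / q.toReal) * lpNorm q T) *
        eLpNorm (fderiv ℝ v) p volume := by
  obtain ⟨b, rfl, hb⟩ := h
  exact LogRiesz.lpNorm_comm_le hb ht hC hp hpt hpq hv i hT

lemma ofReal_two_pow_inv (n : ℕ) : ENNReal.ofReal (((2 : ℝ) ^ n)⁻¹) = 2⁻¹ ^ n := by
  rw [← inv_pow, ENNReal.ofReal_pow (by positivity), ENNReal.ofReal_inv_of_pos two_pos,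
    ENNReal.ofReal_ofNat]

lemma ofReal_two_pow (n : ℕ) : ENNReal.ofReal ((2 : ℝ) ^ n) = 2 ^ n := by
  rw [ENNReal.ofReal_pow zero_le_two, ENNReal.ofReal_ofNat]

lemma two_inv_pow_mul_two_pow (n : ℕ) : (2 : ℝ≥0∞)⁻¹ ^ n * 2 ^ n = 1 := by
  rw [← mul_pow, ENNReal.inv_mul_cancel two_ne_zero (by simp), one_pow]

/-- `2 ^ (-|n - j|)`. -/
def twoDist (n j : ℕ) : ℝ≥0∞ := 2⁻¹ ^ ((n - j) + (j - n))

lemma two_inv_pow_mul_two_pow_of_le {n j : ℕ} (h : j ≤ n) :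
    (2 : ℝ≥0∞)⁻¹ ^ n * 2 ^ j = 2⁻¹ ^ (n - j) := by
  obtain ⟨k, rfl⟩ := Nat.exists_eq_add_of_le h
  rw [pow_add, mul_right_comm, two_inv_pow_mul_two_pow, one_mul, Nat.add_sub_cancel_left]

/-- The commutator gains t⁻¹ for a symbol at frequency t. At low frequency the derivative on the
symbol costs t, leaving only t^{d/p}. At high frequency the two forms of the commutator give
2^{-n}2^j for j ≤ n and, after writing the block as a divergence, 2^n 2^{-j} for j > n. -/
lemma exists_commBound [NeZero d] (P : LittlewoodPaley d) {p : ℝ≥0∞} (hp : 2 ≤ p) (hpt : p ≠ ⊤) :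
    ∃ K : ℝ≥0∞, K ≠ ⊤ ∧ ∀ v : Space d → Space d, v.HasTemperateGrowth →
      (∀ x, divergence v x = 0) → MemLp (fderiv ℝ v) p volume →
      CommBound P v p p K (eLpNorm (fderiv ℝ v) p volume) twoDist := by
  have hp1 : 1 ≤ p := one_le_two.trans hp
  obtain ⟨C₁, hC₁, h₁⟩ := lpNorm_top_lineDeriv_block_le P
  obtain ⟨C₂, hC₂, h₂⟩ := exists_potential_block P
  set κ := profConst d ^ 2 with hκ
  have hκt : κ ≠ ⊤ := by have : profConst d ≠ ⊤ := profConst_ne_top; finiteness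
  have hdt : (d : ℝ≥0∞) ≠ ⊤ := ENNReal.natCast_ne_top d
  refine ⟨d * κ + d * κ * C₁ + d * (d * (2 * κ * C₂)), by finiteness, fun v hv hdiv hG => ?_⟩
  set G := eLpNorm (fderiv ℝ v) p volume
  have hGt : G ≠ ⊤ := hG.2.ne
  have hexp : ∀ t : ℝ, ENNReal.ofReal t ^ ((d : ℝ) / (⊤ : ℝ≥0∞).toReal) = 1 := by simp
  constructor
  · intro n C a T hC ha hT
    rw [advComm_eq_sum_comm hv hdiv ha.base.temperate]
    refine (lpNorm_sum_le hp1 _ _).trans ?_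
    have ht : (0 : ℝ) < (2 ^ n)⁻¹ := by positivity
    calc _ ≤ ∑ _i : Fin d, ENNReal.ofReal C * (κ * ENNReal.ofReal ((2 ^ n)⁻¹) ^
          ((d : ℝ) / p.toReal) * lpNorm p T) * G := by
          refine Finset.sum_le_sum fun i _ => ?_
          have := (ha.coord i).lpNorm_comm_le ht (by positivity) hp hpt le_rfl hv i hT
          rwa [mul_inv_cancel_right₀ ht.ne'] at this
      _ = ENNReal.ofReal C * (d * κ * G * ENNReal.ofReal ((2 ^ n)⁻¹) ^
          ((d : ℝ) / p.toReal) * lpNorm p T) := by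
          rw [Finset.sum_const, Finset.card_univ, Fintype.card_fin, nsmul_eq_mul]; ring
      _ ≤ _ := by
          gcongr
          rw [add_assoc]
          exact le_self_add
  · intro n j C a U hC ha hT
    have ht : (0 : ℝ) < 2 ^ n := by positivity
    set N := lpNorm ⊤ (multiplier (P.sym j) U)
    rcases le_or_gt j n with hj | hj
    · rw [advComm_eq_sum_comm_lineDeriv v ha.base.temperate]
      refine (lpNorm_sum_le hp1 _ _).trans ?_
      calc _ ≤ ∑ _i : Fin d, ENNReal.ofReal C * 2⁻¹ ^ n * (κ * (C₁ * 2 ^ j * N)) * G := by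
            refine Finset.sum_le_sum fun i _ => ?_
            have hle := h₁ j i U hT
            have := ha.base.lpNorm_comm_le ht hC hp hpt le_top hv i
              (hle.trans_lt (by finiteness)).ne
            rw [hexp, mul_one, ENNReal.ofReal_mul hC, ofReal_two_pow_inv] at this
            refine this.trans ?_
            gcongr
        _ = ENNReal.ofReal C * (d * κ * C₁ * G * ((2⁻¹ ^ n * 2 ^ j) * N)) := by
            rw [Finset.sum_const, Finset.card_univ, Fintype.card_fin, nsmul_eq_mul]; ring
        _ ≤ _ := by
            rw [two_inv_pow_mul_two_pow_of_le hj, twoDist, Nat.sub_eq_zero_of_le hj, add_zero]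
            exact mul_le_mul' le_rfl (mul_le_mul' (mul_le_mul' (le_add_self.trans le_self_add)
              le_rfl) le_rfl)
    · obtain ⟨H, hH, hHle⟩ := h₂ j U (by omega) hT
      have hHt : ∀ l, lpNorm ⊤ (H l) ≠ ⊤ := fun l => ((hHle l).trans_lt (by finiteness)).ne
      rw [advComm_eq_sum_comm hv hdiv ha.base.temperate]
      refine (lpNorm_sum_le hp1 _ _).trans ?_
      calc _ ≤ ∑ _i : Fin d, ∑ _l : Fin d, ENNReal.ofReal C * 2 ^ n *
            (2 * κ * (C₂ * 2⁻¹ ^ j * N)) * G := by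
            refine Finset.sum_le_sum fun i _ => ?_
            rw [hH, comm_sum]
            refine (lpNorm_sum_le hp1 _ _).trans (Finset.sum_le_sum fun l _ => ?_)
            -- Both terms have size 2^n 2^{-j}: the first costs 2^{2n} for two derivatives on the
            -- symbol and gains 2^{-n} as a commutator, the second puts one derivative on v and one
            -- on the symbol.
            rw [comm_lineDeriv (ha.coord i).temperate (temperate_component hv i)]
            refine (lpNorm_sub_le hp1 _ _).trans ?_
            have e1 := (ha.coord_coord i l).lpNorm_comm_le ht (by positivity) hp hpt le_top hv i
              (hHt l)
            have e2 := lpNorm_smulLeft_fderiv_le hv i l p (hHt l)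
            have e3 := (ha.coord i).lpNorm_le ht (by positivity) hp1
              (e2.trans_lt (ENNReal.mul_lt_top hGt.lt_top (hHt l).lt_top)).ne
            have e4 : C * (2 ^ n) ^ 2 * ((2 : ℝ) ^ n)⁻¹ = C * 2 ^ n := by field_simp
            rw [hexp, mul_one, e4] at e1
            rw [ENNReal.ofReal_mul hC, ofReal_two_pow] at e1 e3
            have e5 := hHle l
            calc _ ≤ ENNReal.ofReal C * 2 ^ n * (κ * (C₂ * 2⁻¹ ^ j * N)) * G +
                  ENNReal.ofReal C * 2 ^ n * (κ * (G * (C₂ * 2⁻¹ ^ j * N))) := by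
                  refine add_le_add (e1.trans ?_) (e3.trans ?_)
                  · gcongr
                  · gcongr
                    exact e2.trans (by gcongr)
              _ = _ := by ring
        _ = ENNReal.ofReal C * (d * (d * (2 * κ * C₂)) * G * ((2⁻¹ ^ j * 2 ^ n) * N)) := by
            simp only [Finset.sum_const, Finset.card_univ, Fintype.card_fin, nsmul_eq_mul]; ring
        _ ≤ _ := by
            rw [two_inv_pow_mul_two_pow_of_le hj.le, twoDist, Nat.sub_eq_zero_of_le hj.le,
              zero_add]
            exact mul_le_mul' le_rfl (mul_le_mul' (mul_le_mul' le_add_self le_rfl) le_rfl)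

/-! ### Smooth functions as tempered distributions -/

/-- The constant function one as a tempered distribution. -/
def oneDist (d : ℕ) : 𝓢'(Space d, ℂ) :=
  Lp.toTemperedDistribution (memLp_top_const (μ := (volume : Measure (Space d))) (1 : ℂ)).toLp

lemma represents_oneDist : Represents (fun _ => 1) (oneDist d) := represents_of_memLp _

lemma lineDeriv_oneDist (e : Space d) : ∂_{e} (oneDist d) = 0 := by
  ext g
  have h1 : Integrable fun x => fderiv ℝ g x e := (∂_{e} g : 𝓢(Space d, ℂ)).integrable
  have h2 := integral_mul_fderiv_eq_neg_fderiv_mul_of_integrable (μ := (volume : Measure (Space d)))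
    (f := fun _ : Space d => (1 : ℂ)) (g := g) (v := e) (by simp) (by simpa using h1)
    (by simpa using g.integrable) (fun _ _ => by fun_prop) (fun x _ => g.differentiableAt)
  rw [TemperedDistribution.lineDerivOp_apply_apply, represents_oneDist.2]
  simp only [one_mul, fderiv_fun_const, Pi.zero_apply, zero_apply, zero_mul, integral_zero,
    neg_zero] at h2
  simp only [neg_apply, mul_one, SchwartzMap.lineDerivOp_apply_eq_fderiv, integral_neg, h2,
    neg_zero]
  rfl

/-- The tempered distribution defined by a smooth function with temperate growth. -/
def smoothDist (f : Space d → ℂ) : 𝓢'(Space d, ℂ) :=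
  TemperedDistribution.smulLeftCLM ℂ f (oneDist d)

lemma represents_smoothDist {f : Space d → ℂ} (hf : f.HasTemperateGrowth) :
    Represents f (smoothDist f) := by
  have h := represents_oneDist.smulLeft hf
  simp only [mul_one] at h
  exact h

lemma lineDeriv_smoothDist {f : Space d → ℂ} (hf : f.HasTemperateGrowth) (e : Space d) :
    ∂_{e} (smoothDist f) = smoothDist (fun x => fderiv ℝ f x e) := by
  rw [smoothDist, lineDeriv_smulLeft hf, lineDeriv_oneDist, map_zero, zero_add, smoothDist]

/-! ### Recovering a divergence free vector field from its vorticity -/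

/-- The coordinates of the vorticity. -/
def vortComp (v : Space d → Space d) (i l : Fin d) (x : Space d) : ℂ :=
  fderiv ℝ (component v i) x (EuclideanSpace.single l (1 : ℝ)) -
    fderiv ℝ (component v l) x (EuclideanSpace.single i (1 : ℝ))

lemma temperate_vortComp {v : Space d → Space d} (hv : v.HasTemperateGrowth) (i l : Fin d) :
    (vortComp v i l).HasTemperateGrowth :=
  (temperate_fderiv_apply (temperate_component hv i) _).sub
    (temperate_fderiv_apply (temperate_component hv l) _)

lemma enorm_vortComp_le {v : Space d → Space d} (hv : v.HasTemperateGrowth) (i l : Fin d)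
    (x : Space d) : ‖vortComp v i l x‖ₑ ≤ ‖vorticity v x‖ₑ := by
  have h1 : vortComp v i l x =
      ((vorticity v x (EuclideanSpace.single l (1 : ℝ)) i : ℝ) : ℂ) := by
    rw [vortComp, fderiv_component hv, fderiv_component hv, vorticity]
    have h2 : ContinuousLinearMap.adjoint (fderiv ℝ v x) (EuclideanSpace.single l (1 : ℝ)) i =
        fderiv ℝ v x (EuclideanSpace.single i (1 : ℝ)) l := by
      have h3 := ContinuousLinearMap.adjoint_inner_right (fderiv ℝ v x)
        (EuclideanSpace.single i (1 : ℝ)) (EuclideanSpace.single l (1 : ℝ))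
      rw [EuclideanSpace.inner_single_left, EuclideanSpace.inner_single_right] at h3
      simpa using h3
    rw [sub_apply, PiLp.sub_apply, h2]
    push_cast
    rfl
  rw [← ofReal_norm, ← ofReal_norm, h1, Complex.norm_real]
  refine ENNReal.ofReal_le_ofReal ((PiLp.norm_apply_le _ i).trans ?_)
  refine ((vorticity v x).le_opNorm _).trans_eq ?_
  simp

/-- Biot-Savart at a fixed frequency: v_i = ∑_l ∂_l Δ⁻¹(∂_l v_i − ∂_i v_l), the second sum being ∂_i
Δ⁻¹ div v = 0. The annular cut-off makes Δ⁻¹ harmless, and v may grow polynomially. -/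
lemma multiplier_component_eq_sum {v : Space d → Space d} (hv : v.HasTemperateGrowth)
    (hdiv : ∀ x, divergence v x = 0) {ψ : Space d → ℂ} (hψ : Annular ψ) {t : ℝ} (ht : 0 < t)
    (i : Fin d) :
    multiplier (fun ξ => ψ (t⁻¹ • ξ)) (smoothDist (component v i)) =
      ∑ l, multiplier (potential ψ t l) (smoothDist (vortComp v i l)) := by
  obtain ⟨C, -, hC⟩ := hψ.exists_symbolBound_potential
  have hp : ∀ l, (potential ψ t l).HasTemperateGrowth := fun l => (hC t l ht).base.temperate
  have hv' := temperate_component hv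
  have hf : ∀ l e, (fun x => fderiv ℝ (component v l) x e).HasTemperateGrowth := fun l e =>
    temperate_fderiv_apply (hv' l) e
  have h1 : ∀ l, smoothDist (vortComp v i l) =
      ∂_{EuclideanSpace.single l (1 : ℝ)} (smoothDist (component v i)) -
        ∂_{EuclideanSpace.single i (1 : ℝ)} (smoothDist (component v l)) := fun l => by
    rw [lineDeriv_smoothDist (hv' i), lineDeriv_smoothDist (hv' l)]
    simp only [smoothDist]
    have := TemperedDistribution.smulLeftCLM_sub (F := ℂ)
      (hf i (EuclideanSpace.single l (1 : ℝ))) (hf l (EuclideanSpace.single i (1 : ℝ)))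
    rw [← sub_apply, ← this]
    rfl
  have h2 : ∑ l, multiplier (potential ψ t l)
      (∂_{EuclideanSpace.single i (1 : ℝ)} (smoothDist (component v l))) = 0 := by
    -- ξ_i times the l-th potential symbol is ξ_l times the i-th, which exposes the divergence of v.
    have h3 : ∀ l, multiplier (potential ψ t l)
        (∂_{EuclideanSpace.single i (1 : ℝ)} (smoothDist (component v l))) =
        multiplier (potential ψ t i)
          (∂_{EuclideanSpace.single l (1 : ℝ)} (smoothDist (component v l))) := fun l => by
      rw [multiplier_lineDeriv (hp l), multiplier_lineDeriv (hp i)]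
      congr 2
      ext ξ
      rw [potential, potential]
      push_cast
      ring
    rw [Finset.sum_congr rfl fun l _ => h3 l, ← map_sum]
    simp only [lineDeriv_smoothDist (hv' _)]
    have h4 : ∑ l, smoothDist (fun x => fderiv ℝ (component v l) x
        (EuclideanSpace.single l (1 : ℝ))) = 0 := by
      simp only [smoothDist]
      rw [← sum_apply, ← TemperedDistribution.smulLeftCLM_sum fun l _ => hf l _]
      have h : (fun x => ∑ l : Fin d, fderiv ℝ (component v l) x
          (EuclideanSpace.single l (1 : ℝ))) = fun _ => 0 := by
        ext x
        simp_rw [fderiv_component hv]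
        have := hdiv x
        rw [divergence] at this
        exact_mod_cast this
      rw [h]
      ext g
      simp
    rw [h4, map_zero]
  simp only [h1, map_sub, Finset.sum_sub_distrib]
  rw [h2, sub_zero]
  simp only [multiplier_lineDeriv (hp _)]
  rw [← multiplier_sum]
  · simp only [sum_potential hψ.map_zero]
  · intro l _
    exact ((Function.HasTemperateGrowth.const Complex.I).mul (temperate_coord l)).mul (hp l)

/-! ### Differences of convolutions -/

open FourierTransform in
lemma lineDeriv_kernel {b b' : 𝓢(Space d, ℂ)} (m : Fin d)
    (h : ∀ ξ, b' ξ = Complex.I * (ξ m : ℂ) * b ξ) :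
    ∂_{EuclideanSpace.single m (1 : ℝ)} (kernel b) = kernel b' := by
  rw [kernel, kernel, SchwartzMap.lineDerivOp_fourierInv_eq]
  congr 1
  ext ξ
  have hi : (fun ξ : Space d => inner ℝ ξ (EuclideanSpace.single m (1 : ℝ))).HasTemperateGrowth := by
    fun_prop
  rw [smul_apply, SchwartzMap.smulLeftCLM_apply_apply hi]
  simp only [SchwartzMap.compCLMOfContinuousLinearEquiv_apply, Function.comp_apply, dilation_apply,
    h, EuclideanSpace.inner_single_right]
  simp
  ring

/-- The mean value formula expanded in coordinates, because the kernels of the coordinate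
derivatives are the ones with known bounds. -/
lemma enorm_sub_le_lintegral_lineDeriv (K : 𝓢(Space d, ℂ)) (y z : Space d) :
    ‖K (y - z) - K y‖ₑ ≤ ENNReal.ofReal ‖z‖ * ∑ m : Fin d, ∫⁻ s in Set.Ioc (0 : ℝ) 1,
      ‖(∂_{EuclideanSpace.single m (1 : ℝ)} K : 𝓢(Space d, ℂ)) (y - s • z)‖ₑ := by
  have hK : ContDiff ℝ ∞ K := K.smooth ⊤
  have hd : ∀ s ∈ Set.uIcc (0 : ℝ) 1, HasDerivAt (fun s : ℝ => K (y - s • z))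
      (fderiv ℝ K (y - s • z) (-z)) s := fun s _ => by
    have h2 := (hK.differentiable (by simp) (y - s • z)).hasFDerivAt
    have h3 : HasDerivAt (fun s : ℝ => y - s • z) (-z) s := by
      simpa using ((hasDerivAt_id s).smul_const z).const_sub y
    exact h2.comp_hasDerivAt s h3
  have hc : Continuous fun s : ℝ => fderiv ℝ K (y - s • z) (-z) :=
    ((hK.continuous_fderiv (by simp)).comp (by fun_prop)).clm_apply continuous_const
  have h4 := intervalIntegral.integral_eq_sub_of_hasDerivAt hd (hc.intervalIntegrable _ _)
  simp only [one_smul, zero_smul, sub_zero] at h4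
  rw [← h4, intervalIntegral.integral_of_le zero_le_one, ← lintegral_finsetSum',
    ← lintegral_const_mul' _ _ (by simp)]
  · refine (enorm_integral_le_lintegral_enorm _).trans (lintegral_mono fun s => ?_)
    have h5 : -z = ∑ m, (-(z m)) • EuclideanSpace.single m (1 : ℝ) := by
      ext k
      simp [Finset.sum_apply, Pi.single_apply]
    conv_lhs => rw [h5]
    rw [map_sum, Finset.mul_sum]
    refine (enorm_sum_le _ _).trans (Finset.sum_le_sum fun m _ => ?_)
    rw [map_smul, enorm_smul, SchwartzMap.lineDerivOp_apply_eq_fderiv]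
    gcongr
    rw [← ofReal_norm, norm_neg]
    exact ENNReal.ofReal_le_ofReal (PiLp.norm_apply_le z m)
  · intro m _
    exact (((∂_{EuclideanSpace.single m (1 : ℝ)} K : 𝓢(Space d, ℂ)).continuous.comp
      (by fun_prop : Continuous fun s : ℝ => y - s • z)).enorm).aemeasurable

/-- Lipschitz estimate for convolutions with a localized kernel. -/
lemma enorm_conv_sub_le {t C : ℝ} (ht : 0 < t) (hC : 0 ≤ C) {b : 𝓢(Space d, ℂ)}
    (hb : ∀ m, Localized t C (fun ξ => Complex.I * (ξ m : ℂ) * b ξ)) {q : ℝ≥0∞} (hq : 1 ≤ q)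
    {G : Space d → ℂ} (hG : Continuous G) (hGm : Moderate G) (x z : Space d) :
    ‖conv (kernel b) (fun x => G (x - z) - G x) x‖ₑ ≤ ENNReal.ofReal ‖z‖ * (d *
      (ENNReal.ofReal C * (profConst d * ENNReal.ofReal t ^ ((d : ℝ) / q.toReal) *
        eLpNorm G q volume))) := by
  choose b' hb' hk using hb
  set K := kernel b with hK
  have hKm : ∀ m, ∂_{EuclideanSpace.single m (1 : ℝ)} K = kernel (b' m) := fun m =>
    lineDeriv_kernel m fun ξ => congrFun (hb' m) ξ
  -- A translation of the integration variable moves the difference from G to the kernel, so that G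
  -- needs no regularity.
  have h1 : conv K (fun x => G (x - z) - G x) x = ∫ y, (K (y - z) - K y) * G (x - y) := by
    have i1 := hGm.integrable_conv K x
    have i2 := hGm.integrable_conv K (x - z)
    have i3 : Integrable fun y => K (y - z) * G (x - y) := by
      refine (i2.comp_sub_right z).congr (Eventually.of_forall fun y => ?_)
      simp only
      congr 2
      abel
    have e1 : ∫ y, K (y - z) * G (x - y) = ∫ y, K y * G (x - z - y) := by
      rw [← integral_sub_right_eq_self (fun y => K y * G (x - z - y)) z]
      refine integral_congr_ae (Eventually.of_forall fun y => ?_)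
      simp only
      congr 2
      abel
    simp only [conv, sub_mul, mul_sub]
    rw [integral_sub i3 i1, e1, ← integral_sub i2 i1]
    refine integral_congr_ae (Eventually.of_forall fun y => ?_)
    simp only
    rw [sub_right_comm]
  have h2 : ∀ (m : Fin d) (s : ℝ), ∫⁻ y, ‖kernel (b' m) (y - s • z)‖ₑ * ‖G (x - y)‖ₑ ≤
      ENNReal.ofReal C * (profConst d * ENNReal.ofReal t ^ ((d : ℝ) / q.toReal) *
        eLpNorm G q volume) := fun m s => by
    have e1 : ∫⁻ y, ‖kernel (b' m) (y - s • z)‖ₑ * ‖G (x - y)‖ₑ =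
        ∫⁻ y, ‖kernel (b' m) y‖ₑ * ‖G (x - s • z - y)‖ₑ := by
      rw [← lintegral_sub_right_eq_self (fun y => ‖kernel (b' m) y‖ₑ * ‖G (x - s • z - y)‖ₑ)
        (s • z)]
      refine lintegral_congr fun y => ?_
      congr 3
      abel
    have e2 := (hk m).lintegral_le ht hC le_rfl zero_le_one (fun y => ‖G (x - s • z - y)‖ₑ)
    simp only [Real.rpow_zero, ENNReal.ofReal_one, one_mul, neg_zero, mul_one] at e2
    have e3 := eLpNorm_comp_sub_left_profMeasure_le ht le_rfl hq hG.aestronglyMeasurable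
      (x - s • z)
    rw [eLpNorm_one_eq_lintegral_enorm] at e3
    rw [e1]
    exact e2.trans (by gcongr)
  have hmeas : ∀ m, Measurable fun w : Space d × ℝ =>
      ‖kernel (b' m) (w.1 - w.2 • z)‖ₑ * ‖G (x - w.1)‖ₑ := fun m => by
    have c1 : Continuous fun w : Space d × ℝ => kernel (b' m) (w.1 - w.2 • z) :=
      (kernel (b' m)).continuous.comp (by fun_prop)
    have c2 : Continuous fun w : Space d × ℝ => G (x - w.1) := hG.comp (by fun_prop)
    exact c1.enorm.measurable.mul c2.enorm.measurable
  rw [h1]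
  calc _ ≤ ∫⁻ y, ENNReal.ofReal ‖z‖ * ∑ m, ∫⁻ s in Set.Ioc (0 : ℝ) 1,
        ‖kernel (b' m) (y - s • z)‖ₑ * ‖G (x - y)‖ₑ := by
        refine (enorm_integral_le_lintegral_enorm _).trans (lintegral_mono fun y => ?_)
        rw [enorm_mul]
        have e1 := enorm_sub_le_lintegral_lineDeriv K y z
        simp only [hKm] at e1
        refine (mul_le_mul' e1 le_rfl).trans_eq ?_
        rw [mul_assoc, Finset.sum_mul]
        congr 1
        refine Finset.sum_congr rfl fun m _ => ?_
        rw [lintegral_mul_const' _ _ (by simp)]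
    _ = ENNReal.ofReal ‖z‖ * ∑ m, ∫⁻ y, ∫⁻ s in Set.Ioc (0 : ℝ) 1,
        ‖kernel (b' m) (y - s • z)‖ₑ * ‖G (x - y)‖ₑ := by
        rw [lintegral_const_mul' _ _ (by simp), lintegral_finsetSum']
        exact fun m _ => ((hmeas m).lintegral_prod_right').aemeasurable
    _ = ENNReal.ofReal ‖z‖ * ∑ m, ∫⁻ s in Set.Ioc (0 : ℝ) 1, ∫⁻ y,
        ‖kernel (b' m) (y - s • z)‖ₑ * ‖G (x - y)‖ₑ := by
        congr 1
        refine Finset.sum_congr rfl fun m _ => ?_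
        rw [lintegral_lintegral_swap]
        exact (hmeas m).aemeasurable
    _ ≤ ENNReal.ofReal ‖z‖ * ∑ _m : Fin d, ∫⁻ _s in Set.Ioc (0 : ℝ) 1,
        ENNReal.ofReal C * (profConst d * ENNReal.ofReal t ^ ((d : ℝ) / q.toReal) *
          eLpNorm G q volume) := by
        gcongr with m _ s
        exact h2 m s
    _ = _ := by simp

/-! ### Modulus of continuity of a vector field with bounded vorticity -/

/-- The increment `v (· - z) - v` of a vector field. -/
def increment (v : Space d → Space d) (z x : Space d) : Space d := v (x - z) - v x

lemma temperate_increment {v : Space d → Space d} (hv : v.HasTemperateGrowth) (z : Space d) :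
    (increment v z).HasTemperateGrowth := by
  have h : (fun x : Space d => x - z).HasTemperateGrowth := by fun_prop
  exact (hv.comp h).sub hv

lemma fderiv_increment {v : Space d → Space d} (hv : v.HasTemperateGrowth) (z x : Space d) :
    fderiv ℝ (increment v z) x = fderiv ℝ v (x - z) - fderiv ℝ v x := by
  have h := hv.1.differentiable (by simp)
  have h1 : DifferentiableAt ℝ (fun x => v (x - z)) x := by
    exact (h (x - z)).comp x (by fun_prop)
  have h2 := fderiv_fun_sub h1 (h x)
  rw [fderiv_comp_sub] at h2
  exact h2

lemma component_increment (v : Space d → Space d) (z : Space d) (i : Fin d) (x : Space d) :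
    component (increment v z) i x = component v i (x - z) - component v i x := by
  simp [component, increment]

lemma divergence_increment {v : Space d → Space d} (hv : v.HasTemperateGrowth)
    (hdiv : ∀ x, divergence v x = 0) (z x : Space d) : divergence (increment v z) x = 0 := by
  have h1 := hdiv (x - z)
  have h2 := hdiv x
  simp only [divergence] at *
  simp only [fderiv_increment hv, sub_apply, PiLp.sub_apply, Finset.sum_sub_distrib, h1, h2,
    sub_zero]

lemma vortComp_increment {v : Space d → Space d} (hv : v.HasTemperateGrowth) (z : Space d)
    (i l : Fin d) (x : Space d) :
    vortComp (increment v z) i l x = vortComp v i l (x - z) - vortComp v i l x := by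
  simp only [vortComp, fderiv_component (temperate_increment hv z), fderiv_component hv,
    fderiv_increment hv, sub_apply, PiLp.sub_apply]
  push_cast
  ring

lemma eLpNorm_vortComp_le {v : Space d → Space d} (hv : v.HasTemperateGrowth) (i l : Fin d)
    (q : ℝ≥0∞) : eLpNorm (vortComp v i l) q volume ≤ eLpNorm (vorticity v) q volume :=
  eLpNorm_mono_enorm (enorm_vortComp_le hv i l)

lemma moderate_of_temperate {f : Space d → ℂ} (hf : f.HasTemperateGrowth) : Moderate f :=
  (represents_smoothDist hf).1

/-- The field v itself may grow, but its increments are in L^ρ by the segment mean. This rules out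
polynomial parts when an increment is rebuilt from its dyadic blocks. -/
lemma lpNorm_smoothDist_increment_ne_top {v : Space d → Space d} (hv : v.HasTemperateGrowth)
    {ρ : ℝ≥0∞} (hρ : 1 ≤ ρ) (hρt : ρ ≠ ⊤) (h : MemLp (fderiv ℝ v) ρ volume) (i : Fin d)
    (z : Space d) : lpNorm ρ (smoothDist (component (increment v z) i)) ≠ ⊤ := by
  have hρ0 : ρ ≠ 0 := (zero_lt_one.trans_le hρ).ne'
  have hρ1 : 1 ≤ ρ.toReal := by
    have := (ENNReal.toReal_le_toReal ENNReal.one_ne_top hρt).2 hρ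
    simpa using this
  have hρp : 0 < ρ.toReal := by linarith
  have hr := represents_smoothDist (temperate_component (temperate_increment hv z) i)
  refine ((hr.lpNorm_le ρ).trans_lt ?_).ne
  rw [eLpNorm_lt_top_iff_lintegral_rpow_enorm_lt_top hρ0 hρt]
  have h2 := (eLpNorm_lt_top_iff_lintegral_rpow_enorm_lt_top hρ0 hρt).1 h.2
  calc _ ≤ ∫⁻ x, ENNReal.ofReal ‖z‖ ^ ρ.toReal * segmentMean v x z ^ ρ.toReal := by
        refine lintegral_mono fun x => ?_
        rw [← ENNReal.mul_rpow_of_nonneg _ _ hρp.le, component_increment]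
        exact ENNReal.rpow_le_rpow (enorm_component_sub_le_segmentMean hv.1 i x z) hρp.le
    _ = ENNReal.ofReal ‖z‖ ^ ρ.toReal * ∫⁻ x, segmentMean v x z ^ ρ.toReal :=
        lintegral_const_mul' _ _ (by finiteness)
    _ < ⊤ := ENNReal.mul_lt_top (by finiteness)
        ((lintegral_segmentMean_rpow_le hv.1 hρ1 z).trans_lt h2)

/-- A dyadic block of the increment is controlled by the vorticity. -/
lemma Annular.exists_lpNorm_top_increment_le {ψ : Space d → ℂ} (hψ : Annular ψ) :
    ∃ K : ℝ≥0∞, K ≠ ⊤ ∧ ∀ v : Space d → Space d, v.HasTemperateGrowth →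
      (∀ x, divergence v x = 0) → eLpNorm (vorticity v) ⊤ volume ≠ ⊤ →
      ∀ (i : Fin d) (z : Space d) (t : ℝ), 0 < t →
      (lpNorm ⊤ (multiplier (fun ξ => ψ (t⁻¹ • ξ)) (smoothDist (component (increment v z) i))) ≤
        K * (ENNReal.ofReal t⁻¹ * eLpNorm (vorticity v) ⊤ volume)) ∧
      ∀ q : ℝ≥0∞, 1 ≤ q →
      lpNorm ⊤ (multiplier (fun ξ => ψ (t⁻¹ • ξ)) (smoothDist (component (increment v z) i))) ≤
        K * (ENNReal.ofReal ‖z‖ *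
          (ENNReal.ofReal t ^ ((d : ℝ) / q.toReal) * eLpNorm (vorticity v) q volume)) := by
  obtain ⟨C, hC, h⟩ := hψ.exists_symbolBound_potential
  have hκt : profConst d ≠ ⊤ := profConst_ne_top
  have hdt : (d : ℝ≥0∞) ≠ ⊤ := ENNReal.natCast_ne_top d
  refine ⟨d * (ENNReal.ofReal C * (profConst d ^ 2 * 2)) +
    d * (d * (ENNReal.ofReal C * profConst d)), by finiteness,
    fun v hv hdiv hω i z t ht => ?_⟩
  have htC : 0 ≤ C * t⁻¹ := by positivity
  have hvz := temperate_increment hv z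
  rw [multiplier_component_eq_sum hvz (divergence_increment hv hdiv z) hψ ht i]
  have hrep : ∀ l, Represents (fun x => vortComp v i l (x - z) - vortComp v i l x)
      (smoothDist (vortComp (increment v z) i l)) := fun l => by
    have := represents_smoothDist (temperate_vortComp hvz i l)
    simpa only [funext (vortComp_increment hv z i l)] using this
  constructor
  -- First bound: the increment of the vorticity is at most twice its supremum and the potential
  -- gains t⁻¹.
  · refine (lpNorm_sum_le le_top _ _).trans ?_
    calc _ ≤ ∑ _l : Fin d, ENNReal.ofReal (C * t⁻¹) *
          (profConst d ^ 2 * (2 * eLpNorm (vorticity v) ⊤ volume)) := by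
          refine Finset.sum_le_sum fun l _ => ?_
          have h1 : lpNorm ⊤ (smoothDist (vortComp (increment v z) i l)) ≤
              2 * eLpNorm (vorticity v) ⊤ volume := by
            have hc := (temperate_vortComp hv i l).1.continuous
            have hc' : Continuous fun x : Space d => x - z := by fun_prop
            have hm : AEStronglyMeasurable (fun x => vortComp v i l (x - z)) volume :=
              (hc.comp hc').aestronglyMeasurable
            refine ((hrep l).lpNorm_le ⊤).trans
              ((eLpNorm_sub_le hm hc.aestronglyMeasurable le_top).trans ?_)
            have e1 := eLpNorm_comp_measurePreserving (p := ⊤) hc.aestronglyMeasurable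
              (measurePreserving_sub_right (volume : Measure (Space d)) z)
            rw [Function.comp_def] at e1
            rw [e1, two_mul]
            exact add_le_add (eLpNorm_vortComp_le hv i l ⊤) (eLpNorm_vortComp_le hv i l ⊤)
          refine ((h t l ht).base.lpNorm_le ht htC le_top
            (h1.trans_lt (ENNReal.mul_lt_top (by simp) hω.lt_top)).ne).trans ?_
          gcongr
      _ = d * (ENNReal.ofReal C * (profConst d ^ 2 * 2)) *
          (ENNReal.ofReal t⁻¹ * eLpNorm (vorticity v) ⊤ volume) := by
          rw [Finset.sum_const, Finset.card_univ, Fintype.card_fin, nsmul_eq_mul,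
            ENNReal.ofReal_mul hC]
          ring
      _ ≤ _ := mul_le_mul' le_self_add le_rfl
  -- Second bound: the increment is moved to the kernel of the potential. Its derivative costs t and
  -- cancels the gain t⁻¹, leaving ‖z‖ and the Bernstein factor t^{d/q}.
  · intro q hq
    refine (lpNorm_sum_le le_top _ _).trans ?_
    calc _ ≤ ∑ _l : Fin d, ENNReal.ofReal ‖z‖ * (d * (ENNReal.ofReal C *
          (profConst d * ENNReal.ofReal t ^ ((d : ℝ) / q.toReal) *
            eLpNorm (vorticity v) q volume))) := by
          refine Finset.sum_le_sum fun l _ => ?_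
          obtain ⟨b, hb, -⟩ := (h t l ht).base
          have hcoord : ∀ m, Localized t C (fun ξ => Complex.I * (ξ m : ℂ) * b ξ) := fun m => by
            have := (h t l ht).coord m
            rw [inv_mul_cancel_right₀ ht.ne'] at this
            simpa only [hb] using this
          have hV := temperate_vortComp hv i l
          rw [← hb]
          refine (((hrep l).multiplier b).lpNorm_le ⊤).trans ?_
          rw [eLpNorm_exponent_top]
          refine essSup_le_of_ae_le _ (Eventually.of_forall fun x => ?_)
          refine (enorm_conv_sub_le ht hC hcoord hq hV.1.continuous (moderate_of_temperate hV)
            x z).trans ?_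
          exact mul_le_mul' le_rfl (mul_le_mul' le_rfl (mul_le_mul' le_rfl (mul_le_mul' le_rfl
            (eLpNorm_vortComp_le hv i l q))))
      _ = d * (d * (ENNReal.ofReal C * profConst d)) * (ENNReal.ofReal ‖z‖ *
          (ENNReal.ofReal t ^ ((d : ℝ) / q.toReal) * eLpNorm (vorticity v) q volume)) := by
          rw [Finset.sum_const, Finset.card_univ, Fintype.card_fin, nsmul_eq_mul]
          ring
      _ ≤ _ := mul_le_mul' le_add_self le_rfl

/-- The remainder at frequency 2^{-N} tends to zero in L^∞ by Bernstein's inequality, since u is in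
L^ρ with ρ < ∞; no mass is left at frequency zero. -/
lemma lpNorm_top_low_le [NeZero d] (P : LittlewoodPaley d) {ρ : ℝ≥0∞} (hρ : 1 ≤ ρ)
    (hρt : ρ ≠ ⊤) {u : 𝓢'(Space d, ℂ)} (hu : lpNorm ρ u ≠ ⊤) :
    lpNorm ⊤ (multiplier P.low u) ≤
      ∑' n : ℕ, lpNorm ⊤ (multiplier (fun ξ => P.ring ((2 : ℝ) ^ n • ξ)) u) := by
  obtain ⟨C, hC, h⟩ := exists_symbolBound_dilation P.low_contDiff P.low_compact
  have hκt : profConst d ≠ ⊤ := profConst_ne_top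
  refine lpNorm_le_tsum le_top fun g => ?_
  have h1 : ∀ N : ℕ, lpNorm ⊤ (multiplier (fun ξ => P.low ((2 : ℝ) ^ N • ξ)) u) ≤
      ENNReal.ofReal C * (profConst d * ENNReal.ofReal ((2 ^ N)⁻¹) ^ ((d : ℝ) / ρ.toReal) *
        lpNorm ρ u) := fun N => by
    have := (h ((2 ^ N)⁻¹) (by positivity)).base.lpNorm_top_le (by positivity) hC hρ hu
    simpa only [inv_inv] using this
  have h2 : ∀ N, (∑ n ∈ Finset.range N, multiplier (fun ξ => P.ring ((2 : ℝ) ^ n • ξ)) u) =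
      multiplier P.low u - multiplier (fun ξ => P.low ((2 : ℝ) ^ N • ξ)) u := fun N => by
    rw [← multiplier_sum _ fun n _ => temperate_dilation P.temperate_ring _]
    simp only [P.sum_ring]
    have h3 := multiplier_add
      (a := fun ξ => P.low ξ - P.low ((2 : ℝ) ^ N • ξ))
      ((P.temperate_low).sub (temperate_dilation P.temperate_low ((2 : ℝ) ^ N)))
      (temperate_dilation P.temperate_low ((2 : ℝ) ^ N)) u
    rw [eq_sub_iff_add_eq, ← h3]
    congr 2
    ext ξ
    simp
  simp only [h2]
  have h4 : Tendsto (fun N : ℕ => multiplier (fun ξ => P.low ((2 : ℝ) ^ N • ξ)) u g) atTop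
      (𝓝 0) := by
    rw [tendsto_zero_iff_enorm_tendsto_zero]
    have h5 : Tendsto (fun N : ℕ => eLpNorm g (ENNReal.conjExponent ⊤) volume *
        (ENNReal.ofReal C * (profConst d * ENNReal.ofReal ((2 ^ N)⁻¹) ^ ((d : ℝ) / ρ.toReal) *
          lpNorm ρ u))) atTop (𝓝 0) := by
      have hG : eLpNorm g (ENNReal.conjExponent ⊤) volume ≠ ⊤ :=
        (g.memLp (ENNReal.conjExponent ⊤) volume).2.ne
      refine ENNReal.tendsto_atTop_zero_of_tsum_ne_top ?_
      simp only [ENNReal.tsum_mul_left, ENNReal.tsum_mul_right]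
      have := tsum_low_ne_top (d := d) hρ hρt
      finiteness
    refine tendsto_of_tendsto_of_tendsto_of_le_of_le tendsto_const_nhds h5 (fun _ => zero_le)
      fun N => ?_
    refine (enorm_apply_le_lpNorm le_top _ ((h1 N).trans_lt ?_).ne g).trans
      (mul_le_mul' le_rfl (h1 N))
    finiteness
  have := (tendsto_const_nhds (x := multiplier P.low u g)).sub h4
  rw [sub_zero] at this
  exact this

lemma le_rpow_mul_rpow_of_le {x a b : ℝ≥0∞} (ha : x ≤ a) (hb : x ≤ b) {c : ℝ} (hc0 : 0 ≤ c)
    (hc1 : c ≤ 1) : x ≤ a ^ (1 - c) * b ^ c := by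
  calc x = x ^ (1 - c) * x ^ c := by
        rw [← ENNReal.rpow_add_of_nonneg _ _ (by linarith) hc0]; simp
    _ ≤ _ := mul_le_mul' (ENNReal.rpow_le_rpow ha (by linarith)) (ENNReal.rpow_le_rpow hb hc0)

/-- A divergence free vector field with vorticity in `L^ρ ∩ L^∞` is Hölder continuous with any
exponent `c < 1` at small scales. -/
lemma exists_enorm_component_sub_le [NeZero d] (P : LittlewoodPaley d) {ρ : ℝ≥0∞} (hρ : 1 ≤ ρ)
    (hρt : ρ ≠ ⊤) {c : ℝ} (hc0 : 0 ≤ c) (hc1 : c < 1) :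
    ∃ K : ℝ≥0∞, K ≠ ⊤ ∧ ∀ v : Space d → Space d, v.HasTemperateGrowth →
      (∀ x, divergence v x = 0) → MemLp (fderiv ℝ v) ρ volume →
      eLpNorm (vorticity v) ⊤ volume ≠ ⊤ → ∀ (i : Fin d) (x z : Space d),
      ‖component v i (x - z) - component v i x‖ₑ ≤
        K * (eLpNorm (vorticity v) ⊤ volume + eLpNorm (vorticity v) ρ volume) *
          (ENNReal.ofReal (‖z‖ ^ (1 : ℝ)) + ENNReal.ofReal (‖z‖ ^ c)) := by
  obtain ⟨K, hK, h⟩ := P.annular_ring.exists_lpNorm_top_increment_le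
  set S : ℝ≥0∞ := ∑' n : ℕ, ENNReal.ofReal ((2 ^ n)⁻¹) ^ ((d : ℝ) / ρ.toReal) with hS
  have hSt : S ≠ ⊤ := tsum_low_ne_top hρ hρt
  set S' : ℝ≥0∞ := ∑' n : ℕ, (2⁻¹ ^ (1 - c)) ^ n with hS'
  have hSt' : S' ≠ ⊤ := by
    rw [hS', ENNReal.tsum_geometric]
    refine ENNReal.inv_ne_top.2 (tsub_pos_of_lt ?_).ne'
    exact ENNReal.rpow_lt_one (by simp) (by linarith)
  refine ⟨K * S + K * S', by finiteness, fun v hv hdiv hmem hω i x z => ?_⟩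
  set W := eLpNorm (vorticity v) ⊤ volume
  set W' := eLpNorm (vorticity v) ρ volume
  set u := smoothDist (component (increment v z) i) with hu
  have hut : lpNorm ρ u ≠ ⊤ := lpNorm_smoothDist_increment_ne_top hv hρ hρt hmem i z
  have hb := h v hv hdiv hω i z
  -- Low frequencies use the second bound with q = ρ, which is summable and Lipschitz in z.
  have hlow : lpNorm ⊤ (multiplier P.low u) ≤ K * S * W' * ENNReal.ofReal ‖z‖ := by
    refine (lpNorm_top_low_le P hρ hρt hut).trans ?_
    calc _ ≤ ∑' n : ℕ, K * (ENNReal.ofReal ‖z‖ *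
          (ENNReal.ofReal ((2 ^ n)⁻¹) ^ ((d : ℝ) / ρ.toReal) * W')) := by
          refine ENNReal.tsum_le_tsum fun n => ?_
          have := (hb ((2 ^ n)⁻¹) (by positivity)).2 ρ hρ
          simpa only [inv_inv] using this
      _ = _ := by
          simp only [ENNReal.tsum_mul_left, ENNReal.tsum_mul_right]
          ring
  -- High frequencies: geometric interpolation between 2^{-n}‖ω‖_∞ and ‖z‖‖ω‖_∞ gives ‖z‖^c
  -- 2^{-n(1−c)}, summable because c < 1.
  have hhigh : ∀ n : ℕ, n ≠ 0 → lpNorm ⊤ (multiplier (P.sym n) u) ≤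
      K * W * ENNReal.ofReal (‖z‖ ^ c) * (2⁻¹ ^ (1 - c)) ^ n := fun n hn => by
    rw [P.sym_of_ne hn]
    have h1 := (hb (2 ^ n) (by positivity)).1
    have h2 := (hb (2 ^ n) (by positivity)).2 ⊤ le_top
    rw [ofReal_two_pow_inv] at h1
    simp only [ENNReal.toReal_top, div_zero, ENNReal.rpow_zero, one_mul] at h2
    refine (le_rpow_mul_rpow_of_le h1 h2 hc0 hc1.le).trans_eq ?_
    have e1 : ∀ y : ℝ≥0∞, y ^ (1 - c) * y ^ c = y := fun y => by
      rw [← ENNReal.rpow_add_of_nonneg _ _ (by linarith) hc0]; simp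
    have e2 : ((2 : ℝ≥0∞)⁻¹ ^ n) ^ (1 - c) = (2⁻¹ ^ (1 - c)) ^ n := by
      rw [← ENNReal.rpow_natCast, ← ENNReal.rpow_mul, mul_comm, ENNReal.rpow_mul,
        ENNReal.rpow_natCast]
    rw [ENNReal.mul_rpow_of_nonneg _ _ (by linarith), ENNReal.mul_rpow_of_nonneg _ _ (by linarith),
      ENNReal.mul_rpow_of_nonneg _ _ hc0, ENNReal.mul_rpow_of_nonneg _ _ hc0, e2,
      ENNReal.ofReal_rpow_of_nonneg (norm_nonneg z) hc0]
    calc _ = (K ^ (1 - c) * K ^ c) * (W ^ (1 - c) * W ^ c) * ENNReal.ofReal (‖z‖ ^ c) *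
          (2⁻¹ ^ (1 - c)) ^ n := by ring
      _ = _ := by rw [e1, e1]
  have htot : lpNorm ⊤ u ≤ K * S * W' * ENNReal.ofReal ‖z‖ +
      K * W * ENNReal.ofReal (‖z‖ ^ c) * S' := by
    refine (lpNorm_le_tsum le_top fun g => tendsto_sum_block P u g).trans ?_
    rw [tsum_eq_zero_add' ENNReal.summable, P.sym_zero]
    refine add_le_add hlow ?_
    rw [hS', ← ENNReal.tsum_mul_left]
    calc _ ≤ ∑' n : ℕ, K * W * ENNReal.ofReal (‖z‖ ^ c) * (2⁻¹ ^ (1 - c)) ^ (n + 1) :=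
          ENNReal.tsum_le_tsum fun n => hhigh (n + 1) (Nat.succ_ne_zero n)
      _ ≤ _ := ENNReal.tsum_comp_le_tsum_of_injective (add_left_injective 1)
          fun n => K * W * ENNReal.ofReal (‖z‖ ^ c) * (2⁻¹ ^ (1 - c)) ^ n
  have hr := represents_smoothDist (temperate_component (temperate_increment hv z) i)
  have hc := (temperate_component (temperate_increment hv z) i).1.continuous
  have hae : ∀ᵐ y, ‖component (increment v z) i y‖ₑ ≤ lpNorm ⊤ u := by
    rw [hu, hr.lpNorm_eq le_top, eLpNorm_exponent_top]
    exact ae_le_eLpNormEssSup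
  -- An almost everywhere bound holds everywhere by continuity of v.
  have hall : ‖component (increment v z) i x‖ₑ ≤ lpNorm ⊤ u := by
    have h1 : IsClosed {y | ‖component (increment v z) i y‖ₑ ≤ lpNorm ⊤ u} :=
      isClosed_le hc.enorm continuous_const
    have h2 := (Measure.dense_of_ae hae).closure_eq
    rw [h1.closure_eq] at h2
    exact h2.symm.subset (Set.mem_univ x)
  rw [← component_increment]
  refine hall.trans (htot.trans ?_)
  rw [Real.rpow_one]
  calc _ ≤ (K * S + K * S') * (W + W') * ENNReal.ofReal ‖z‖ +
        (K * S + K * S') * (W + W') * ENNReal.ofReal (‖z‖ ^ c) := by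
        refine add_le_add ?_ ?_
        · exact mul_le_mul' (mul_le_mul' le_self_add le_add_self) le_rfl
        · calc _ = K * S' * W * ENNReal.ofReal (‖z‖ ^ c) := by ring
            _ ≤ _ := mul_le_mul' (mul_le_mul' le_add_self le_self_add) le_rfl
    _ = _ := by ring

/-! ### Commutator estimates in `L^∞` -/

lemma Localized.lpNorm_top_comm_le {t C : ℝ} {a : Space d → ℂ} (h : Localized t C a) (ht : 0 < t)
    (hC : 0 ≤ C) {q : ℝ≥0∞} (hq : 1 ≤ q)
    {v : Space d → Space d} (hv : v.HasTemperateGrowth) (i : Fin d) {Λ : ℝ≥0∞} {c : ℝ}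
    (hc0 : 0 ≤ c) (hc1 : c ≤ 1)
    (hΛ : ∀ x z, ‖component v i (x - z) - component v i x‖ₑ ≤
      Λ * (ENNReal.ofReal (‖z‖ ^ (1 : ℝ)) + ENNReal.ofReal (‖z‖ ^ c)))
    {T : 𝓢'(Space d, ℂ)} (hT : lpNorm q T ≠ ⊤) :
    lpNorm ⊤ (comm a (component v i) T) ≤
      ENNReal.ofReal C * (ENNReal.ofReal (t ^ (-1 : ℝ)) + ENNReal.ofReal (t ^ (-c))) *
      (profConst d * ENNReal.ofReal t ^ ((d : ℝ) / q.toReal) * lpNorm q T) * Λ := by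
  obtain ⟨b, rfl, hb⟩ := h
  have := LogRiesz.lpNorm_top_comm_le hb ht hC hq hv i hc0 hc1 hΛ hT
  rwa [ENNReal.ofReal_mul hC, ENNReal.ofReal_mul hC, ← mul_add] at this

/-- The weight `2 ^ (n δ - (n - j)⁺)`. -/
def driftDist (δ : ℝ) (n j : ℕ) : ℝ≥0∞ := ENNReal.ofReal ((2 ^ n) ^ δ) * 2⁻¹ ^ (n - j)

lemma ofReal_rpow_add_le {δ : ℝ} (hδ : 0 ≤ δ) (n : ℕ) :
    ENNReal.ofReal (((2 : ℝ) ^ n) ^ (-1 : ℝ)) + ENNReal.ofReal (((2 : ℝ) ^ n) ^ (-(1 - δ))) ≤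
      2 * (ENNReal.ofReal ((2 ^ n) ^ δ) * 2⁻¹ ^ n) := by
  have h2 : (1 : ℝ) ≤ 2 ^ n := one_le_pow₀ one_le_two
  have h1 : ((2 : ℝ) ^ n) ^ (-(1 - δ)) = (2 ^ n) ^ δ * (2 ^ n)⁻¹ := by
    rw [neg_sub, sub_eq_add_neg, Real.rpow_add (by positivity), Real.rpow_neg_one]
  rw [h1, ENNReal.ofReal_mul (by positivity), ofReal_two_pow_inv, Real.rpow_neg_one,
    ofReal_two_pow_inv, two_mul]
  refine add_le_add (le_mul_of_one_le_left zero_le ?_) le_rfl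
  rw [ENNReal.one_le_ofReal]
  exact Real.one_le_rpow h2 hδ

/-- With the Hölder exponent 1 − δ a commutator at frequency 2^n gains only 2^{-n(1−δ)}. For j ≤ n
the derivative costs 2^j. For j > n it is put on the symbol and costs 2^n, which leaves 2^{nδ} with
no decay in j; no further integration by parts is made, since ∇v is not bounded. -/
lemma exists_commBound_top [NeZero d] (P : LittlewoodPaley d) {ρ : ℝ≥0∞} (hρ : 1 ≤ ρ)
    (hρt : ρ ≠ ⊤) {δ : ℝ} (hδ : 0 < δ) (hδ1 : δ ≤ 1) :
    ∃ K : ℝ≥0∞, K ≠ ⊤ ∧ ∀ v : Space d → Space d, v.HasTemperateGrowth →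
      (∀ x, divergence v x = 0) → MemLp (fderiv ℝ v) ρ volume →
      eLpNorm (vorticity v) ⊤ volume ≠ ⊤ →
      CommBound P v ⊤ ρ K (eLpNorm (vorticity v) ⊤ volume + eLpNorm (vorticity v) ρ volume)
        (driftDist δ) := by
  obtain ⟨C₁, hC₁, h₁⟩ := lpNorm_top_lineDeriv_block_le P
  obtain ⟨H, hH, hHol⟩ := exists_enorm_component_sub_le P hρ hρt (c := 1 - δ) (by linarith)
    (by linarith)
  have hκt : profConst d ≠ ⊤ := profConst_ne_top
  have hdt : (d : ℝ≥0∞) ≠ ⊤ := ENNReal.natCast_ne_top d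
  refine ⟨d * (2 * (profConst d * H)) + d * (2 * (profConst d * C₁ * H)), by finiteness,
    fun v hv hdiv hG hω => ?_⟩
  set Λ := eLpNorm (vorticity v) ⊤ volume + eLpNorm (vorticity v) ρ volume
  have hΛ := hHol v hv hdiv hG hω
  have hexp : ∀ t : ℝ, ENNReal.ofReal t ^ ((d : ℝ) / (⊤ : ℝ≥0∞).toReal) = 1 := by simp
  have hc0 : 0 ≤ 1 - δ := by linarith
  have hc1 : 1 - δ ≤ 1 := by linarith
  constructor
  · intro n C a T hC ha hT
    rw [advComm_eq_sum_comm hv hdiv ha.base.temperate]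
    refine (lpNorm_sum_le le_top _ _).trans ?_
    set t : ℝ := (2 ^ n)⁻¹ with ht'
    have ht : 0 < t := by positivity
    have ht1 : t ≤ 1 := inv_le_one_of_one_le₀ (one_le_pow₀ one_le_two)
    -- At low frequency t ≤ 1 the Lipschitz term of the modulus is the larger one, so the factor t
    -- from the symbol cancels it without loss.
    have hE : ENNReal.ofReal (C * t) *
        (ENNReal.ofReal (t ^ (-1 : ℝ)) + ENNReal.ofReal (t ^ (-(1 - δ)))) ≤
          ENNReal.ofReal C * 2 := by
      rw [ENNReal.ofReal_mul hC, mul_assoc, mul_add, ← ENNReal.ofReal_mul ht.le,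
        ← ENNReal.ofReal_mul ht.le, Real.rpow_neg_one, mul_inv_cancel₀ ht.ne']
      have e1 : t * t ^ (-(1 - δ)) ≤ 1 := by
        rw [← Real.rpow_one_add' ht.le (by linarith)]
        exact Real.rpow_le_one ht.le ht1 (by linarith)
      have e2 := ENNReal.ofReal_le_ofReal e1
      rw [ENNReal.ofReal_one] at *
      calc _ ≤ ENNReal.ofReal C * (1 + 1) := by gcongr
        _ = _ := by rw [one_add_one_eq_two]
    calc _ ≤ ∑ _i : Fin d, ENNReal.ofReal C * 2 *
          (profConst d * ENNReal.ofReal t ^ ((d : ℝ) / ρ.toReal) * lpNorm ρ T) * (H * Λ) := by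
          refine Finset.sum_le_sum fun i _ => ?_
          refine ((ha.coord i).lpNorm_top_comm_le ht (by positivity) hρ hv i hc0 hc1 (hΛ i)
            hT).trans ?_
          exact mul_le_mul' (mul_le_mul' hE le_rfl) le_rfl
      _ = ENNReal.ofReal C * (d * (2 * (profConst d * H)) * Λ *
          ENNReal.ofReal t ^ ((d : ℝ) / ρ.toReal) * lpNorm ρ T) := by
          rw [Finset.sum_const, Finset.card_univ, Fintype.card_fin, nsmul_eq_mul]; ring
      _ ≤ _ := by
          gcongr
          exact le_self_add
  · intro n j C a U hC ha hT
    have ht : (0 : ℝ) < 2 ^ n := by positivity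
    set N := lpNorm ⊤ (multiplier (P.sym j) U)
    have hE := ofReal_rpow_add_le hδ.le n
    set D := ENNReal.ofReal (((2 : ℝ) ^ n) ^ δ) with hD
    rcases le_or_gt j n with hj | hj
    · rw [advComm_eq_sum_comm_lineDeriv v ha.base.temperate]
      refine (lpNorm_sum_le le_top _ _).trans ?_
      calc _ ≤ ∑ _i : Fin d, ENNReal.ofReal C * (2 * (D * 2⁻¹ ^ n)) *
            (profConst d * (C₁ * 2 ^ j * N)) * (H * Λ) := by
            refine Finset.sum_le_sum fun i _ => ?_
            have hle := h₁ j i U hT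
            have := ha.base.lpNorm_top_comm_le ht hC le_top hv i hc0 hc1 (hΛ i)
              (hle.trans_lt (by finiteness)).ne
            rw [hexp, mul_one] at this
            refine this.trans ?_
            gcongr
        _ = ENNReal.ofReal C * (d * (2 * (profConst d * C₁ * H)) * Λ *
              (D * (2⁻¹ ^ n * 2 ^ j) * N)) := by
            rw [Finset.sum_const, Finset.card_univ, Fintype.card_fin, nsmul_eq_mul]; ring
        _ ≤ _ := by
            rw [two_inv_pow_mul_two_pow_of_le hj, driftDist]
            exact mul_le_mul' le_rfl (mul_le_mul' (mul_le_mul' le_add_self le_rfl) le_rfl)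
    · rw [advComm_eq_sum_comm hv hdiv ha.base.temperate]
      refine (lpNorm_sum_le le_top _ _).trans ?_
      calc _ ≤ ∑ _i : Fin d, ENNReal.ofReal C * 2 ^ n * (2 * (D * 2⁻¹ ^ n)) *
            (profConst d * N) * (H * Λ) := by
            refine Finset.sum_le_sum fun i _ => ?_
            have := (ha.coord i).lpNorm_top_comm_le ht (by positivity) le_top hv i hc0 hc1 (hΛ i)
              hT
            rw [hexp, mul_one, ENNReal.ofReal_mul hC, ofReal_two_pow] at this
            refine this.trans ?_
            gcongr
        _ = ENNReal.ofReal C * (d * (2 * (profConst d * H)) * Λ *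
              (D * (2⁻¹ ^ n * 2 ^ n) * N)) := by
            rw [Finset.sum_const, Finset.card_univ, Fintype.card_fin, nsmul_eq_mul]; ring
        _ ≤ _ := by
            rw [two_inv_pow_mul_two_pow, driftDist, Nat.sub_eq_zero_of_le hj.le, pow_zero]
            exact mul_le_mul' le_rfl (mul_le_mul' (mul_le_mul' le_self_add le_rfl) le_rfl)

/-! ### Young's inequality for sequences -/

/-- Jensen's inequality for the measure with weights k, of total mass ∑ k_j. -/
lemma tsum_mul_rpow_le (k y : ℕ → ℝ≥0∞) {r : ℝ} (hr : 1 ≤ r) :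
    (∑' j, k j * y j) ^ r ≤ (∑' j, k j) ^ (r - 1) * ∑' j, k j * y j ^ r := by
  have hr0 : 0 < r := by linarith
  set μ : Measure ℕ := Measure.count.withDensity k
  have hint : ∀ f : ℕ → ℝ≥0∞, ∫⁻ j, f j ∂μ = ∑' j, k j * f j := fun f => by
    rw [lintegral_withDensity_eq_lintegral_mul _ .of_discrete .of_discrete, lintegral_count]
    rfl
  have huniv : μ Set.univ = ∑' j, k j := by
    rw [← lintegral_one, hint]; simp
  have h := eLpNorm'_le_eLpNorm'_mul_rpow_measure_univ (μ := μ) (f := y) one_pos hr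
    (Measurable.of_discrete).aestronglyMeasurable
  simp only [eLpNorm', enorm_eq_self, ENNReal.rpow_one, div_one] at h
  rw [hint, hint, huniv] at h
  refine (ENNReal.rpow_le_rpow h hr0.le).trans_eq ?_
  rw [ENNReal.mul_rpow_of_nonneg _ _ hr0.le, ← ENNReal.rpow_mul, ← ENNReal.rpow_mul,
    one_div, inv_mul_cancel₀ hr0.ne', ENNReal.rpow_one, sub_mul, one_mul,
    inv_mul_cancel₀ hr0.ne', mul_comm]

/-- Schur's test: Jensen uses the row sums and, after exchanging the sums, the column sums appear.
The case r = ∞ needs only the rows. -/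
lemma eLpNorm_tsum_mul_le {k : ℕ → ℕ → ℝ≥0∞} {M : ℝ≥0∞} (hM0 : M ≠ 0) (hM : M ≠ ⊤)
    (hrow : ∀ n, ∑' j, k n j ≤ M) (hcol : ∀ j, ∑' n, k n j ≤ M) {r : ℝ≥0∞} (hr : 1 ≤ r)
    (y : ℕ → ℝ≥0∞) :
    eLpNorm (fun n => ∑' j, k n j * y j) r Measure.count ≤ M * eLpNorm y r Measure.count := by
  rcases eq_or_ne r ⊤ with rfl | hrt
  · simp only [eLpNorm_exponent_top, eLpNormEssSup_count, enorm_eq_self]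
    refine iSup_le fun n => ?_
    calc _ ≤ ∑' j, k n j * ⨆ a, y a := ENNReal.tsum_le_tsum fun j => by
          gcongr; exact le_iSup y j
      _ ≤ _ := by rw [ENNReal.tsum_mul_right]; gcongr; exact hrow n
  have hr1 : 1 ≤ r.toReal := by
    simpa using (ENNReal.toReal_le_toReal ENNReal.one_ne_top hrt).2 hr
  have hr0 : 0 < r.toReal := by linarith
  have hrne : r ≠ 0 := (zero_lt_one.trans_le hr).ne'
  rw [eLpNorm_eq_lintegral_rpow_enorm_toReal hrne hrt,
    eLpNorm_eq_lintegral_rpow_enorm_toReal hrne hrt, one_div, lintegral_count, lintegral_count]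
  simp only [enorm_eq_self]
  rw [ENNReal.rpow_inv_le_iff hr0, ENNReal.mul_rpow_of_nonneg _ _ hr0.le, ← ENNReal.rpow_mul,
    inv_mul_cancel₀ hr0.ne', ENNReal.rpow_one]
  calc _ ≤ ∑' n, M ^ (r.toReal - 1) * ∑' j, k n j * y j ^ r.toReal := by
        refine ENNReal.tsum_le_tsum fun n => (tsum_mul_rpow_le _ _ hr1).trans ?_
        gcongr
        exact hrow n
    _ = M ^ (r.toReal - 1) * ∑' j, (∑' n, k n j) * y j ^ r.toReal := by
        rw [ENNReal.tsum_mul_left, ENNReal.tsum_comm]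
        simp only [ENNReal.tsum_mul_right]
    _ ≤ M ^ (r.toReal - 1) * ∑' j, M * y j ^ r.toReal := by
        gcongr with j
        exact hcol j
    _ = _ := by
        have e : M ^ (r.toReal - 1) * M = M ^ r.toReal := by
          calc _ = M ^ (r.toReal - 1) * M ^ (1 : ℝ) := by rw [ENNReal.rpow_one]
            _ = _ := by rw [← ENNReal.rpow_add _ _ hM0 hM, sub_add_cancel]
        rw [ENNReal.tsum_mul_left, ← mul_assoc, e]

/-- Splitting at j = n leaves two sums, each dominated by the geometric series. -/
lemma tsum_pow_dist_le (κ : ℝ≥0∞) (n : ℕ) :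
    ∑' j : ℕ, κ ^ ((n - j) + (j - n)) ≤ 2 * (1 - κ)⁻¹ := by
  have h := ENNReal.summable.sum_add_tsum_nat_add' (k := n)
    (f := fun j => κ ^ ((n - j) + (j - n)))
  rw [← h, two_mul, ← ENNReal.tsum_geometric]
  refine add_le_add ?_ (le_of_eq (tsum_congr fun j => by congr 1; omega))
  rw [← Finset.sum_range_reflect]
  refine (Finset.sum_le_sum fun j hj => ?_).trans
    (ENNReal.sum_le_tsum (f := fun j => κ ^ (j + 1)) (Finset.range n)) |>.trans
    (ENNReal.tsum_comp_le_tsum_of_injective (add_left_injective 1) fun j => κ ^ j)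
  refine le_of_eq ?_
  have := Finset.mem_range.1 hj
  congr 1
  omega

/-- Schur's test for the matrix κ^{|n−j|}. The term z at j = 0 carries the L^ρ norm of θ coming from
the low frequencies. -/
lemma eLpNorm_le_of_le_tsum_pow_dist {κ : ℝ≥0∞} (hκ : κ < 1) {r : ℝ≥0∞} (hr : 1 ≤ r) :
    ∃ M : ℝ≥0∞, M ≠ ⊤ ∧ ∀ (x y : ℕ → ℝ≥0∞) (L z : ℝ≥0∞),
      (∀ n, x n ≤ L * ∑' j, κ ^ ((n - j) + (j - n)) * (y j + if j = 0 then z else 0)) →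
      eLpNorm x r Measure.count ≤ L * M * (eLpNorm y r Measure.count + z) := by
  have hM : 2 * (1 - κ)⁻¹ ≠ ⊤ :=
    ENNReal.mul_ne_top (by simp) (ENNReal.inv_ne_top.2 (tsub_pos_of_lt hκ).ne')
  have hM0 : 2 * (1 - κ)⁻¹ ≠ 0 := mul_ne_zero two_ne_zero
    (ENNReal.inv_ne_zero.2 (tsub_le_self.trans_lt ENNReal.one_lt_top).ne)
  refine ⟨2 * (1 - κ)⁻¹, hM, fun x y L z h => ?_⟩
  have h1 := eLpNorm_tsum_mul_le hM0 hM (tsum_pow_dist_le κ)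
    (fun j => by simpa only [add_comm (_ - j)] using tsum_pow_dist_le κ j) hr
    (fun j => y j + if j = 0 then z else 0)
  have h2 : eLpNorm (fun j : ℕ => y j + if j = 0 then z else 0) r Measure.count ≤
      eLpNorm y r Measure.count + z := by
    refine (eLpNorm_add_le (Measurable.of_discrete).aestronglyMeasurable
      (Measurable.of_discrete).aestronglyMeasurable hr).trans (add_le_add le_rfl ?_)
    have h3 : (fun j : ℕ => if j = 0 then z else 0) = Set.indicator {0} fun _ => z := by
      ext j; simp [Set.indicator_apply]
    rw [h3]
    refine (eLpNorm_indicator_const_le z r).trans ?_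
    simp
  refine (eLpNorm_le_mul_eLpNorm_of_ae_le_mul'' (c := L) r
    (g := fun n => ∑' j, κ ^ ((n - j) + (j - n)) * (y j + if j = 0 then z else 0))
    (Measurable.of_discrete).aestronglyMeasurable (Eventually.of_forall h)).trans ?_
  rw [mul_assoc]
  gcongr
  exact h1.trans (by gcongr)

/-! ### Comparison of weights -/

/-- Comparability is assumed in both directions because α may have either sign. -/
lemma rpow_le_rpow_mul_rpow {a b m : ℝ} (ha : 0 < a) (hb : 0 < b) (hm : 0 < m) (h1 : a ≤ m * b)
    (h2 : b ≤ m * a) (α : ℝ) : a ^ α ≤ m ^ |α| * b ^ α := by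
  rcases le_or_gt 0 α with h | h
  · rw [abs_of_nonneg h, ← Real.mul_rpow hm.le hb.le]
    exact Real.rpow_le_rpow ha.le h1 h
  · have h3 := Real.rpow_le_rpow_of_nonpos hb h2 h.le
    rw [Real.mul_rpow hm.le ha.le] at h3
    rw [abs_of_neg h]
    calc a ^ α = m ^ (-α) * (m ^ α * a ^ α) := by
          rw [← mul_assoc, ← Real.rpow_add hm]; simp
      _ ≤ _ := by gcongr

lemma exists_rpow_le_two_rpow {A δ : ℝ} (hA : 0 ≤ A) (hδ : 0 < δ) :
    ∃ C : ℝ, 0 < C ∧ ∀ k : ℕ, ((k : ℝ) + 1) ^ A ≤ C * 2 ^ (δ * k) := by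
  have hl : 0 < Real.log 2 := Real.log_pos one_lt_two
  -- Chosen so that ηA ≤ δ log 2; the denominator A + 1 also covers A = 0.
  set η := δ * Real.log 2 / (A + 1) with hη
  have hη0 : 0 < η := by positivity
  refine ⟨(η⁻¹) ^ A * Real.exp (δ * Real.log 2), by positivity, fun k => ?_⟩
  have h1 : ((k : ℝ) + 1) ≤ η⁻¹ * Real.exp (η * (k + 1)) := by
    rw [← div_eq_inv_mul, le_div_iff₀ hη0]
    have := Real.add_one_le_exp (η * ((k : ℝ) + 1))
    linarith
  have h2 : η * A ≤ δ * Real.log 2 := by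
    rw [hη, div_mul_eq_mul_div, div_le_iff₀ (by linarith)]
    have : 0 ≤ δ * Real.log 2 := by positivity
    linarith
  calc _ ≤ (η⁻¹ * Real.exp (η * (k + 1))) ^ A := Real.rpow_le_rpow (by positivity) h1 hA
    _ = η⁻¹ ^ A * Real.exp (η * A * (k + 1)) := by
        rw [Real.mul_rpow (by positivity) (by positivity), ← Real.exp_mul]; ring_nf
    _ ≤ η⁻¹ ^ A * Real.exp (δ * Real.log 2 * (k + 1)) := by gcongr
    _ = _ := by
        rw [Real.rpow_def_of_pos two_pos, mul_assoc (η⁻¹ ^ A), ← Real.exp_add]; ring_nf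

lemma abs_natCast_sub_one_add_one_le (j : ℕ) :
    (j : ℝ) + 1 ≤ 2 * (|(j : ℝ) - 1| + 1) ∧ |(j : ℝ) - 1| + 1 ≤ 2 * ((j : ℝ) + 1) := by
  have := Nat.cast_nonneg (α := ℝ) j
  rcases abs_cases ((j : ℝ) - 1) with h | h <;> constructor <;> linarith

/-- The weight `2 ^ (q s) (|q| + 1) ^ s'`, `q = j - 1`, of the Besov norm. -/
def besovWeight (s s' : ℝ) (j : ℕ) : ℝ :=
  (2 : ℝ) ^ (((j : ℝ) - 1) * s) * (|(j : ℝ) - 1| + 1) ^ s'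

/-- (n+1) and (j+1) are comparable up to the factor |n−j| + 1, and half of the decay 2^{-|n−j|}
absorbs the power |α| of this factor. The other half remains as κ = 2^{-1/2}. -/
lemma exists_twoDist_mul_le (α : ℝ) : ∃ C : ℝ≥0∞, C ≠ ⊤ ∧ ∃ κ : ℝ≥0∞, κ < 1 ∧ ∀ n j : ℕ,
    twoDist n j * (ENNReal.ofReal (((n : ℝ) + 1) ^ α) + ENNReal.ofReal (((j : ℝ) + 1) ^ α)) ≤
      C * (κ ^ ((n - j) + (j - n)) * ENNReal.ofReal (besovWeight 0 α j)) := by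
  obtain ⟨C, hC, h⟩ := exists_rpow_le_two_rpow (abs_nonneg α) (δ := 1 / 2) (by norm_num)
  set κ : ℝ := 2 ^ (-(1 / 2) : ℝ) with hκ
  have hκ0 : 0 < κ := by positivity
  have hκ1 : κ < 1 := Real.rpow_lt_one_of_one_lt_of_neg one_lt_two (by norm_num)
  refine ⟨ENNReal.ofReal (2 * C * 2 ^ |α|), by simp, ENNReal.ofReal κ, by simpa using hκ1,
    fun n j => ?_⟩
  set D := (n - j) + (j - n) with hD
  have e1 : twoDist n j = ENNReal.ofReal (2⁻¹ ^ D) := by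
    rw [inv_pow, ofReal_two_pow_inv]; rfl
  rw [e1, ← ENNReal.ofReal_add (by positivity) (by positivity),
    ← ENNReal.ofReal_mul (by positivity), ← ENNReal.ofReal_pow hκ0.le,
    ← ENNReal.ofReal_mul (by positivity), ← ENNReal.ofReal_mul (by positivity)]
  refine ENNReal.ofReal_le_ofReal ?_
  have hn0 := Nat.cast_nonneg (α := ℝ) n
  have hj0 := Nat.cast_nonneg (α := ℝ) j
  have hD0 := Nat.cast_nonneg (α := ℝ) D
  have hnD : (n : ℝ) ≤ j + D := by exact_mod_cast (by omega : n ≤ j + D)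
  have hjD : (j : ℝ) ≤ n + D := by exact_mod_cast (by omega : j ≤ n + D)
  have h1 := rpow_le_rpow_mul_rpow (a := (n : ℝ) + 1) (b := (j : ℝ) + 1) (m := (D : ℝ) + 1)
    (by positivity) (by positivity) (by positivity) (by nlinarith) (by nlinarith) α
  obtain ⟨w1, w2⟩ := abs_natCast_sub_one_add_one_le j
  have h2 := rpow_le_rpow_mul_rpow (by positivity) (by positivity) two_pos w1 w2 α
  have h3 : (1 : ℝ) ≤ ((D : ℝ) + 1) ^ |α| := Real.one_le_rpow (by linarith) (abs_nonneg α)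
  have h4 : (2 : ℝ)⁻¹ ^ D * 2 ^ (1 / 2 * D : ℝ) = κ ^ D := by
    rw [hκ, ← Real.rpow_natCast, ← Real.rpow_natCast, ← Real.rpow_neg_one, ← Real.rpow_mul two_pos.le,
      ← Real.rpow_mul two_pos.le, ← Real.rpow_add two_pos]
    congr 1
    ring
  have h5 : besovWeight 0 α j = (|(j : ℝ) - 1| + 1) ^ α := by simp [besovWeight]
  rw [h5]
  set X := (|(j : ℝ) - 1| + 1) ^ α with hX
  calc _ ≤ (2 : ℝ)⁻¹ ^ D * (((D : ℝ) + 1) ^ |α| * ((j : ℝ) + 1) ^ α +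
        ((D : ℝ) + 1) ^ |α| * ((j : ℝ) + 1) ^ α) := by
        have : 1 * ((j : ℝ) + 1) ^ α ≤ ((D : ℝ) + 1) ^ |α| * ((j : ℝ) + 1) ^ α := by gcongr
        gcongr
        linarith
    _ = 2 * (2 : ℝ)⁻¹ ^ D * ((D : ℝ) + 1) ^ |α| * ((j : ℝ) + 1) ^ α := by ring
    _ ≤ 2 * (2 : ℝ)⁻¹ ^ D * (C * 2 ^ (1 / 2 * D : ℝ)) * (2 ^ |α| * X) := by
        gcongr
        exact h D
    _ = 2 * C * 2 ^ |α| * (((2 : ℝ)⁻¹ ^ D * 2 ^ (1 / 2 * D : ℝ)) * X) := by ring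
    _ = _ := by rw [h4]

/-- The logarithmic weights are at most a constant times 2^{δ(n+j)}. The requested ratio is κ =
2^{-2δ}. -/
lemma exists_driftDist_mul_le (α : ℝ) {ε δ : ℝ} (hδ : 0 < δ) (hδ4 : δ ≤ 1 / 4)
    (hε : 3 * δ ≤ ε) : ∃ C : ℝ≥0∞, C ≠ ⊤ ∧ ∃ κ : ℝ≥0∞, κ < 1 ∧ ∀ n j : ℕ,
    driftDist δ n j * (ENNReal.ofReal (((n : ℝ) + 1) ^ α) + ENNReal.ofReal (((j : ℝ) + 1) ^ α)) ≤
      C * (κ ^ ((n - j) + (j - n)) * ENNReal.ofReal (besovWeight ε 0 j)) := by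
  obtain ⟨C, hC, h⟩ := exists_rpow_le_two_rpow (abs_nonneg α) hδ
  set κ : ℝ := 2 ^ (-(2 * δ) : ℝ) with hκ
  have hκ0 : 0 < κ := by positivity
  have hκ1 : κ < 1 := Real.rpow_lt_one_of_one_lt_of_neg one_lt_two (by linarith)
  refine ⟨ENNReal.ofReal (2 * C * 2 ^ ε), by simp, ENNReal.ofReal κ, by simpa using hκ1,
    fun n j => ?_⟩
  set D := (n - j) + (j - n) with hD
  have e1 : driftDist δ n j = ENNReal.ofReal ((2 ^ n) ^ δ * (2 ^ (n - j))⁻¹) := by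
    rw [ENNReal.ofReal_mul (by positivity), ofReal_two_pow_inv]; rfl
  rw [e1, ← ENNReal.ofReal_add (by positivity) (by positivity),
    ← ENNReal.ofReal_mul (by positivity), ← ENNReal.ofReal_pow hκ0.le]
  rw [besovWeight, Real.rpow_zero, mul_one, ← ENNReal.ofReal_mul (by positivity),
    ← ENNReal.ofReal_mul (by positivity)]
  refine ENNReal.ofReal_le_ofReal ?_
  have hn0 := Nat.cast_nonneg (α := ℝ) n
  have hj0 := Nat.cast_nonneg (α := ℝ) j
  have hD0 := Nat.cast_nonneg (α := ℝ) D
  have hw : ∀ m k : ℕ, ((m : ℝ) + 1) ^ α ≤ C * 2 ^ (δ * (m + k)) := fun m k => by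
    refine (Real.rpow_le_rpow_of_exponent_le (by linarith [Nat.cast_nonneg (α := ℝ) m])
      (le_abs_self α)).trans ((h m).trans ?_)
    gcongr
    · exact one_le_two
    · linarith [Nat.cast_nonneg (α := ℝ) k]
  have h1 := hw n j
  have h2 := hw j n
  rw [add_comm (j : ℝ) n] at h2
  have h3 : ((2 : ℝ) ^ n) ^ δ = 2 ^ (n * δ) := by
    rw [← Real.rpow_natCast, ← Real.rpow_mul two_pos.le]
  have h4 : ((2 : ℝ) ^ (n - j))⁻¹ = 2 ^ (-((n - j : ℕ) : ℝ)) := by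
    rw [Real.rpow_neg two_pos.le, Real.rpow_natCast]
  have h5 : κ ^ D = 2 ^ (-(2 * δ) * D) := by
    rw [hκ, ← Real.rpow_natCast, ← Real.rpow_mul two_pos.le]
  -- For n ≤ j the left side equals −2δ(j−n) + 3δj, whence 3δ ≤ ε. For n ≥ j it equals 2δ(n−j) + 3δj
  -- − (n−j), whence also 4δ ≤ 1. The separate ε on the right compensates the index shift q = j − 1
  -- in the Besov weight.
  have hexp : n * δ + -((n - j : ℕ) : ℝ) + δ * (n + j) ≤ ε + (-(2 * δ) * D + (j - 1) * ε) := by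
    have hjε : 3 * δ * j ≤ ε * j := by gcongr
    rcases le_total n j with hnj | hnj
    · have e2 : (n - j : ℕ) = 0 := by omega
      have e3 : (D : ℝ) = j - n := by rw [hD, e2, zero_add, Nat.cast_sub hnj]
      rw [e2, e3]
      push_cast
      linarith
    · have e2 : (j - n : ℕ) = 0 := by omega
      have e3 : (D : ℝ) = n - j := by rw [hD, e2, add_zero, Nat.cast_sub hnj]
      have e4 : δ * D ≤ 1 / 4 * D := by gcongr
      rw [Nat.cast_sub hnj, e3]
      rw [e3] at e4
      linarith
  calc _ ≤ ((2 : ℝ) ^ n) ^ δ * (2 ^ (n - j))⁻¹ * (C * 2 ^ (δ * ((n : ℝ) + j)) +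
        C * 2 ^ (δ * ((n : ℝ) + j))) := by gcongr
    _ = 2 * C * 2 ^ (n * δ + -((n - j : ℕ) : ℝ) + δ * (n + j)) := by
        rw [Real.rpow_add two_pos, Real.rpow_add two_pos, h3, h4]; ring
    _ ≤ 2 * C * 2 ^ (ε + (-(2 * δ) * D + (j - 1) * ε)) := by
        gcongr
        exact one_le_two
    _ = _ := by rw [Real.rpow_add two_pos, Real.rpow_add two_pos, h5]; ring

/-! ### Besov estimates for the commutator -/

lemma besovNorm_eq (P : LittlewoodPaley d) (s s' : ℝ) (p r : ℝ≥0∞) (u : 𝓢'(Space d, ℂ)) :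
    besovNorm P s s' p r u = eLpNorm (fun n : ℕ =>
      ENNReal.ofReal (besovWeight s s' n) * lpNorm p (multiplier (P.sym n) u)) r
        Measure.count := by
  simp only [besovNorm, P.block_eq, besovWeight]

/-- Common conclusion of both parts: the block bounds, the comparison of weights and Schur's test.
The exponents and the weight β are left free. -/
lemma exists_besovNorm_commutator_le [NeZero d] (P : LittlewoodPaley d) (α : ℝ) {lam : ℝ}
    (hlam : 1 < lam) {p ρ K r : ℝ≥0∞} (hp : 1 ≤ p) (hρ : 1 ≤ ρ) (hρt : ρ ≠ ⊤) (hK : K ≠ ⊤)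
    (hr : 1 ≤ r) {β : ℕ → ℕ → ℝ≥0∞} (hβ : 1 ≤ β 0 0) {s s' : ℝ}
    (hw : ∃ C : ℝ≥0∞, C ≠ ⊤ ∧ ∃ κ : ℝ≥0∞, κ < 1 ∧ ∀ n j : ℕ, β n j *
      (ENNReal.ofReal (((n : ℝ) + 1) ^ α) + ENNReal.ofReal (((j : ℝ) + 1) ^ α)) ≤
        C * (κ ^ ((n - j) + (j - n)) * ENNReal.ofReal (besovWeight s s' j))) :
    ∃ C : ℝ≥0, ∀ (v : Space d → Space d) (Λ : ℝ≥0∞) (u : 𝓢'(Space d, ℂ)), Λ ≠ ⊤ →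
      lpNorm ρ u ≠ ⊤ → CommBound P v p ρ K Λ β →
      ∃ A B : 𝓢'(Space d, ℂ), IsLogRiesz α lam (advect v u) A ∧ IsLogRiesz α lam u B ∧
        besovNorm P 0 0 p r (A - advect v B) ≤
          C * Λ * (besovNorm P s s' ⊤ r u + lpNorm ρ u) := by
  obtain ⟨C₁, hC₁, h₁⟩ := exists_commutator_bound P α hlam hp hρ hρt hK
  obtain ⟨C₂, hC₂, κ, hκ, h₂⟩ := hw
  obtain ⟨M, hM, h₃⟩ := eLpNorm_le_of_le_tsum_pow_dist hκ hr
  set W := ENNReal.ofReal (besovWeight s s' 0) with hW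
  have hCt : C₁ * C₂ * M * (1 + W) ≠ ⊤ := by finiteness
  refine ⟨(C₁ * C₂ * M * (1 + W)).toNNReal, fun v Λ u hΛ hu hcb => ?_⟩
  obtain ⟨A, B, hA, hB, hAB⟩ := h₁ v Λ β u hΛ hu hcb hβ
  refine ⟨A, B, hA, hB, ?_⟩
  rw [ENNReal.coe_toNNReal hCt, besovNorm_eq, besovNorm_eq]
  set Y : ℕ → ℝ≥0∞ := fun n =>
    ENNReal.ofReal (besovWeight s s' n) * lpNorm ⊤ (multiplier (P.sym n) u) with hY
  have h4 := h₃ (fun n => ENNReal.ofReal (besovWeight 0 0 n) *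
    lpNorm p (multiplier (P.sym n) (A - advect v B))) Y (C₁ * Λ * C₂) (W * lpNorm ρ u) fun n => by
      have e1 : besovWeight 0 0 n = 1 := by simp [besovWeight]
      rw [e1, ENNReal.ofReal_one, one_mul]
      refine (hAB n).trans ?_
      rw [mul_assoc _ C₂]
      refine mul_le_mul' le_rfl ?_
      rw [← ENNReal.tsum_mul_left]
      refine ENNReal.tsum_le_tsum fun j => ?_
      rw [← mul_assoc]
      refine (mul_le_mul' (h₂ n j) le_rfl).trans_eq ?_
      rw [hY]
      rcases eq_or_ne j 0 with rfl | hj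
      · simp only [if_true, hW]; ring
      · simp only [hj, if_false, add_zero]; ring
  refine h4.trans ?_
  calc C₁ * Λ * C₂ * M * (eLpNorm Y r Measure.count + W * lpNorm ρ u) ≤
        C₁ * Λ * C₂ * M * ((1 + W) * eLpNorm Y r Measure.count + (1 + W) * lpNorm ρ u) := by
        refine mul_le_mul' le_rfl (add_le_add ?_ ?_)
        · exact le_mul_of_one_le_left zero_le le_self_add
        · exact mul_le_mul' le_add_self le_rfl
    _ = _ := by ring

lemma lpNorm_lpDist {p : ℝ≥0∞} (hp : 1 ≤ p) {θ : Space d → ℝ} (hθ : MemLp θ p volume) :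
    lpNorm p (lpDist hp θ hθ) = eLpNorm θ p volume := by
  rw [(represents_lpDist hp θ hθ).lpNorm_eq hp]
  exact eLpNorm_congr_norm_ae (Eventually.of_forall fun x => Complex.norm_real _)

lemma eLpNorm_vorticity_ne_top {v : Space d → Space d} {ρ : ℝ≥0∞}
    (h : MemLp (fderiv ℝ v) ρ volume) : eLpNorm (vorticity v) ρ volume ≠ ⊤ := by
  have h1 : MemLp (fun x => ContinuousLinearMap.adjoint (fderiv ℝ v x)) ρ volume :=
    (ContinuousLinearMap.adjoint (𝕜 := ℝ) (E := Space d)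
      (F := Space d)).toLinearIsometry.toContinuousLinearMap.comp_memLp' h
  exact (h.sub h1).2.ne

end LogRiesz

end

/-! ### The two commutator estimates -/

theorem mainTheorem5 (d : ℕ) [NeZero d] (P : LogRiesz.LittlewoodPaley d)
    (α lam : ℝ) (hlam : 1 < lam) :
    (∀ (p r : ℝ≥0∞) (hp : 2 ≤ p), p ≠ (∞ : ℝ≥0∞) → 1 ≤ r →
      ∃ C : ℝ≥0, ∀ (v : LogRiesz.Space d → LogRiesz.Space d) (θ : LogRiesz.Space d → ℝ),
        Function.HasTemperateGrowth v → (∀ x, LogRiesz.divergence v x = 0) →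
        MemLp (fderiv ℝ v) p volume → ContDiff ℝ ∞ θ → ∀ hθ : MemLp θ p volume,
        ∃ A B : 𝓢'(LogRiesz.Space d, ℂ),
          LogRiesz.IsLogRiesz α lam
            (LogRiesz.advect v (LogRiesz.lpDist (one_le_two.trans hp) θ hθ)) A ∧
          LogRiesz.IsLogRiesz α lam (LogRiesz.lpDist (one_le_two.trans hp) θ hθ) B ∧
          LogRiesz.besovNorm P 0 0 p r (A - LogRiesz.advect v B) ≤
            C * eLpNorm (fderiv ℝ v) p volume *
              (LogRiesz.besovNorm P 0 α ∞ r (LogRiesz.lpDist (one_le_two.trans hp) θ hθ) +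
                eLpNorm θ p volume)) ∧
    (∀ (r ρ : ℝ≥0∞) (ε : ℝ) (hρ : 1 < ρ), ρ ≠ (∞ : ℝ≥0∞) → 1 ≤ r → 0 < ε →
      ∃ C : ℝ≥0, ∀ (v : LogRiesz.Space d → LogRiesz.Space d) (θ : LogRiesz.Space d → ℝ),
        Function.HasTemperateGrowth v → (∀ x, LogRiesz.divergence v x = 0) →
        MemLp (fderiv ℝ v) ρ volume → MemLp (LogRiesz.vorticity v) ∞ volume →
        ContDiff ℝ ∞ θ → ∀ hθ : MemLp θ ρ volume,
        ∃ A B : 𝓢'(LogRiesz.Space d, ℂ),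
          LogRiesz.IsLogRiesz α lam (LogRiesz.advect v (LogRiesz.lpDist hρ.le θ hθ)) A ∧
          LogRiesz.IsLogRiesz α lam (LogRiesz.lpDist hρ.le θ hθ) B ∧
          LogRiesz.besovNorm P 0 0 ∞ r (A - LogRiesz.advect v B) ≤
            C * (eLpNorm (LogRiesz.vorticity v) ∞ volume +
                eLpNorm (LogRiesz.vorticity v) ρ volume) *
              (LogRiesz.besovNorm P ε 0 ∞ r (LogRiesz.lpDist hρ.le θ hθ) +
                eLpNorm θ ρ volume)) := by
  constructor
  · intro p r hp hpt hr
    have hp1 : 1 ≤ p := one_le_two.trans hp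
    obtain ⟨K, hK, h⟩ := LogRiesz.exists_commBound P hp hpt
    obtain ⟨C, hC⟩ := LogRiesz.exists_besovNorm_commutator_le P α hlam hp1 hp1 hpt hK hr
      (by simp [LogRiesz.twoDist]) (LogRiesz.exists_twoDist_mul_le α)
    refine ⟨C, fun v θ hv hdiv hG _ hθ => ?_⟩
    have hn := LogRiesz.lpNorm_lpDist hp1 hθ
    have := hC v _ (LogRiesz.lpDist hp1 θ hθ) hG.2.ne (hn ▸ hθ.2.ne) (h v hv hdiv hG)
    rwa [hn] at this
  · intro r ρ ε hρ hρt hr hε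
    -- The Hölder loss δ of the velocity is chosen to meet the two constraints 3δ ≤ ε and 4δ ≤ 1 of
    -- the weight comparison.
    have hδ : 0 < min (ε / 3) (1 / 4) := by positivity
    have hδ4 : min (ε / 3) (1 / 4) ≤ 1 / 4 := min_le_right _ _
    have hδε : 3 * min (ε / 3) (1 / 4) ≤ ε := by linarith [min_le_left (ε / 3) (1 / 4)]
    obtain ⟨K, hK, h⟩ := LogRiesz.exists_commBound_top P hρ.le hρt hδ (by linarith)
    obtain ⟨C, hC⟩ := LogRiesz.exists_besovNorm_commutator_le P α hlam le_top hρ.le hρt hK hr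
      (by simp [LogRiesz.driftDist]) (LogRiesz.exists_driftDist_mul_le α hδ hδ4 hδε)
    refine ⟨C, fun v θ hv hdiv hG hω _ hθ => ?_⟩
    have hn := LogRiesz.lpNorm_lpDist hρ.le hθ
    have := hC v _ (LogRiesz.lpDist hρ.le θ hθ)
      (ENNReal.add_ne_top.2 ⟨hω.2.ne, LogRiesz.eLpNorm_vorticity_ne_top hG⟩)
      (hn ▸ hθ.2.ne) (h v hv hdiv hG hω.2.ne)
    rwa [hn] at this
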